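/- **Setting.** For $d\ge 1$ let $\mathbb M_d^{sa}$ be the real space of self-adjoint complex $d\times d$ matrices with the operator norm $\|\cdot\|$, and let $\mathbb M_d^{+}$, $\mathbb M_d^{++}$ be its subsets of positive semidefinite and positive definite matrices. $\operatorname{Tr}$ is the trace, $\operatorname{tr}=\frac1d\operatorname{Tr}$, and $\langle h,k\rangle=\operatorname{Tr}[hk]$. For a scalar function $f$, $f(A)$ is the standard matrix function, and $\mathsf D^m f[A]$ is the $m$-th Fréchet derivative of $A\mapsto f(A)$ on $\mathbb M_d^{sa}$. The class $\Phi_d$ consists of the functions $\Phi$ on $[0,\infty)$ that are either affine, or are convex, continuous at zero, twice continuously differentiable on $(0,\infty)$ and such that, with $\Psi=\Phi'$, the linear map $\mathsf D\Psi[A]$ on $\mathbb M_d^{sa}$ is invertible for each $A\in\mathbb M_d^{++}$ and $A\mapsto(\mathsf D\Psi[A])^{-1}$ is concave on $\mathbb M_d^{++}$ for the semidefinite order on linear operators on $(\mathbb M_d^{sa},\langle\cdot,\cdot\rangle)$ (that is, $A\mapsto\langle h,(\mathsf D\Psi[A])^{-1}(h)\rangle$ is concave for each $h\in\mathbb M_d^{sa}$).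 Put $\mathbf{(C2)}=\bigcap_{d\ge1}\Phi_d$. For a probability space $(\Omega,P)$ and a random matrix $Z:\Omega\to\mathbb M_d^{+}$ with $\mathbb E\|Z\|<\infty$ and $\mathbb E\|\Phi(Z)\|<\infty$, put $H_\Phi(Z)=\operatorname{tr}[\mathbb E\Phi(Z)-\Phi(\mathbb EZ)]$. Below, "admissible" means that $Z$ satisfies these conditions. **Theorem.** Let $\Phi:[0,\infty)\to\mathbb R$ be convex, continuous at zero, and twice continuously differentiable on $(0,\infty)$, and let $\Psi=\Phi'$. The following statements (a)–(d), (f)–(j), in which $d$ ranges over all integers $\ge1$ and the probability spaces are arbitrary, are equivalent. * (a) $\Phi\in\mathbf{(C2)}$. * (b) $(A,B)\mapsto\operatorname{Tr}[\Phi(A+B)-\Phi(A)-\mathsf D\Phi[A](B)]$ is convex on $\{(A,B): A\in\mathbb M_d^{++},\ A+B\in\mathbb M_d^{++}\}$. * (c) $(A,B)\mapsto\operatorname{Tr}[\mathsf D\Phi[A+B](B)-\mathsf D\Phi[A](B)]$ is convex on the same set. * (d) $(A,B)\mapsto\operatorname{Tr}[\mathsf D^2\Phi[A](B,B)]$ is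 convex on $\mathbb M_d^{++}\times\mathbb M_d^{sa}$. * (f) For each $t\in[0,1]$, $(A,B)\mapsto\operatorname{Tr}[t\Phi(A)+(1-t)\Phi(B)-\Phi(tA+(1-t)B)]$ is convex on $\mathbb M_d^+\times\mathbb M_d^+$. * (g) If $X_1,X_2$ are independent, i.e. the coordinates of a product $(\Omega_1\times\Omega_2,P_1\otimes P_2)$ of two probability spaces, then for each admissible $Z=Z(X_1,X_2)$ $$\mathbb E_1H_\Phi(Z|X_1)\ge H_\Phi(\mathbb E_1Z),$$ where $\mathbb E_1$ is the integral over $X_1$ and $H_\Phi(Z|X_1)$ is the entropy of $x_2\mapsto Z(X_1,x_2)$. * (h) On each probability space, the set of admissible random matrices is convex and $Z\mapsto H_\Phi(Z)$ is convex on it. * (i) For each probability space and each admissible $Z$, $$H_\Phi(Z)=\sup_{T\succ0}\left\{\operatorname{tr}\mathbb E\left[(\Phi'(T)-\Phi'(\mathbb ET))(Z-T)\right]+H_\Phi(T)\right\},$$ where $T$ ranges over the random positive definite matrices on the same space for which $\|T\|$, $\|\Phi(T)\|$ and $(\Phi'(T)-\Phi'(\mathbb ET))(Z-T)$ are integrable.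 * (j) For each $n$, if $X_1,\dots,X_n$ are independent, i.e. the coordinates of a product of $n$ probability spaces, then for each admissible $Z=Z(X_1,\dots,X_n)$ $$H_\Phi(Z)\le\sum_{i=1}^n\mathbb E\,H^{(i)}_\Phi(Z),\qquad H_\Phi^{(i)}(Z)=\operatorname{tr}[\mathbb E_i\Phi(Z)-\Phi(\mathbb E_iZ)],$$ where $\mathbb E_i$ is the integral over $X_i$ with the other coordinates fixed (the conditional expectation given $(X_j)_{j\ne i}$). If moreover $\Phi$ is four times continuously differentiable on $(0,\infty)$, they are also equivalent to * (e) $\Phi$ is affine, or $\Phi''>0$ on $(0,\infty)$ and for all $d\ge1$, $A\in\mathbb M_d^{++}$ and $h,k\in\mathbb M_d^{sa}$, with $\mathsf T=\mathsf D\Psi[A]$, $$\operatorname{Tr}\left[h\cdot\mathsf T^{-1}\left(\mathsf D^3\Psi[A](k,k,\mathsf T^{-1}(h))\right)\right]\ \ge\ 2\operatorname{Tr}\left[h\cdot\mathsf T^{-1}\left(\mathsf D^2\Psi[A]\left(k,\mathsf T^{-1}\left(\mathsf D^2\Psi[A](k,\mathsf T^{-1}(h))\right)\right)\right)\right].$$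 Finally, the functionals $H_\Phi$, $\Phi\in\mathbf{(C2)}$, which are convex by (h), form a convex set: $\mathbf{(C2)}$ is convex, and for $\Phi_1,\Phi_2\in\mathbf{(C2)}$ and $\theta\in[0,1]$, each $Z$ that is admissible for $\Phi_1$ and $\Phi_2$ is admissible for $\theta\Phi_1+(1-\theta)\Phi_2$, with $H_{\theta\Phi_1+(1-\theta)\Phi_2}(Z)=\theta H_{\Phi_1}(Z)+(1-\theta)H_{\Phi_2}(Z)$. -/

import Mathlib

open MeasureTheory
open scoped Matrix.Norms.L2Operator ComplexOrder

universe u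

namespace MatrixPhiEntropy

noncomputable section

/-- The real normed space of self-adjoint `d × d` complex matrices, with the operator norm. -/
abbrev Herm (d : ℕ) : Type := selfAdjoint (Matrix (Fin d) (Fin d) ℂ)

variable {d : ℕ}

/-- `A` is positive semidefinite. -/
def IsPSD (A : Herm d) : Prop := (A : Matrix (Fin d) (Fin d) ℂ).PosSemidef

/-- `A` is positive definite. -/
def IsPD (A : Herm d) : Prop := (A : Matrix (Fin d) (Fin d) ℂ).PosDef

/-- The standard matrix function `A ↦ f(A)`: apply `f` to the eigenvalues of `A`. -/
def matFun (f : ℝ → ℝ) (A : Herm d) : Herm d :=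
  ⟨cfc f (A : Matrix (Fin d) (Fin d) ℂ), cfc_predicate f _⟩

/-- The trace of a self-adjoint matrix, which is a real number. -/
def tr (A : Herm d) : ℝ := (Matrix.trace (A : Matrix (Fin d) (Fin d) ℂ)).re

/-- The Hilbert-Schmidt inner product `Tr[A B]` of two self-adjoint matrices. -/
def hs (A B : Herm d) : ℝ :=
  (Matrix.trace ((A : Matrix (Fin d) (Fin d) ℂ) * (B : Matrix (Fin d) (Fin d) ℂ))).re

/-- The first Fréchet derivative `Df[A]`. -/
def D1 (f : ℝ → ℝ) (A : Herm d) : Herm d →L[ℝ] Herm d :=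
  fderiv ℝ (matFun f : Herm d → Herm d) A

/-- The second Fréchet derivative `D²f[A](h, k)`. -/
def D2 (f : ℝ → ℝ) (A h k : Herm d) : Herm d :=
  iteratedFDeriv ℝ 2 (matFun f : Herm d → Herm d) A ![h, k]

/-- The third Fréchet derivative `D³f[A](h, k, l)`. -/
def D3 (f : ℝ → ℝ) (A h k l : Herm d) : Herm d :=
  iteratedFDeriv ℝ 3 (matFun f : Herm d → Herm d) A ![h, k, l]

/-- The inverse `(Df[A])⁻¹` of the linear map `Df[A]`. -/
def D1inv (f : ℝ → ℝ) (A : Herm d) : Herm d →L[ℝ] Herm d := (D1 f A).inverse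

/-! ### The class of entropy functions -/

/-- `Φ` is affine on `[0, ∞)`. -/
def IsAffine (Φ : ℝ → ℝ) : Prop := ∃ a b : ℝ, ∀ t, 0 ≤ t → Φ t = a * t + b

/-- The class `Φ_d`. Operator concavity of `A ↦ (DΨ[A])⁻¹`, `Ψ = Φ'`, refers to the
semidefinite order on linear operators on the Hilbert-Schmidt space of self-adjoint matrices. -/
def ClassPhi (d : ℕ) (Φ : ℝ → ℝ) : Prop :=
  IsAffine Φ ∨
    (ConvexOn ℝ (Set.Ici 0) Φ ∧ ContinuousWithinAt Φ (Set.Ici 0) 0 ∧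
      ContDiffOn ℝ 2 Φ (Set.Ioi 0) ∧
      (∀ A : Herm d, IsPD A → (D1 (deriv Φ) A).IsInvertible) ∧
      ∀ h : Herm d, ConcaveOn ℝ {A : Herm d | IsPD A} (fun A => hs h (D1inv (deriv Φ) A h)))

/-- The class (C2): the intersection of the classes `Φ_d` over all dimensions `d ≥ 1`. -/
def ClassC2 (Φ : ℝ → ℝ) : Prop := ∀ d : ℕ, 1 ≤ d → ClassPhi d Φ

/-! ### Convexity of trace functions -/

/-- Joint convexity of the trace Brègman divergence. -/
def BregmanConvex (Φ : ℝ → ℝ) : Prop :=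
  ∀ d : ℕ, 1 ≤ d → ConvexOn ℝ {p : Herm d × Herm d | IsPD p.1 ∧ IsPD (p.1 + p.2)}
    (fun p => tr (matFun Φ (p.1 + p.2) - matFun Φ p.1 - D1 Φ p.1 p.2))

/-- Joint convexity of `(A, B) ↦ Tr[DΦ[A+B](B) - DΦ[A](B)]`. -/
def DerivDiffConvex (Φ : ℝ → ℝ) : Prop :=
  ∀ d : ℕ, 1 ≤ d → ConvexOn ℝ {p : Herm d × Herm d | IsPD p.1 ∧ IsPD (p.1 + p.2)}
    (fun p => tr (D1 Φ (p.1 + p.2) p.2 - D1 Φ p.1 p.2))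

/-- Joint convexity of `(A, B) ↦ Tr[D²Φ[A](B, B)]`. -/
def SecondDerivConvex (Φ : ℝ → ℝ) : Prop :=
  ∀ d : ℕ, 1 ≤ d → ConvexOn ℝ {p : Herm d × Herm d | IsPD p.1}
    (fun p => tr (D2 Φ p.1 p.2 p.2))

/-- The differential inequality generalising `Φ'''' Φ'' ≥ 2 Φ'''²`, with `Ψ = Φ'`. -/
def ThirdDerivIneq (Φ : ℝ → ℝ) : Prop :=
  IsAffine Φ ∨
    ((∀ t : ℝ, 0 < t → 0 < deriv (deriv Φ) t) ∧
      ∀ d : ℕ, 1 ≤ d → ∀ A h k : Herm d, IsPD A →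
        hs h (D1inv (deriv Φ) A (D3 (deriv Φ) A k k (D1inv (deriv Φ) A h))) ≥
          2 * hs h (D1inv (deriv Φ) A (D2 (deriv Φ) A k
            (D1inv (deriv Φ) A (D2 (deriv Φ) A k (D1inv (deriv Φ) A h))))))

/-- Joint convexity of `(A, B) ↦ Tr[tΦ(A) + (1-t)Φ(B) - Φ(tA + (1-t)B)]` for all `t ∈ [0, 1]`. -/
def JensenGapConvex (Φ : ℝ → ℝ) : Prop :=
  ∀ t : ℝ, 0 ≤ t → t ≤ 1 → ∀ d : ℕ, 1 ≤ d →
    ConvexOn ℝ {p : Herm d × Herm d | IsPSD p.1 ∧ IsPSD p.2}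
      (fun p => tr (t • matFun Φ p.1 + (1 - t) • matFun Φ p.2
        - matFun Φ (t • p.1 + (1 - t) • p.2)))

/-! ### Matrix entropies -/

/-- The domain of the entropy functional: random positive semidefinite matrices `Z` for which
`‖Z‖` and `‖Φ(Z)‖` are integrable. -/
def EntropyDomain {Ω : Type u} [MeasurableSpace Ω] (Φ : ℝ → ℝ) (P : Measure Ω)
    (Z : Ω → Herm d) : Prop :=
  (∀ ω, IsPSD (Z ω)) ∧ Integrable Z P ∧ Integrable (fun ω => matFun Φ (Z ω)) P

/-- The matrix entropy `H_Φ(Z) = d⁻¹ Tr[E Φ(Z) - Φ(E Z)]`. -/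
def entropy {Ω : Type u} [MeasurableSpace Ω] (Φ : ℝ → ℝ) (P : Measure Ω)
    (Z : Ω → Herm d) : ℝ :=
  (d : ℝ)⁻¹ * tr ((∫ ω, matFun Φ (Z ω) ∂P) - matFun Φ (∫ ω, Z ω ∂P))

/-- Conditional Jensen inequality `E₁ H_Φ(Z | X₁) ≥ H_Φ(E₁ Z)`, where `X₁, X₂` are the
coordinates of a product of two probability spaces and `Z` is a function of `(X₁, X₂)`. -/
def ConditionalJensen (Φ : ℝ → ℝ) : Prop :=
  ∀ d : ℕ, 1 ≤ d → ∀ (Ω₁ Ω₂ : Type u) [MeasurableSpace Ω₁] [MeasurableSpace Ω₂]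
    (P₁ : Measure Ω₁) (P₂ : Measure Ω₂) [IsProbabilityMeasure P₁] [IsProbabilityMeasure P₂]
    (Z : Ω₁ × Ω₂ → Herm d), EntropyDomain Φ (P₁.prod P₂) Z →
      ∫ x₁, entropy Φ P₂ (fun x₂ => Z (x₁, x₂)) ∂P₁ ≥
        entropy Φ P₂ (fun x₂ => ∫ x₁, Z (x₁, x₂) ∂P₁)

/-- `Z ↦ H_Φ(Z)` is a convex function of the random matrix `Z`. -/
def EntropyConvex (Φ : ℝ → ℝ) : Prop :=
  ∀ d : ℕ, 1 ≤ d → ∀ (Ω : Type u) [MeasurableSpace Ω] (P : Measure Ω) [IsProbabilityMeasure P],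
    ConvexOn ℝ {Z : Ω → Herm d | EntropyDomain Φ P Z} (fun Z => entropy Φ P Z)

/-- The range of the supremum representation of `H_Φ(Z)`: random positive definite matrices `T`
with `‖T‖`, `‖Φ(T)‖` integrable, for which the expectation that occurs in it exists. -/
def SupRange {Ω : Type u} [MeasurableSpace Ω] (Φ : ℝ → ℝ) (P : Measure Ω)
    (Z T : Ω → Herm d) : Prop :=
  (∀ ω, IsPD (T ω)) ∧ Integrable T P ∧ Integrable (fun ω => matFun Φ (T ω)) P ∧
    Integrable (fun ω => ((matFun (deriv Φ) (T ω) - matFun (deriv Φ) (∫ ω', T ω' ∂P) : Herm d) :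
      Matrix (Fin d) (Fin d) ℂ) * ((Z ω - T ω : Herm d) : Matrix (Fin d) (Fin d) ℂ)) P

/-- `H_Φ(Z) = sup_{T ≻ 0} { tr E[(Φ'(T) - Φ'(E T)) (Z - T)] + H_Φ(T) }`, `tr` being the
normalised trace. -/
def SupRepresentation (Φ : ℝ → ℝ) : Prop :=
  ∀ d : ℕ, 1 ≤ d → ∀ (Ω : Type u) [MeasurableSpace Ω] (P : Measure Ω) [IsProbabilityMeasure P]
    (Z : Ω → Herm d), EntropyDomain Φ P Z →
      IsLUB {r : ℝ | ∃ T : Ω → Herm d, SupRange Φ P Z T ∧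
        r = (d : ℝ)⁻¹ * (Matrix.trace (∫ ω,
            ((matFun (deriv Φ) (T ω) - matFun (deriv Φ) (∫ ω', T ω' ∂P) : Herm d) :
              Matrix (Fin d) (Fin d) ℂ) *
            ((Z ω - T ω : Herm d) : Matrix (Fin d) (Fin d) ℂ) ∂P)).re + entropy Φ P T}
        (entropy Φ P Z)

/-- Subadditivity `H_Φ(Z) ≤ ∑ᵢ E H_Φ⁽ⁱ⁾(Z)`, where `Z` is a function of the coordinates of a
finite product of probability spaces, and `H_Φ⁽ⁱ⁾(Z)` is the entropy in the `i`-th coordinate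
with all other coordinates held fixed. -/
def EntropySubadditive (Φ : ℝ → ℝ) : Prop :=
  ∀ d : ℕ, 1 ≤ d → ∀ (n : ℕ) (Ω : Fin n → Type u) [∀ i, MeasurableSpace (Ω i)]
    (P : ∀ i, Measure (Ω i)) [∀ i, IsProbabilityMeasure (P i)]
    (Z : (∀ i, Ω i) → Herm d), EntropyDomain Φ (Measure.pi P) Z →
      entropy Φ (Measure.pi P) Z ≤
        ∑ i, ∫ ω, entropy Φ (P i) (fun x => Z (Function.update ω i x)) ∂(Measure.pi P)

/-- The entropies `H_Φ`, `Φ ∈ (C2)`, form a convex set of functionals: (C2) is convex, and a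
convex combination of two entropies is the entropy of the same combination of the functions. -/
def EntropiesConvexSet : Prop :=
  Convex ℝ {Φ : ℝ → ℝ | ClassC2 Φ} ∧
  ∀ Φ₁ Φ₂ : ℝ → ℝ, ClassC2 Φ₁ → ClassC2 Φ₂ → ∀ θ : ℝ, 0 ≤ θ → θ ≤ 1 →
    ∀ d : ℕ, 1 ≤ d → ∀ (Ω : Type u) [MeasurableSpace Ω] (P : Measure Ω) [IsProbabilityMeasure P]
      (Z : Ω → Herm d), EntropyDomain Φ₁ P Z → EntropyDomain Φ₂ P Z →
        EntropyDomain (θ • Φ₁ + (1 - θ) • Φ₂) P Z ∧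
        entropy (θ • Φ₁ + (1 - θ) • Φ₂) P Z =
          θ * entropy Φ₁ P Z + (1 - θ) * entropy Φ₂ P Z

end

end MatrixPhiEntropy

open MatrixPhiEntropy

/-!
# Matrix entropies and the class (C2)

Write `g A = Tr Φ(A)` and `Ψ = Φ'`. All the conditions are equivalent to one, `HessConvex Φ`: the
Hessian form `(A, B) ↦ ⟨B, DΨ[A](B)⟩` of `g` is jointly convex in every dimension.

*Smoothness.* Left and right multiplication by `B` and `A` commute, and
`f(B) - f(A) = ∫₀¹ f'(s L_B + (1 - s) R_A) ds (B - A)` (`hermFun_sub`), where the integrand is a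
matrix function in dimension `d²`. Hence `A ↦ f(A)` is `C^k` on positive definite matrices if `f` is
(`contDiffOn_hermFun`, by induction on `k` over all dimensions), and in an eigenbasis of `A` the
derivative is a Schur multiplier (`exists_hs_D1`). So `DΨ[A]` is symmetric, it is positive where
`Φ'' > 0`, `Tr DΦ[A](B) = ⟨Ψ(A), B⟩`, and `Tr D²Φ[A](B, B)` is the Hessian form of `g`.

*Convexity of trace functions.* For a `C²` function `g` on an open convex set, joint convexity of
the Hessian form, of the Brègman divergence, of the difference of gradients and of the Jensen gap
are equivalent: one integrates along segments, or takes second order limits (`TwiceDiff`).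
Continuity of `g` extends the Jensen gap to semidefinite matrices.

*The class (C2).* As `⟨h, T⁻¹ h⟩ = sup_x (2⟨h, x⟩ - ⟨x, T x⟩)` for positive `T`, concavity of
`A ↦ ⟨h, DΨ[A]⁻¹ h⟩` for all `h` is convexity of the Hessian form (`concaveOn_inverse_iff`).
A zero of `Φ''` forces `Φ` to be affine (`isAffine_or_pos`), so invertibility is automatic otherwise.
The inequality for the third derivative states that the second derivative of
`s ↦ ⟨h, DΨ[A + s k]⁻¹ h⟩` is nonpositive.

*Entropies.* Integrating the tangent inequality of the Brègman divergence at the pair `(E T, T)`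
bounds the entropy of `Z` below by the functional
`E ⟨Ψ(T) - Ψ(E T), Z - T⟩ + E g(T) - g(E T)`, which is affine in `Z` (`dual_le_gap`). For the
truncations `T` of `Z` to `[1 / n, n]` these values approach the entropy of `Z`
(`le_dual_trunc`, `tendsto_lower_bound`). Thus the entropy is a supremum of affine functionals;
it is convex, and it satisfies the conditional Jensen inequality because the functionals commute
with partial expectations. Subadditivity follows from the conditional Jensen inequality by induction
on the number of variables, through the chain rule `gap_prod`. Conversely, on two-point probability
spaces each of these properties is joint convexity of the Jensen gap.
-/

namespace MatrixPhiEntropy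

noncomputable section

open Matrix Set Filter Topology
open scoped Kronecker

/-! ### Functional calculus and spectral positivity -/

section Spectral

theorem isSelfAdjoint_coe {m : Type} (A : selfAdjoint (Matrix m m ℂ)) :
    IsSelfAdjoint (A : Matrix m m ℂ) := A.2

variable {n : Type} [Fintype n] [DecidableEq n]

instance : FiniteDimensional ℝ (selfAdjoint (Matrix n n ℂ)) := by
  have : FiniteDimensional ℝ (Matrix n n ℂ) := FiniteDimensional.trans ℝ ℂ _
  refine FiniteDimensional.of_injective
    ({ toFun := fun A => (A : Matrix n n ℂ)
       map_add' := fun _ _ => rfl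
       map_smul' := fun _ _ => rfl } : selfAdjoint (Matrix n n ℂ) →ₗ[ℝ] Matrix n n ℂ) ?_
  exact Subtype.val_injective


/-- A Hermitian matrix is positive definite iff its spectrum is positive. -/
theorem posDef_iff_spectrum {A : Matrix n n ℂ} (hA : A.IsHermitian) :
    A.PosDef ↔ spectrum ℝ A ⊆ Ioi 0 := by
  rw [hA.posDef_iff_eigenvalues_pos, hA.spectrum_real_eq_range_eigenvalues]
  exact ⟨fun h x ⟨i, hi⟩ => hi ▸ h i, fun h i => h ⟨i, rfl⟩⟩

theorem posSemidef_iff_spectrum {A : Matrix n n ℂ} (hA : A.IsHermitian) :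
    A.PosSemidef ↔ spectrum ℝ A ⊆ Ici 0 := by
  rw [hA.posSemidef_iff_eigenvalues_nonneg, hA.spectrum_real_eq_range_eigenvalues]
  exact ⟨fun h x ⟨i, hi⟩ => hi ▸ h i, fun h i => h ⟨i, rfl⟩⟩

theorem isOpen_posDef : IsOpen {A : selfAdjoint (Matrix n n ℂ) | (A : Matrix n n ℂ).PosDef} := by
  have h : {A : selfAdjoint (Matrix n n ℂ) | (A : Matrix n n ℂ).PosDef} =
      (fun A : selfAdjoint (Matrix n n ℂ) => (A : Matrix n n ℂ)) ⁻¹'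
        {a | spectrum ℝ a ⊆ Ioi 0} := by
    ext A
    exact posDef_iff_spectrum A.2
  rw [h]
  refine IsOpen.preimage continuous_subtype_val ?_
  exact upperHemicontinuous_iff_isOpen_preimage_Iic.1 (upperHemicontinuous_spectrum ℝ _) _ isOpen_Ioi

/-- Every function is continuous on the (finite) spectrum of a matrix. -/
theorem continuousOn_spectrum (f : ℝ → ℝ) (A : Matrix n n ℂ) :
    ContinuousOn f (spectrum ℝ A) :=
  (Matrix.finite_real_spectrum (A := A)).continuousOn f

theorem diagonal_cfc (μ : n → ℝ) (f : ℝ → ℝ) :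
    cfc f (Matrix.diagonal (fun i => (μ i : ℂ))) = Matrix.diagonal (fun i => (f (μ i) : ℂ)) := by
  obtain ⟨q, hq⟩ : ∃ q : Polynomial ℝ, ∀ i, q.eval (μ i) = f (μ i) := by
    classical
    refine ⟨Lagrange.interpolate (Finset.univ.image μ) id f, fun i => ?_⟩
    exact Lagrange.eval_interpolate_at_node (v := id) f (Function.injective_id.injOn)
      (Finset.mem_image_of_mem _ (Finset.mem_univ i))
  have hH : IsSelfAdjoint (Matrix.diagonal (fun i => (μ i : ℂ))) := by
    rw [isSelfAdjoint_iff, star_eq_conjTranspose, diagonal_conjTranspose]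
    congr 1
    ext i
    simp
  have hspec : spectrum ℝ (Matrix.diagonal (fun i => (μ i : ℂ))) ⊆ range μ := by
    intro x hx
    have := spectrum.algebraMap_mem ℂ hx
    rw [spectrum_diagonal] at this
    obtain ⟨i, hi⟩ := this
    exact ⟨i, by simpa using hi⟩
  have h1 : cfc f (Matrix.diagonal (fun i => (μ i : ℂ))) =
      cfc (fun x => q.eval x) (Matrix.diagonal (fun i => (μ i : ℂ))) := by
    refine cfc_congr fun x hx => ?_
    obtain ⟨i, rfl⟩ := hspec hx
    exact (hq i).symm
  rw [h1, cfc_polynomial q _ hH]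
  have h2 : Matrix.diagonal (fun i => (μ i : ℂ)) =
      (Matrix.diagonalAlgHom ℝ (fun i => (μ i : ℂ)) : Matrix n n ℂ) := rfl
  rw [h2, Polynomial.aeval_algHom_apply]
  show Matrix.diagonal _ = _
  congr 1
  ext i
  rw [← hq i]
  have := Polynomial.aeval_algHom_apply (Pi.evalAlgHom ℝ (fun _ : n => ℂ) i) (fun i => (μ i : ℂ)) q
  simp only [Pi.evalAlgHom_apply] at this
  rw [← this]
  simpa using Polynomial.aeval_algebraMap_apply ℂ (μ i) q

theorem cfc_conj_diagonal {W : Matrix n n ℂ} (hW : W ∈ unitaryGroup n ℂ) (μ : n → ℝ) (f : ℝ → ℝ) :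
    cfc f (W * Matrix.diagonal (fun i => (μ i : ℂ)) * star W) =
      W * Matrix.diagonal (fun i => (f (μ i) : ℂ)) * star W := by
  have hH : IsSelfAdjoint (Matrix.diagonal (fun i => (μ i : ℂ))) := by
    rw [isSelfAdjoint_iff, star_eq_conjTranspose, diagonal_conjTranspose]
    congr 1
    ext i
    simp
  have hφ : Continuous (Unitary.conjStarAlgAut ℝ (Matrix n n ℂ) ⟨W, hW⟩) := by
    have : ⇑(Unitary.conjStarAlgAut ℝ (Matrix n n ℂ) ⟨W, hW⟩) = fun X => W * X * star W := by
      ext1 X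
      exact Unitary.conjStarAlgAut_apply _ _
    rw [this]
    fun_prop
  have := StarAlgHomClass.map_cfc (S := ℝ) (Unitary.conjStarAlgAut ℝ (Matrix n n ℂ) ⟨W, hW⟩) f
    (Matrix.diagonal (fun i => (μ i : ℂ))) (continuousOn_spectrum _ _) hφ hH (hH.map _)
  rw [diagonal_cfc, Unitary.conjStarAlgAut_apply, Unitary.conjStarAlgAut_apply] at this
  exact this.symm

/-- The spectral theorem in the form `A = U diag(a) U*`. -/
theorem exists_diagonalization (A : selfAdjoint (Matrix n n ℂ)) :
    ∃ U ∈ unitaryGroup n ℂ, ∃ a : n → ℝ,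
      (A : Matrix n n ℂ) = U * Matrix.diagonal (fun i => (a i : ℂ)) * star U ∧
      (∀ i, a i ∈ spectrum ℝ (A : Matrix n n ℂ)) := by
  have hA : (A : Matrix n n ℂ).IsHermitian := A.2
  refine ⟨hA.eigenvectorUnitary, hA.eigenvectorUnitary.2, hA.eigenvalues, ?_,
    hA.eigenvalues_mem_spectrum_real⟩
  exact hA.spectral_theorem

end Spectral

/-! ### Linear functionals and the positive cone -/

section Herm

variable {d : ℕ}

/-- The quadratic form `A ↦ v* A v` of a vector `v`. -/
def quadForm (v : Fin d → ℂ) : Herm d →L[ℝ] ℝ :=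
  LinearMap.toContinuousLinearMap
    { toFun := fun A => (star v ⬝ᵥ ((A : Matrix (Fin d) (Fin d) ℂ) *ᵥ v)).re
      map_add' := fun A B => by simp [Matrix.add_mulVec]
      map_smul' := fun c A => by simp [Matrix.smul_mulVec] }

/-- The trace as a continuous linear functional. -/
def trCLM : Herm d →L[ℝ] ℝ :=
  LinearMap.toContinuousLinearMap
    { toFun := tr
      map_add' := fun A B => by simp [tr]
      map_smul' := fun c A => by simp [tr] }

/-- The Hilbert-Schmidt inner product as a continuous bilinear form. -/
def hsCLM : Herm d →L[ℝ] Herm d →L[ℝ] ℝ :=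
  LinearMap.toContinuousLinearMap
    { toFun := fun A => LinearMap.toContinuousLinearMap
        { toFun := hs A
          map_add' := fun B C => by simp [hs, mul_add]
          map_smul' := fun c B => by simp [hs] }
      map_add' := fun A B => by
        ext C
        show hs (A + B) C = hs A C + hs B C
        simp [hs, add_mul]
      map_smul' := fun c A => by
        ext C
        show hs (c • A) C = c * hs A C
        simp [hs] }

@[simp] theorem hsCLM_apply (A B : Herm d) : hsCLM A B = hs A B := rfl

theorem tr_add (A B : Herm d) : tr (A + B) = tr A + tr B := trCLM.map_add A B
theorem tr_sub (A B : Herm d) : tr (A - B) = tr A - tr B := trCLM.map_sub A B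
theorem tr_smul (c : ℝ) (A : Herm d) : tr (c • A) = c * tr A := trCLM.map_smul c A
theorem hs_add_right (A B C : Herm d) : hs A (B + C) = hs A B + hs A C := (hsCLM A).map_add B C
theorem hs_sub_right (A B C : Herm d) : hs A (B - C) = hs A B - hs A C := (hsCLM A).map_sub B C
theorem hs_smul_right (c : ℝ) (A B : Herm d) : hs A (c • B) = c * hs A B :=
  (hsCLM A).map_smul c B
theorem hs_comm (A B : Herm d) : hs A B = hs B A := by simp only [hs]; rw [Matrix.trace_mul_comm]
theorem hs_sub_left (A B C : Herm d) : hs (A - B) C = hs A C - hs B C := by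
  simp only [hs_comm _ C, hs_sub_right]
theorem hs_smul_left (c : ℝ) (A B : Herm d) : hs (c • A) B = c * hs A B := by
  simp only [hs_comm _ B, hs_smul_right]
theorem hs_one (A : Herm d) : hs 1 A = tr A := by simp [hs, tr]

theorem isPSD_iff {A : Herm d} : IsPSD A ↔ ∀ v, 0 ≤ quadForm v A := by
  have hA : (A : Matrix (Fin d) (Fin d) ℂ).IsHermitian := A.2
  constructor
  · intro h v
    exact h.re_dotProduct_nonneg v
  · intro h
    refine Matrix.PosSemidef.of_dotProduct_mulVec_nonneg hA fun v => ?_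
    rw [Complex.nonneg_iff]
    exact ⟨h v, (hA.im_star_dotProduct_mulVec_self v).symm⟩

theorem isPD_iff {A : Herm d} : IsPD A ↔ ∀ v, v ≠ 0 → 0 < quadForm v A := by
  have hA : (A : Matrix (Fin d) (Fin d) ℂ).IsHermitian := A.2
  constructor
  · intro h v hv
    exact h.re_dotProduct_pos hv
  · intro h
    refine Matrix.PosDef.of_dotProduct_mulVec_pos hA fun v hv => ?_
    rw [Complex.pos_iff]
    exact ⟨h v hv, (hA.im_star_dotProduct_mulVec_self v).symm⟩

theorem IsPD.isPSD {A : Herm d} (h : IsPD A) : IsPSD A := Matrix.PosDef.posSemidef h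

theorem isPSD_smul {A : Herm d} (h : IsPSD A) {c : ℝ} (hc : 0 ≤ c) : IsPSD (c • A) := by
  rw [isPSD_iff] at *
  intro v
  rw [map_smul, smul_eq_mul]
  exact mul_nonneg hc (h v)

theorem isPD_smul {A : Herm d} (h : IsPD A) {c : ℝ} (hc : 0 < c) : IsPD (c • A) := by
  rw [isPD_iff] at *
  intro v hv
  rw [map_smul, smul_eq_mul]
  exact mul_pos hc (h v hv)

theorem isPSD_add {A B : Herm d} (hA : IsPSD A) (hB : IsPSD B) : IsPSD (A + B) :=
  Matrix.PosSemidef.add hA hB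

theorem IsPSD.add_isPD {A B : Herm d} (hA : IsPSD A) (hB : IsPD B) : IsPD (A + B) :=
  Matrix.PosDef.posSemidef_add hA hB

theorem isPD_one : IsPD (1 : Herm d) := Matrix.PosDef.one

theorem isPSD_zero : IsPSD (0 : Herm d) := Matrix.PosSemidef.zero

theorem convex_isPSD : Convex ℝ {A : Herm d | IsPSD A} := by
  intro A hA B hB a b ha hb _
  exact isPSD_add (isPSD_smul hA ha) (isPSD_smul hB hb)

theorem isPD_combo {A B : Herm d} (hA : IsPD A) (hB : IsPSD B) {a b : ℝ} (ha : 0 < a)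
    (hb : 0 ≤ b) : IsPD (a • A + b • B) := by
  rw [add_comm]
  exact (isPSD_smul hB hb).add_isPD (isPD_smul hA ha)

theorem convex_isPD : Convex ℝ {A : Herm d | IsPD A} := by
  intro A hA B hB a b ha hb hab
  rcases ha.eq_or_lt with rfl | ha
  · rw [zero_add] at hab; subst hab; simpa using hB
  · exact isPD_combo hA (IsPD.isPSD hB) ha hb

theorem isClosed_isPSD : IsClosed {A : Herm d | IsPSD A} := by
  have : {A : Herm d | IsPSD A} = ⋂ v, {A | 0 ≤ quadForm v A} := by
    ext A; simp [isPSD_iff]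
  rw [this]
  exact isClosed_iInter fun v => isClosed_le continuous_const (quadForm v).continuous

theorem isOpen_isPD : IsOpen {A : Herm d | IsPD A} := isOpen_posDef

theorem isPD_iff_spectrum {A : Herm d} :
    IsPD A ↔ spectrum ℝ (A : Matrix (Fin d) (Fin d) ℂ) ⊆ Ioi 0 := posDef_iff_spectrum A.2

theorem isPSD_iff_spectrum {A : Herm d} :
    IsPSD A ↔ spectrum ℝ (A : Matrix (Fin d) (Fin d) ℂ) ⊆ Ici 0 := posSemidef_iff_spectrum A.2

end Herm

/-! ### Matrix functions -/

section MatFun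

variable {d : ℕ}

theorem coe_matFun (f : ℝ → ℝ) (A : Herm d) :
    (matFun f A : Matrix (Fin d) (Fin d) ℂ) = cfc f (A : Matrix (Fin d) (Fin d) ℂ) := rfl

theorem matFun_congr {f g : ℝ → ℝ} {A : Herm d}
    (h : EqOn f g (spectrum ℝ (A : Matrix (Fin d) (Fin d) ℂ))) : matFun f A = matFun g A :=
  Subtype.ext (cfc_congr h)

theorem matFun_congr_psd {f g : ℝ → ℝ} {A : Herm d} (hA : IsPSD A) (h : EqOn f g (Ici 0)) :
    matFun f A = matFun g A :=
  matFun_congr (h.mono (isPSD_iff_spectrum.1 hA))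

theorem matFun_congr_pd {f g : ℝ → ℝ} {A : Herm d} (hA : IsPD A) (h : EqOn f g (Ioi 0)) :
    matFun f A = matFun g A :=
  matFun_congr (h.mono (isPD_iff_spectrum.1 hA))

theorem matFun_add (f g : ℝ → ℝ) (A : Herm d) :
    matFun (f + g) A = matFun f A + matFun g A :=
  Subtype.ext (cfc_add _ f g (continuousOn_spectrum _ _) (continuousOn_spectrum _ _))

theorem matFun_smul (c : ℝ) (f : ℝ → ℝ) (A : Herm d) :
    matFun (c • f) A = c • matFun f A :=
  Subtype.ext (cfc_smul c f _ (continuousOn_spectrum _ _))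

theorem matFun_const (c : ℝ) (A : Herm d) : matFun (fun _ => c) A = c • 1 := by
  ext1
  rw [coe_matFun, cfc_const c _ (isSelfAdjoint_coe A), Algebra.algebraMap_eq_smul_one]
  rfl

theorem matFun_id (A : Herm d) : matFun (fun x => x) A = A :=
  Subtype.ext (cfc_id' ℝ _ (isSelfAdjoint_coe A))

theorem matFun_comp (f g : ℝ → ℝ) (A : Herm d) :
    matFun f (matFun g A) = matFun (fun x => f (g x)) A :=
  Subtype.ext (cfc_comp' f g _
    ((Matrix.finite_real_spectrum.image g).continuousOn f) (continuousOn_spectrum _ _)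
    (isSelfAdjoint_coe A)).symm

theorem hs_matFun_matFun (f g : ℝ → ℝ) (A : Herm d) :
    hs (matFun f A) (matFun g A) = tr (matFun (fun x => f x * g x) A) := by
  have := cfc_mul f g (A : Matrix (Fin d) (Fin d) ℂ) (continuousOn_spectrum _ _)
    (continuousOn_spectrum _ _)
  simp only [hs, tr, coe_matFun, this]

theorem isPSD_matFun {f : ℝ → ℝ} {A : Herm d}
    (h : ∀ x ∈ spectrum ℝ (A : Matrix (Fin d) (Fin d) ℂ), 0 ≤ f x) : IsPSD (matFun f A) := by
  rw [isPSD_iff_spectrum, coe_matFun,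
    cfc_map_spectrum f _ (isSelfAdjoint_coe A) (continuousOn_spectrum _ _)]
  rintro _ ⟨x, hx, rfl⟩
  exact h x hx

theorem isPD_matFun {f : ℝ → ℝ} {A : Herm d}
    (h : ∀ x ∈ spectrum ℝ (A : Matrix (Fin d) (Fin d) ℂ), 0 < f x) : IsPD (matFun f A) := by
  rw [isPD_iff_spectrum, coe_matFun,
    cfc_map_spectrum f _ (isSelfAdjoint_coe A) (continuousOn_spectrum _ _)]
  rintro _ ⟨x, hx, rfl⟩
  exact h x hx

theorem continuous_matFun {f : ℝ → ℝ} (hf : Continuous f) :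
    Continuous (matFun f : Herm d → Herm d) := by
  refine Continuous.subtype_mk ?_ _
  exact Continuous.cfc_of_mem_nhdsSet (s := univ) f Filter.univ_mem continuous_subtype_val
    (fun x => x.2) hf.continuousOn

theorem continuousOn_matFun {f : ℝ → ℝ} (hf : ContinuousOn f (Ici 0)) :
    ContinuousOn (matFun f : Herm d → Herm d) {A | IsPSD A} := by
  have h : Continuous fun x => f (max x 0) :=
    hf.comp_continuous (continuous_id.max continuous_const) fun x => mem_Ici.2 (le_max_right _ _)
  refine (continuous_matFun h).continuousOn.congr fun A hA => ?_
  exact matFun_congr_psd hA fun x hx => by rw [max_eq_left hx]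

theorem tr_nonneg {A : Herm d} (hA : IsPSD A) : 0 ≤ tr A :=
  (Complex.nonneg_iff.1 hA.trace_nonneg).1

theorem norm_matFun_le {f : ℝ → ℝ} {A : Herm d} {C : ℝ} (hC : 0 ≤ C)
    (h : ∀ x ∈ spectrum ℝ (A : Matrix (Fin d) (Fin d) ℂ), |f x| ≤ C) : ‖matFun f A‖ ≤ C :=
  norm_cfc_le hC h

/-- The operator norm of a positive semidefinite matrix is at most its trace. -/
theorem norm_le_tr {A : Herm d} (hA : IsPSD A) : ‖A‖ ≤ tr A := by
  have hH : (A : Matrix (Fin d) (Fin d) ℂ).IsHermitian := isSelfAdjoint_coe A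
  rw [← matFun_id A]
  refine norm_matFun_le (by rw [matFun_id]; exact tr_nonneg hA) fun x hx => ?_
  have hx0 : 0 ≤ x := isPSD_iff_spectrum.1 hA hx
  rw [hH.spectrum_real_eq_range_eigenvalues] at hx
  obtain ⟨i, rfl⟩ := hx
  rw [abs_of_nonneg hx0, matFun_id, tr, hH.trace_eq_sum_eigenvalues]
  simp only [Complex.re_sum]
  exact Finset.single_le_sum (f := hH.eigenvalues) (fun j _ => hA.eigenvalues_nonneg j)
    (Finset.mem_univ i)

end MatFun

/-! ### Parametric integrals -/

section Parametric

variable {E : Type} [NormedAddCommGroup E]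

/-- Around a point `x₀` with `[0, 1] × {x₀} ⊆ O`, a continuous function on the open set `O` is
bounded, uniformly in the first variable `s ∈ [0, 1]`. -/
theorem exists_nhds_bound {F : Type} [NormedAddCommGroup F] {O : Set (ℝ × E)} (hO : IsOpen O)
    {g : ℝ × E → F} (hg : ContinuousOn g O) {x₀ : E} (hx : ∀ s ∈ Icc (0 : ℝ) 1, (s, x₀) ∈ O) :
    ∃ C : ℝ, ∃ u ∈ 𝓝 x₀, ∀ s ∈ Icc (0 : ℝ) 1, ∀ x ∈ u, (s, x) ∈ O ∧ ‖g (s, x)‖ ≤ C := by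
  have hK : IsCompact (Icc (0 : ℝ) 1 ×ˢ ({x₀} : Set E)) := isCompact_Icc.prod isCompact_singleton
  have hKO : Icc (0 : ℝ) 1 ×ˢ ({x₀} : Set E) ⊆ O := by
    rintro ⟨s, x⟩ ⟨hs, rfl⟩
    exact hx s hs
  obtain ⟨C, hC⟩ := hK.exists_bound_of_continuousOn (hg.mono hKO)
  have hW : IsOpen (O ∩ (fun p => ‖g p‖) ⁻¹' Iio (C + 1)) :=
    hg.norm.isOpen_inter_preimage hO isOpen_Iio
  obtain ⟨u, v, hu, hv, h1, h2, huv⟩ := generalized_tube_lemma isCompact_Icc isCompact_singleton hW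
    (fun p hp => ⟨hKO hp, lt_of_le_of_lt (hC p hp) (lt_add_one C)⟩)
  refine ⟨C + 1, v, hv.mem_nhds (h2 rfl), fun s hs x hxv => ?_⟩
  have := huv (mk_mem_prod (h1 hs) hxv)
  exact ⟨this.1, le_of_lt this.2⟩

theorem continuousOn_slice {F : Type} [NormedAddCommGroup F] {O : Set (ℝ × E)}
    {g : ℝ × E → F} (hg : ContinuousOn g O) {x : E} (hx : ∀ s ∈ Icc (0 : ℝ) 1, (s, x) ∈ O) :
    ContinuousOn (fun s => g (s, x)) (Icc 0 1) :=
  hg.comp (by fun_prop) hx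

theorem continuousOn_parametric_integral {F : Type} [NormedAddCommGroup F] [NormedSpace ℝ F]
    {O : Set (ℝ × E)} (hO : IsOpen O) {V : Set E}
    (hVO : ∀ s ∈ Icc (0 : ℝ) 1, ∀ x ∈ V, (s, x) ∈ O) {g : ℝ × E → F} (hg : ContinuousOn g O) :
    ContinuousOn (fun x => ∫ s in (0 : ℝ)..1, g (s, x)) V := by
  intro x₀ hx₀
  refine ContinuousAt.continuousWithinAt ?_
  obtain ⟨C, u, hu, h⟩ := exists_nhds_bound hO hg (fun s hs => hVO s hs x₀ hx₀)
  refine intervalIntegral.continuousAt_of_dominated_interval (bound := fun _ => C) ?_ ?_ ?_ ?_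
  · filter_upwards [hu] with x hx
    refine (ContinuousOn.aestronglyMeasurable ?_ measurableSet_uIoc)
    rw [uIoc_of_le zero_le_one]
    exact (continuousOn_slice hg fun s hs => (h s hs x hx).1).mono Ioc_subset_Icc_self
  · filter_upwards [hu] with x hx
    refine Eventually.of_forall fun s hs => ?_
    rw [uIoc_of_le zero_le_one] at hs
    exact (h s (Ioc_subset_Icc_self hs) x hx).2
  · exact intervalIntegrable_const
  · refine Eventually.of_forall fun s hs => ?_
    rw [uIoc_of_le zero_le_one] at hs
    have h1 : ContinuousAt g (s, x₀) :=
      hg.continuousAt (hO.mem_nhds (hVO s (Ioc_subset_Icc_self hs) x₀ hx₀))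
    exact ContinuousAt.comp (f := fun x => (s, x)) h1 (by fun_prop)

variable [NormedSpace ℝ E]

theorem hasFDerivAt_parametric_integral {F : Type} [NormedAddCommGroup F] [NormedSpace ℝ F]
    {O : Set (ℝ × E)} (hO : IsOpen O) {g : ℝ × E → F} (hg : ContDiffOn ℝ 1 g O) {x₀ : E}
    (hx₀ : ∀ s ∈ Icc (0 : ℝ) 1, (s, x₀) ∈ O) :
    HasFDerivAt (fun x => ∫ s in (0 : ℝ)..1, g (s, x))
      (∫ s in (0 : ℝ)..1, (fderiv ℝ g (s, x₀)).comp (ContinuousLinearMap.inr ℝ ℝ E)) x₀ := by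
  have hd : ContinuousOn (fun p => (fderiv ℝ g p).comp (ContinuousLinearMap.inr ℝ ℝ E)) O :=
    (hg.continuousOn_fderiv_of_isOpen hO le_rfl).clm_comp continuousOn_const
  obtain ⟨C, u, hu, h⟩ := exists_nhds_bound hO hd hx₀
  refine intervalIntegral.hasFDerivAt_integral_of_dominated_of_fderiv_le (s := u)
    (F' := fun x s => (fderiv ℝ g (s, x)).comp (ContinuousLinearMap.inr ℝ ℝ E))
    (bound := fun _ => C) hu ?_ ?_ ?_ ?_ ?_ ?_
  · filter_upwards [hu] with x hx
    refine (ContinuousOn.aestronglyMeasurable ?_ measurableSet_uIoc)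
    rw [uIoc_of_le zero_le_one]
    exact (continuousOn_slice hg.continuousOn fun s hs => (h s hs x hx).1).mono Ioc_subset_Icc_self
  · refine ContinuousOn.intervalIntegrable ?_
    rw [uIcc_of_le zero_le_one]
    exact continuousOn_slice hg.continuousOn hx₀
  · refine (ContinuousOn.aestronglyMeasurable ?_ measurableSet_uIoc)
    rw [uIoc_of_le zero_le_one]
    exact (continuousOn_slice hd hx₀).mono Ioc_subset_Icc_self
  · refine Eventually.of_forall fun s hs x hx => ?_
    rw [uIoc_of_le zero_le_one] at hs
    exact (h s (Ioc_subset_Icc_self hs) x hx).2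
  · exact intervalIntegrable_const
  · refine Eventually.of_forall fun s hs x hx => ?_
    rw [uIoc_of_le zero_le_one] at hs
    have h1 : HasFDerivAt g (fderiv ℝ g (s, x)) (s, x) :=
      ((hg.differentiableOn one_ne_zero).differentiableAt
        (hO.mem_nhds (h s (Ioc_subset_Icc_self hs) x hx).1)).hasFDerivAt
    exact h1.comp x (hasFDerivAt_prodMk_right s x)

theorem contDiffOn_succ_of_hasFDerivAt {F : Type} [NormedAddCommGroup F] [NormedSpace ℝ F]
    {U : Set E} (hU : IsOpen U) {k : ℕ} {φ : E → F} {M : E → E →L[ℝ] F}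
    (hM : ContDiffOn ℝ k M U) (h : ∀ x ∈ U, HasFDerivAt φ (M x) x) :
    ContDiffOn ℝ (k + 1 : ℕ) φ U := by
  rw [Nat.cast_succ, contDiffOn_succ_iff_fderiv_of_isOpen hU]
  exact ⟨fun x hx => (h x hx).differentiableAt.differentiableWithinAt, by simp,
    hM.congr fun x hx => (h x hx).fderiv⟩

/-- A parametric integral over `[0, 1]` of a `C^k` function is `C^k`. -/
theorem contDiffOn_parametric_integral (k : ℕ) :
    ∀ {F : Type} [NormedAddCommGroup F] [NormedSpace ℝ F]
    {O : Set (ℝ × E)} (_ : IsOpen O) {V : Set E} (_ : IsOpen V)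
    (_ : ∀ s ∈ Icc (0 : ℝ) 1, ∀ x ∈ V, (s, x) ∈ O) {g : ℝ × E → F} (_ : ContDiffOn ℝ k g O),
    ContDiffOn ℝ k (fun x => ∫ s in (0 : ℝ)..1, g (s, x)) V := by
  induction k with
  | zero =>
    intro F _ _ O hO V hV hVO g hg
    simp only [Nat.cast_zero, contDiffOn_zero] at hg ⊢
    exact continuousOn_parametric_integral hO hVO hg
  | succ k ih =>
    intro F _ _ O hO V hV hVO g hg
    have hg1 : ContDiffOn ℝ 1 g O := hg.of_le (by norm_cast; omega)
    have hder := fun x (hx : x ∈ V) =>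
      hasFDerivAt_parametric_integral hO hg1 (fun s hs => hVO s hs x hx)
    refine contDiffOn_succ_of_hasFDerivAt hV ?_ hder
    refine ih hO hV hVO (g := fun p => (fderiv ℝ g p).comp (ContinuousLinearMap.inr ℝ ℝ E)) ?_
    refine ContDiffOn.clm_comp ?_ contDiffOn_const
    exact hg.fderiv_of_isOpen hO (by norm_cast)

theorem integral_clm_apply {F : Type} [NormedAddCommGroup F] [NormedSpace ℝ F] [CompleteSpace F]
    {φ : ℝ → E →L[ℝ] F} (hφ : ContinuousOn φ (Icc 0 1)) (x : E) :
    (∫ s in (0 : ℝ)..1, φ s) x = ∫ s in (0 : ℝ)..1, φ s x :=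
  ContinuousLinearMap.intervalIntegral_apply
    (ContinuousOn.intervalIntegrable (by rwa [uIcc_of_le zero_le_one])) x

/-- A function whose increments are `φ y - φ x = M y (y - x)` with `M` continuous at `x` has
derivative `M x` at `x`. -/
theorem hasFDerivAt_of_increment {F : Type} [NormedAddCommGroup F] [NormedSpace ℝ F]
    {φ : E → F} {M : E → E →L[ℝ] F} {x : E} (hM : ContinuousAt M x)
    (h : ∀ᶠ y in 𝓝 x, φ y - φ x = M y (y - x)) : HasFDerivAt φ (M x) x := by
  rw [hasFDerivAt_iff_isLittleO, Asymptotics.isLittleO_iff]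
  intro c hc
  filter_upwards [h, Metric.tendsto_nhds.1 hM.tendsto c hc] with y hy hyc
  rw [hy, ← _root_.sub_apply]
  refine (ContinuousLinearMap.le_opNorm _ _).trans ?_
  gcongr
  rw [dist_eq_norm] at hyc
  exact hyc.le

end Parametric

/-! ### Matrix functions as integrals of Kronecker interpolations -/

section Smooth

theorem transpose_conjTranspose {m : Type} (M : Matrix m m ℂ) : Mᵀᴴ = Mᴴᵀ := rfl

variable {n : Type} [Fintype n] [DecidableEq n]

/-- The standard matrix function on self-adjoint matrices with rows indexed by any finite type. -/
def hermFun (f : ℝ → ℝ) (A : selfAdjoint (Matrix n n ℂ)) : selfAdjoint (Matrix n n ℂ) :=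
  ⟨cfc f (A : Matrix n n ℂ), cfc_predicate f _⟩

theorem coe_hermFun (f : ℝ → ℝ) (A : selfAdjoint (Matrix n n ℂ)) :
    (hermFun f A : Matrix n n ℂ) = cfc f (A : Matrix n n ℂ) := rfl

/-- `B ↦ 1 ⊗ B`, the matrix of the left multiplication `X ↦ B X`. -/
def leftMulMatrix : selfAdjoint (Matrix n n ℂ) →L[ℝ] selfAdjoint (Matrix (n × n) (n × n) ℂ) :=
  LinearMap.toContinuousLinearMap
    { toFun := fun B => ⟨(1 : Matrix n n ℂ) ⊗ₖ (B : Matrix n n ℂ), by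
        rw [selfAdjoint.mem_iff, star_eq_conjTranspose, conjTranspose_kronecker]
        congr 1
        · simp
        · exact isSelfAdjoint_coe B⟩
      map_add' := fun A B => Subtype.ext (kronecker_add _ _ _)
      map_smul' := fun c A => Subtype.ext (kronecker_smul c _ _) }

/-- `A ↦ Aᵀ ⊗ 1`, the matrix of the right multiplication `X ↦ X A`. -/
def rightMulMatrix : selfAdjoint (Matrix n n ℂ) →L[ℝ] selfAdjoint (Matrix (n × n) (n × n) ℂ) :=
  LinearMap.toContinuousLinearMap
    { toFun := fun A => ⟨(A : Matrix n n ℂ)ᵀ ⊗ₖ (1 : Matrix n n ℂ), by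
        rw [selfAdjoint.mem_iff, star_eq_conjTranspose, conjTranspose_kronecker]
        congr 1
        · rw [transpose_conjTranspose]
          congr 1
          exact isSelfAdjoint_coe A
        · simp⟩
      map_add' := fun A B => Subtype.ext (by simp [add_kronecker])
      map_smul' := fun c A => Subtype.ext (by simp [smul_kronecker]) }

/-- The matrix of `X ↦ s B X + (1 - s) X A` in the basis of matrix units. -/
def interp (s : ℝ) (B A : selfAdjoint (Matrix n n ℂ)) :
    selfAdjoint (Matrix (n × n) (n × n) ℂ) :=
  s • leftMulMatrix B + (1 - s) • rightMulMatrix A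

theorem coe_interp (s : ℝ) (B A : selfAdjoint (Matrix n n ℂ)) :
    (interp s B A : Matrix (n × n) (n × n) ℂ) =
      s • ((1 : Matrix n n ℂ) ⊗ₖ (B : Matrix n n ℂ)) +
        (1 - s) • ((A : Matrix n n ℂ)ᵀ ⊗ₖ (1 : Matrix n n ℂ)) := rfl

/-- The self-adjoint part, as a continuous linear map. -/
def selfAdjointPartCLM : Matrix n n ℂ →L[ℝ] selfAdjoint (Matrix n n ℂ) :=
  haveI : FiniteDimensional ℝ (Matrix n n ℂ) := FiniteDimensional.trans ℝ ℂ _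
  LinearMap.toContinuousLinearMap (selfAdjointPart ℝ (A := Matrix n n ℂ))

theorem selfAdjointPartCLM_coe (A : selfAdjoint (Matrix n n ℂ)) :
    selfAdjointPartCLM (A : Matrix n n ℂ) = A :=
  (isSelfAdjoint_coe A).selfAdjointPart_apply ℝ

/-- A matrix indexed by pairs acts on matrices; this is the action followed by the projection to
self-adjoint matrices. -/
def action : selfAdjoint (Matrix (n × n) (n × n) ℂ) →L[ℝ]
    selfAdjoint (Matrix n n ℂ) →L[ℝ] selfAdjoint (Matrix n n ℂ) :=
  LinearMap.toContinuousLinearMap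
    { toFun := fun M => LinearMap.toContinuousLinearMap
        ((selfAdjointPart ℝ (A := Matrix n n ℂ)) ∘ₗ
          { toFun := fun X => Matrix.of fun i j =>
              ((M : Matrix (n × n) (n × n) ℂ) *ᵥ vec (X : Matrix n n ℂ)) (j, i)
            map_add' := fun X Y => by ext i j; simp [vec_add, mulVec_add]
            map_smul' := fun c X => by ext i j; simp [vec_smul, mulVec_smul] })
      map_add' := fun M N => by
        ext1 X
        show selfAdjointPart ℝ (A := Matrix n n ℂ) _ = selfAdjointPart ℝ (A := Matrix n n ℂ) _ +
          selfAdjointPart ℝ (A := Matrix n n ℂ) _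
        rw [← map_add]
        refine congrArg _ (Matrix.ext fun i j => ?_)
        simp [add_mulVec]
      map_smul' := fun c M => by
        ext1 X
        show selfAdjointPart ℝ (A := Matrix n n ℂ) _ = c • selfAdjointPart ℝ (A := Matrix n n ℂ) _
        rw [← map_smul]
        refine congrArg _ (Matrix.ext fun i j => ?_)
        simp [smul_mulVec] }

theorem action_apply (M : selfAdjoint (Matrix (n × n) (n × n) ℂ)) (X : selfAdjoint (Matrix n n ℂ)) :
    action M X = selfAdjointPartCLM (Matrix.of fun i j =>
      ((M : Matrix (n × n) (n × n) ℂ) *ᵥ vec (X : Matrix n n ℂ)) (j, i)) := rfl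

/-- The self-adjoint part of `U (γ ∘ Y) V*`, where `γ ∘ Y` is the entrywise product, as a linear
function of `γ`. -/
def schurMap (U Y V : Matrix n n ℂ) : (n → n → ℝ) →L[ℝ] selfAdjoint (Matrix n n ℂ) :=
  LinearMap.toContinuousLinearMap
    ((selfAdjointPart ℝ (A := Matrix n n ℂ)) ∘ₗ
      { toFun := fun γ => U * (Matrix.of fun i j => (γ i j : ℂ) * Y i j) * star V
        map_add' := fun γ δ => by
          rw [← add_mul, ← mul_add]
          congr 2
          ext i j
          simp [add_mul]
        map_smul' := fun c γ => by
          rw [RingHom.id_apply, ← smul_mul_assoc, ← mul_smul_comm]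
          congr 2
          ext i j
          simp [mul_assoc] })

theorem schurMap_apply (U Y V : Matrix n n ℂ) (γ : n → n → ℝ) :
    schurMap U Y V γ =
      selfAdjointPartCLM (U * (Matrix.of fun i j => (γ i j : ℂ) * Y i j) * star V) := rfl

theorem interp_eq_conj {U V : Matrix n n ℂ} (hU : U ∈ unitaryGroup n ℂ) (hV : V ∈ unitaryGroup n ℂ)
    {B A : selfAdjoint (Matrix n n ℂ)} {b a : n → ℝ}
    (hB : (B : Matrix n n ℂ) = U * Matrix.diagonal (fun i => (b i : ℂ)) * star U)
    (hA : (A : Matrix n n ℂ) = V * Matrix.diagonal (fun i => (a i : ℂ)) * star V) (s : ℝ) :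
    (interp s B A : Matrix (n × n) (n × n) ℂ) = ((star V)ᵀ ⊗ₖ U) *
      Matrix.diagonal (fun p : n × n => ((s * b p.2 + (1 - s) * a p.1 : ℝ) : ℂ)) *
        star ((star V)ᵀ ⊗ₖ U) := by
  have hU' : U * star U = 1 := (mem_unitaryGroup_iff).1 hU
  have hV' : V * star V = 1 := (mem_unitaryGroup_iff).1 hV
  have hV'' : (star V)ᵀ * Vᵀ = 1 := by rw [← transpose_mul, hV', transpose_one]
  have hst : star ((star V)ᵀ ⊗ₖ U) = Vᵀ ⊗ₖ star U := by
    rw [star_eq_conjTranspose, conjTranspose_kronecker, transpose_conjTranspose,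
      star_eq_conjTranspose, conjTranspose_conjTranspose, star_eq_conjTranspose]
  have hdiag : Matrix.diagonal (fun p : n × n => ((s * b p.2 + (1 - s) * a p.1 : ℝ) : ℂ)) =
      s • ((1 : Matrix n n ℂ) ⊗ₖ Matrix.diagonal (fun i => (b i : ℂ))) +
        (1 - s) • (Matrix.diagonal (fun i => (a i : ℂ)) ⊗ₖ (1 : Matrix n n ℂ)) := by
    rw [← diagonal_one, diagonal_kronecker_diagonal, diagonal_kronecker_diagonal,
      ← diagonal_smul, ← diagonal_smul, diagonal_add]
    congr 1
    ext p
    simp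
  rw [coe_interp, hst, hdiag, mul_add, add_mul, mul_smul_comm, mul_smul_comm, smul_mul_assoc,
    smul_mul_assoc, ← mul_kronecker_mul, ← mul_kronecker_mul, ← mul_kronecker_mul,
    ← mul_kronecker_mul, mul_one, mul_one, hV'', hU', ← hB, hA]
  congr 3
  rw [transpose_mul, transpose_mul, diagonal_transpose, mul_assoc]

/-- In eigenbases of `B` and `A`, functions of `X ↦ s B X + (1 - s) X A` are Schur multipliers. -/
theorem action_hermFun_interp {U V : Matrix n n ℂ} (hU : U ∈ unitaryGroup n ℂ)
    (hV : V ∈ unitaryGroup n ℂ) {B A : selfAdjoint (Matrix n n ℂ)} {b a : n → ℝ}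
    (hB : (B : Matrix n n ℂ) = U * Matrix.diagonal (fun i => (b i : ℂ)) * star U)
    (hA : (A : Matrix n n ℂ) = V * Matrix.diagonal (fun i => (a i : ℂ)) * star V) (s : ℝ)
    (f : ℝ → ℝ) (X : selfAdjoint (Matrix n n ℂ)) :
    action (hermFun f (interp s B A)) X =
      schurMap U (star U * X * V) V (fun i j => f (s * b i + (1 - s) * a j)) := by
  have hW : (star V)ᵀ ⊗ₖ U ∈ unitaryGroup (n × n) ℂ := by
    refine kronecker_mem_unitary ?_ hU
    rw [mem_unitaryGroup_iff]
    have hV' : V * star V = 1 := (mem_unitaryGroup_iff).1 hV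
    rw [star_eq_conjTranspose ((star V)ᵀ), transpose_conjTranspose, star_eq_conjTranspose,
      conjTranspose_conjTranspose, ← transpose_mul, ← star_eq_conjTranspose, hV', transpose_one]
  have hst : star ((star V)ᵀ ⊗ₖ U) = Vᵀ ⊗ₖ star U := by
    rw [star_eq_conjTranspose, conjTranspose_kronecker, transpose_conjTranspose,
      star_eq_conjTranspose, conjTranspose_conjTranspose, star_eq_conjTranspose]
  rw [action_apply, schurMap_apply, coe_hermFun, interp_eq_conj hU hV hB hA s,
    cfc_conj_diagonal hW, hst, ← mulVec_mulVec, ← mulVec_mulVec, kronecker_mulVec_vec]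
  congr 1
  have : Matrix.diagonal (fun p : n × n => ((f (s * b p.2 + (1 - s) * a p.1) : ℝ) : ℂ)) *ᵥ
      vec (star U * (X : Matrix n n ℂ) * Vᵀᵀ) = vec (Matrix.of fun i j =>
        ((f (s * b i + (1 - s) * a j) : ℝ) : ℂ) * (star U * (X : Matrix n n ℂ) * V) i j) := by
    ext p
    simp [mulVec_diagonal, vec]
  rw [this, kronecker_mulVec_vec, transpose_transpose]
  rfl

end Smooth

/-! ### Smoothness of matrix functions -/

section Derivative

variable {n : Type} [Fintype n] [DecidableEq n]

theorem posDef_interp {s : ℝ} (hs : s ∈ Icc (0 : ℝ) 1) {B A : selfAdjoint (Matrix n n ℂ)}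
    (hB : (B : Matrix n n ℂ).PosDef) (hA : (A : Matrix n n ℂ).PosDef) :
    (interp s B A : Matrix (n × n) (n × n) ℂ).PosDef := by
  rw [coe_interp]
  have h1 : ((1 : Matrix n n ℂ) ⊗ₖ (B : Matrix n n ℂ)).PosDef := PosDef.one.kronecker hB
  have h2 : ((A : Matrix n n ℂ)ᵀ ⊗ₖ (1 : Matrix n n ℂ)).PosDef := hA.transpose.kronecker PosDef.one
  rcases hs.1.eq_or_lt with rfl | h0
  · simpa using h2
  · refine PosDef.add_posSemidef ?_ ?_
    · rw [← Complex.coe_smul]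
      exact h1.smul (by exact_mod_cast h0)
    · rw [← Complex.coe_smul]
      exact h2.posSemidef.smul (by exact_mod_cast sub_nonneg.2 hs.2)

theorem continuousOn_hermFun {f : ℝ → ℝ} (hf : ContinuousOn f (Ioi 0)) :
    ContinuousOn (hermFun f) {A : selfAdjoint (Matrix n n ℂ) | (A : Matrix n n ℂ).PosDef} := by
  refine Topology.IsInducing.subtypeVal.continuousOn_iff.2 ?_
  refine ContinuousOn.cfc_of_mem_nhdsSet (s := Ioi 0) f ?_ continuous_subtype_val.continuousOn
    (fun x _ => isSelfAdjoint_coe x) hf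
  refine isOpen_Ioi.mem_nhdsSet.2 (iUnion₂_subset fun A hA => ?_)
  exact (posDef_iff_spectrum (isSelfAdjoint_coe A)).1 hA

theorem contDiff_interp {k : ℕ} (A : selfAdjoint (Matrix n n ℂ)) :
    ContDiff ℝ k (fun p : ℝ × selfAdjoint (Matrix n n ℂ) => interp p.1 p.2 A) := by
  unfold interp
  fun_prop

theorem contDiff_interp_self {k : ℕ} :
    ContDiff ℝ k (fun p : ℝ × selfAdjoint (Matrix n n ℂ) => interp p.1 p.2 p.2) := by
  unfold interp
  fun_prop

theorem continuousOn_hermFun_interp {φ : ℝ → ℝ} (hφ : ContinuousOn φ (Ioi 0))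
    {B A : selfAdjoint (Matrix n n ℂ)}
    (hB : (B : Matrix n n ℂ).PosDef) (hA : (A : Matrix n n ℂ).PosDef) :
    ContinuousOn (fun s => hermFun φ (interp s B A)) (Icc 0 1) := by
  refine (continuousOn_hermFun hφ).comp ?_ fun s hs => posDef_interp hs hB hA
  unfold interp
  fun_prop

/-- In eigenbases of `B` and `A`, averaged functions of `s L_B + (1 - s) R_A` are Schur multipliers.
The diagonalisations of `B` and `A` do not depend on `s`. -/
theorem integral_action {U V : Matrix n n ℂ} (hU : U ∈ unitaryGroup n ℂ)
    (hV : V ∈ unitaryGroup n ℂ) {B A : selfAdjoint (Matrix n n ℂ)} {b a : n → ℝ}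
    (hB : (B : Matrix n n ℂ) = U * Matrix.diagonal (fun i => (b i : ℂ)) * star U)
    (hA : (A : Matrix n n ℂ) = V * Matrix.diagonal (fun i => (a i : ℂ)) * star V)
    (hBp : (B : Matrix n n ℂ).PosDef) (hAp : (A : Matrix n n ℂ).PosDef)
    (hb : ∀ i, 0 < b i) (ha : ∀ i, 0 < a i)
    {φ : ℝ → ℝ} (hφ : ContinuousOn φ (Ioi 0)) (X : selfAdjoint (Matrix n n ℂ)) :
    (∫ s in (0 : ℝ)..1, action (hermFun φ (interp s B A))) X =
      schurMap U (star U * X * V) V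
        (fun i j => ∫ s in (0 : ℝ)..1, φ (s * b i + (1 - s) * a j)) := by
  have h1 : ContinuousOn (fun s => action (hermFun φ (interp s B A))) (Icc 0 1) :=
    (action (n := n)).continuous.comp_continuousOn (continuousOn_hermFun_interp hφ hBp hAp)
  have h2 : ContinuousOn (fun s : ℝ => fun i j : n => φ (s * b i + (1 - s) * a j)) (Icc 0 1) := by
    refine continuousOn_pi.2 fun i => continuousOn_pi.2 fun j => ?_
    refine hφ.comp (by fun_prop) fun s hs => ?_
    rcases hs.1.eq_or_lt with rfl | h0
    · simpa using ha j
    · exact add_pos_of_pos_of_nonneg (mul_pos h0 (hb i)) (mul_nonneg (sub_nonneg.2 hs.2) (ha j).le)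
  have h2i : IntervalIntegrable (fun s : ℝ => fun i j : n => φ (s * b i + (1 - s) * a j))
      volume 0 1 :=
    ContinuousOn.intervalIntegrable (by rwa [uIcc_of_le zero_le_one])
  rw [integral_clm_apply h1]
  simp_rw [action_hermFun_interp hU hV hB hA]
  rw [ContinuousLinearMap.intervalIntegral_comp_comm _ h2i]
  congr 1
  ext i j
  have := ContinuousLinearMap.intervalIntegral_comp_comm
    ((ContinuousLinearMap.proj (R := ℝ) (φ := fun _ : n => ℝ) j).comp
      (ContinuousLinearMap.proj (R := ℝ) (φ := fun _ : n => n → ℝ) i)) h2i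
  exact this.symm

theorem integral_deriv_interp {f : ℝ → ℝ} (hf : ContDiffOn ℝ 1 f (Ioi 0)) {b a : ℝ}
    (hb : 0 < b) (ha : 0 < a) :
    (∫ s in (0 : ℝ)..1, deriv f (s * b + (1 - s) * a)) * (b - a) = f b - f a := by
  have hpos : ∀ s ∈ Icc (0 : ℝ) 1, 0 < s * b + (1 - s) * a := fun s hs => by
    rcases hs.1.eq_or_lt with rfl | h0
    · simpa using ha
    · exact add_pos_of_pos_of_nonneg (mul_pos h0 hb) (mul_nonneg (sub_nonneg.2 hs.2) ha.le)
  have hder : ContinuousOn (deriv f) (Ioi 0) := hf.continuousOn_deriv_of_isOpen isOpen_Ioi le_rfl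
  rw [← intervalIntegral.integral_mul_const]
  have := intervalIntegral.integral_eq_sub_of_hasDerivAt (a := (0 : ℝ)) (b := 1)
    (f := fun s => f (s * b + (1 - s) * a))
    (f' := fun s => deriv f (s * b + (1 - s) * a) * (b - a)) ?_ ?_
  · simpa using this
  · intro s hs
    rw [uIcc_of_le zero_le_one] at hs
    have h1 : HasDerivAt f (deriv f (s * b + (1 - s) * a)) (s * b + (1 - s) * a) :=
      ((hf.differentiableOn one_ne_zero).differentiableAt
        (isOpen_Ioi.mem_nhds (hpos s hs))).hasDerivAt
    have h2 : HasDerivAt (fun s : ℝ => s * b + (1 - s) * a) (b - a) s := by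
      have := ((hasDerivAt_id s).mul_const b).add (((hasDerivAt_id s).const_sub 1).mul_const a)
      refine this.congr_deriv ?_
      ring
    exact h1.comp s h2
  · refine ContinuousOn.intervalIntegrable ?_
    rw [uIcc_of_le zero_le_one]
    exact (hder.comp (by fun_prop) hpos).mul continuousOn_const

/-- The divided difference formula `f(B) - f(A) = ∫₀¹ f'(s L_B + (1 - s) R_A) ds (B - A)`, where
`L_B` and `R_A` are left and right multiplication. -/
theorem hermFun_sub {f : ℝ → ℝ} (hf : ContDiffOn ℝ 1 f (Ioi 0))
    {B A : selfAdjoint (Matrix n n ℂ)}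
    (hB : (B : Matrix n n ℂ).PosDef) (hA : (A : Matrix n n ℂ).PosDef) :
    hermFun f B - hermFun f A =
      (∫ s in (0 : ℝ)..1, action (hermFun (deriv f) (interp s B A))) (B - A) := by
  obtain ⟨U, hU, b, hBU, hb⟩ := exists_diagonalization B
  obtain ⟨V, hV, a, hAV, ha⟩ := exists_diagonalization A
  have hb' : ∀ i, 0 < b i := fun i => (posDef_iff_spectrum (isSelfAdjoint_coe B)).1 hB (hb i)
  have ha' : ∀ i, 0 < a i := fun i => (posDef_iff_spectrum (isSelfAdjoint_coe A)).1 hA (ha i)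
  have hU1 : star U * U = 1 := mem_unitaryGroup_iff'.1 hU
  have hV1 : star V * V = 1 := mem_unitaryGroup_iff'.1 hV
  have hU2 : U * star U = 1 := mem_unitaryGroup_iff.1 hU
  have hV2 : V * star V = 1 := mem_unitaryGroup_iff.1 hV
  have key : ∀ g : ℝ → ℝ,
      star U * (cfc g (B : Matrix n n ℂ) - cfc g (A : Matrix n n ℂ)) * V =
        Matrix.of fun i j => ((g (b i) - g (a j) : ℝ) : ℂ) * (star U * V) i j := by
    intro g
    rw [hBU, hAV, cfc_conj_diagonal hU, cfc_conj_diagonal hV, mul_sub, sub_mul]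
    have e1 : star U * (U * Matrix.diagonal (fun i => (g (b i) : ℂ)) * star U) * V =
        Matrix.diagonal (fun i => (g (b i) : ℂ)) * (star U * V) := by
      simp only [← mul_assoc, hU1, one_mul]
    have e2 : star U * (V * Matrix.diagonal (fun i => (g (a i) : ℂ)) * star V) * V =
        (star U * V) * Matrix.diagonal (fun i => (g (a i) : ℂ)) := by
      simp only [mul_assoc, hV1, mul_one]
    rw [e1, e2]
    ext i j
    rw [Matrix.sub_apply, diagonal_mul, mul_diagonal, of_apply]
    push_cast
    ring
  have hder : ContinuousOn (deriv f) (Ioi 0) := hf.continuousOn_deriv_of_isOpen isOpen_Ioi le_rfl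
  rw [integral_action hU hV hBU hAV hB hA hb' ha' hder, schurMap_apply,
    ← selfAdjointPartCLM_coe (hermFun f B - hermFun f A)]
  congr 1
  have h1 := key f
  have h2 := key (fun x => x)
  rw [cfc_id' ℝ _ (isSelfAdjoint_coe B), cfc_id' ℝ _ (isSelfAdjoint_coe A)] at h2
  have h3 : (Matrix.of fun i j => ((∫ s in (0 : ℝ)..1, deriv f (s * b i + (1 - s) * a j) : ℝ) : ℂ) *
      (star U * ((B - A : selfAdjoint (Matrix n n ℂ)) : Matrix n n ℂ) * V) i j) =
      star U * (cfc f (B : Matrix n n ℂ) - cfc f (A : Matrix n n ℂ)) * V := by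
    rw [h1]
    ext i j
    rw [of_apply, of_apply, AddSubgroupClass.coe_sub, h2, of_apply, ← mul_assoc,
      ← integral_deriv_interp hf (hb' i) (ha' j)]
    push_cast
    rfl
  rw [h3]
  have : U * (star U * (cfc f (B : Matrix n n ℂ) - cfc f (A : Matrix n n ℂ)) * V) * star V =
      (U * star U) * (cfc f (B : Matrix n n ℂ) - cfc f (A : Matrix n n ℂ)) * (V * star V) := by
    simp only [mul_assoc]
  rw [this, hU2, hV2, one_mul, mul_one]
  rfl

/-- The domain of positivity of `(s, B) ↦ s L_B + (1 - s) R_A` is open. -/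
theorem isOpen_interp (A : selfAdjoint (Matrix n n ℂ)) :
    IsOpen {p : ℝ × selfAdjoint (Matrix n n ℂ) |
      (interp p.1 p.2 A : Matrix (n × n) (n × n) ℂ).PosDef} :=
  isOpen_posDef.preimage (contDiff_interp (k := 0) A).continuous

theorem isOpen_interp_self :
    IsOpen {p : ℝ × selfAdjoint (Matrix n n ℂ) |
      (interp p.1 p.2 p.2 : Matrix (n × n) (n × n) ℂ).PosDef} :=
  isOpen_posDef.preimage (contDiff_interp_self (n := n) (k := 0)).continuous

theorem hasFDerivAt_hermFun {f : ℝ → ℝ} (hf : ContDiffOn ℝ 1 f (Ioi 0))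
    {A : selfAdjoint (Matrix n n ℂ)} (hA : (A : Matrix n n ℂ).PosDef) :
    HasFDerivAt (hermFun f) (∫ s in (0 : ℝ)..1, action (hermFun (deriv f) (interp s A A))) A := by
  have hder : ContinuousOn (deriv f) (Ioi 0) := hf.continuousOn_deriv_of_isOpen isOpen_Ioi le_rfl
  have hcont : ContinuousOn
      (fun B => ∫ s in (0 : ℝ)..1, action (hermFun (deriv f) (interp s B A)))
      {B : selfAdjoint (Matrix n n ℂ) | (B : Matrix n n ℂ).PosDef} := by
    refine continuousOn_parametric_integral
      (g := fun p : ℝ × selfAdjoint (Matrix n n ℂ) => action (hermFun (deriv f) (interp p.1 p.2 A)))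
      (isOpen_interp A) (fun s hs B hB => posDef_interp hs hB hA) ?_
    refine (action (n := n)).continuous.comp_continuousOn
      ((continuousOn_hermFun hder).comp ?_ fun p hp => hp)
    exact (contDiff_interp (k := 0) A).continuous.continuousOn
  have hct := (hcont A hA).continuousAt (isOpen_posDef.mem_nhds hA)
  have hev : ∀ᶠ B : selfAdjoint (Matrix n n ℂ) in 𝓝 A, (B : Matrix n n ℂ).PosDef :=
    isOpen_posDef.mem_nhds hA
  refine hasFDerivAt_of_increment
    (M := fun B => ∫ s in (0 : ℝ)..1, action (hermFun (deriv f) (interp s B A))) hct ?_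
  filter_upwards [hev] with B hB
  exact hermFun_sub hf hB hA

/-- The standard matrix function of a `C^k` function is `C^k` on positive definite matrices. The
induction on `k` passes from matrices of size `n` to matrices of size `n²`. -/
theorem contDiffOn_hermFun (k : ℕ) :
    ∀ {n : Type} [Fintype n] [DecidableEq n] {f : ℝ → ℝ}, ContDiffOn ℝ k f (Ioi 0) →
    ContDiffOn ℝ k (hermFun f) {A : selfAdjoint (Matrix n n ℂ) | (A : Matrix n n ℂ).PosDef} := by
  induction k with
  | zero =>
    intro n _ _ f hf
    simp only [Nat.cast_zero, contDiffOn_zero] at hf ⊢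
    exact continuousOn_hermFun hf
  | succ k ih =>
    intro n _ _ f hf
    have hf1 : ContDiffOn ℝ 1 f (Ioi 0) := hf.of_le (by norm_cast; omega)
    have hder : ContDiffOn ℝ k (deriv f) (Ioi 0) := hf.deriv_of_isOpen isOpen_Ioi (by norm_cast)
    refine contDiffOn_succ_of_hasFDerivAt isOpen_posDef ?_ fun A hA => hasFDerivAt_hermFun hf1 hA
    have h1 : ContDiffOn ℝ k
        (fun p : ℝ × selfAdjoint (Matrix n n ℂ) => hermFun (deriv f) (interp p.1 p.2 p.2))
        {p | (interp p.1 p.2 p.2 : Matrix (n × n) (n × n) ℂ).PosDef} :=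
      ContDiffOn.comp (ih (n := n × n) hder) contDiff_interp_self.contDiffOn fun p hp => hp
    have h2 := (ContinuousLinearMap.contDiff (𝕜 := ℝ) (E := selfAdjoint (Matrix (n × n) (n × n) ℂ))
      (F := selfAdjoint (Matrix n n ℂ) →L[ℝ] selfAdjoint (Matrix n n ℂ)) action).comp_contDiffOn h1
    exact contDiffOn_parametric_integral (E := selfAdjoint (Matrix n n ℂ))
      (F := selfAdjoint (Matrix n n ℂ) →L[ℝ] selfAdjoint (Matrix n n ℂ)) k
      isOpen_interp_self isOpen_posDef (fun s hs B hB => posDef_interp hs hB hB) h2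

end Derivative

/-! ### Derivatives of traces of matrix functions -/

section Trace

variable {d : ℕ}

theorem contDiffOn_matFun {k : ℕ} {f : ℝ → ℝ} (hf : ContDiffOn ℝ k f (Ioi 0)) :
    ContDiffOn ℝ k (matFun f : Herm d → Herm d) {A | IsPD A} := contDiffOn_hermFun k hf

theorem hasFDerivAt_matFun {f : ℝ → ℝ} (hf : ContDiffOn ℝ 1 f (Ioi 0)) {A : Herm d} (hA : IsPD A) :
    HasFDerivAt (matFun f : Herm d → Herm d) (D1 f A) A :=
  (hasFDerivAt_hermFun hf hA).differentiableAt.hasFDerivAt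

theorem re_trace_selfAdjointPart (Y : Herm d) (M : Matrix (Fin d) (Fin d) ℂ) :
    hs Y (selfAdjointPartCLM M) = (Matrix.trace ((Y : Matrix (Fin d) (Fin d) ℂ) * M)).re := by
  have hcoe : ((selfAdjointPartCLM M : Herm d) : Matrix (Fin d) (Fin d) ℂ) =
      (⅟2 : ℝ) • (M + star M) := rfl
  have h2 : (Matrix.trace ((Y : Matrix (Fin d) (Fin d) ℂ) * star M)).re =
      (Matrix.trace ((Y : Matrix (Fin d) (Fin d) ℂ) * M)).re := by
    have : (Y : Matrix (Fin d) (Fin d) ℂ) * star M = (M * (Y : Matrix (Fin d) (Fin d) ℂ))ᴴ := by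
      rw [conjTranspose_mul]
      congr 1
      exact (isSelfAdjoint_coe Y).symm
    rw [this, trace_conjTranspose, Matrix.trace_mul_comm]
    simp
  rw [hs, hcoe, mul_smul_comm, trace_smul, mul_add, trace_add, Complex.smul_re, Complex.add_re, h2]
  simp
  ring

theorem hs_schurMap (Y : Herm d) (U X : Matrix (Fin d) (Fin d) ℂ) (γ : Fin d → Fin d → ℝ) :
    hs Y (schurMap U X U γ) = ∑ i, ∑ j, γ i j *
      ((star U * (Y : Matrix (Fin d) (Fin d) ℂ) * U) j i * X i j).re := by
  rw [schurMap_apply, re_trace_selfAdjointPart]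
  have : Matrix.trace ((Y : Matrix (Fin d) (Fin d) ℂ) *
      (U * (Matrix.of fun i j => (γ i j : ℂ) * X i j) * star U)) =
      Matrix.trace ((star U * (Y : Matrix (Fin d) (Fin d) ℂ) * U) *
        (Matrix.of fun i j => (γ i j : ℂ) * X i j)) := by
    rw [← mul_assoc, Matrix.trace_mul_comm]
    simp only [mul_assoc]
  rw [this, Matrix.trace, Complex.re_sum, Finset.sum_comm' (t' := Finset.univ)
    (s' := fun _ => Finset.univ) (by simp)]
  refine Finset.sum_congr rfl fun i _ => ?_
  rw [Matrix.diag_apply, Matrix.mul_apply, Complex.re_sum]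
  refine Finset.sum_congr rfl fun j _ => ?_
  rw [of_apply, mul_left_comm, Complex.re_ofReal_mul]

/-- The Daleckii-Krein formula: in an eigenbasis of `A`, the derivative of `f` at `A` multiplies the
matrix entries by the divided differences `∫₀¹ f'(s aᵢ + (1 - s) aⱼ) ds`. -/
theorem exists_hs_D1 {f : ℝ → ℝ} (hf : ContDiffOn ℝ 1 f (Ioi 0)) {A : Herm d} (hA : IsPD A) :
    ∃ U ∈ unitaryGroup (Fin d) ℂ, ∃ a : Fin d → ℝ, (∀ i, 0 < a i) ∧
      (A : Matrix (Fin d) (Fin d) ℂ) = U * Matrix.diagonal (fun i => (a i : ℂ)) * star U ∧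
      ∀ X Y : Herm d, hs Y (D1 f A X) =
        ∑ i, ∑ j, (∫ s in (0 : ℝ)..1, deriv f (s * a i + (1 - s) * a j)) *
          ((star U * (Y : Matrix (Fin d) (Fin d) ℂ) * U) j i *
            (star U * (X : Matrix (Fin d) (Fin d) ℂ) * U) i j).re := by
  obtain ⟨U, hU, a, hAU, ha⟩ := exists_diagonalization A
  have ha' : ∀ i, 0 < a i := fun i => isPD_iff_spectrum.1 hA (ha i)
  refine ⟨U, hU, a, ha', hAU, fun X Y => ?_⟩
  have hder : ContinuousOn (deriv f) (Ioi 0) := hf.continuousOn_deriv_of_isOpen isOpen_Ioi le_rfl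
  have h1 : D1 f A = ∫ s in (0 : ℝ)..1, action (hermFun (deriv f) (interp s A A)) :=
    (hasFDerivAt_hermFun hf hA).fderiv
  rw [h1, integral_action hU hU hAU hAU hA hA ha' ha' hder, hs_schurMap]

theorem integral_interp_comm (φ : ℝ → ℝ) (a b : ℝ) :
    ∫ s in (0 : ℝ)..1, φ (s * a + (1 - s) * b) = ∫ s in (0 : ℝ)..1, φ (s * b + (1 - s) * a) := by
  have := intervalIntegral.integral_comp_sub_left (a := 0) (b := 1)
    (fun s => φ (s * a + (1 - s) * b)) 1
  simp only [sub_zero, sub_self, sub_sub_cancel] at this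
  rw [← this]
  congr 1
  ext s
  ring_nf

theorem hs_D1_comm {f : ℝ → ℝ} (hf : ContDiffOn ℝ 1 f (Ioi 0)) {A : Herm d} (hA : IsPD A)
    (X Y : Herm d) : hs Y (D1 f A X) = hs X (D1 f A Y) := by
  obtain ⟨U, hU, a, ha, hAU, h⟩ := exists_hs_D1 hf hA
  rw [h, h, Finset.sum_comm]
  refine Finset.sum_congr rfl fun i _ => Finset.sum_congr rfl fun j _ => ?_
  rw [integral_interp_comm, mul_comm ((star U * (Y : Matrix (Fin d) (Fin d) ℂ) * U) i j)]

theorem re_mul_conj_entry (X : Herm d) (U : Matrix (Fin d) (Fin d) ℂ) (i j : Fin d) :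
    ((star U * (X : Matrix (Fin d) (Fin d) ℂ) * U) j i *
      (star U * (X : Matrix (Fin d) (Fin d) ℂ) * U) i j).re =
      ‖(star U * (X : Matrix (Fin d) (Fin d) ℂ) * U) i j‖ ^ 2 := by
  have hH : (star U * (X : Matrix (Fin d) (Fin d) ℂ) * U).IsHermitian :=
    isHermitian_conjTranspose_mul_mul U (isSelfAdjoint_coe X)
  rw [← hH.apply j i, Complex.star_def, mul_comm, Complex.mul_conj, Complex.normSq_eq_norm_sq,
    Complex.ofReal_re]

theorem hs_D1_self_nonneg {f : ℝ → ℝ} (hf : ContDiffOn ℝ 1 f (Ioi 0))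
    (hpos : ∀ t, 0 < t → 0 ≤ deriv f t) {A : Herm d} (hA : IsPD A) (X : Herm d) :
    0 ≤ hs X (D1 f A X) := by
  obtain ⟨U, hU, a, ha, hAU, h⟩ := exists_hs_D1 hf hA
  rw [h]
  refine Finset.sum_nonneg fun i _ => Finset.sum_nonneg fun j _ => ?_
  rw [re_mul_conj_entry]
  refine mul_nonneg (intervalIntegral.integral_nonneg zero_le_one fun s hs => hpos _ ?_)
    (by positivity)
  rcases hs.1.eq_or_lt with rfl | h0
  · simpa using ha j
  · exact add_pos_of_pos_of_nonneg (mul_pos h0 (ha i)) (mul_nonneg (sub_nonneg.2 hs.2) (ha j).le)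

theorem eq_zero_of_hs_D1_self {f : ℝ → ℝ} (hf : ContDiffOn ℝ 1 f (Ioi 0))
    (hpos : ∀ t, 0 < t → 0 < deriv f t) {A : Herm d} (hA : IsPD A) {X : Herm d}
    (hX : hs X (D1 f A X) = 0) : X = 0 := by
  obtain ⟨U, hU, a, ha, hAU, h⟩ := exists_hs_D1 hf hA
  have hder : ContinuousOn (deriv f) (Ioi 0) := hf.continuousOn_deriv_of_isOpen isOpen_Ioi le_rfl
  have hΓ : ∀ i j, 0 < ∫ s in (0 : ℝ)..1, deriv f (s * a i + (1 - s) * a j) := by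
    intro i j
    have hp : ∀ s ∈ Icc (0 : ℝ) 1, 0 < s * a i + (1 - s) * a j := fun s hs => by
      rcases hs.1.eq_or_lt with rfl | h0
      · simpa using ha j
      · exact add_pos_of_pos_of_nonneg (mul_pos h0 (ha i))
          (mul_nonneg (sub_nonneg.2 hs.2) (ha j).le)
    refine intervalIntegral.intervalIntegral_pos_of_pos_on ?_
      (fun s hs => hpos _ (hp s (Ioo_subset_Icc_self hs))) zero_lt_one
    refine ContinuousOn.intervalIntegrable ?_
    rw [uIcc_of_le zero_le_one]
    exact hder.comp (by fun_prop) hp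
  rw [h] at hX
  simp only [re_mul_conj_entry] at hX
  have hz : star U * (X : Matrix (Fin d) (Fin d) ℂ) * U = 0 := by
    ext i j
    rw [Finset.sum_eq_zero_iff_of_nonneg (fun i _ => Finset.sum_nonneg fun j _ =>
      mul_nonneg (hΓ i j).le (by positivity))] at hX
    have h1 := hX i (Finset.mem_univ i)
    rw [Finset.sum_eq_zero_iff_of_nonneg (fun j _ => mul_nonneg (hΓ i j).le (by positivity))] at h1
    have h2 := h1 j (Finset.mem_univ j)
    rcases mul_eq_zero.1 h2 with h3 | h3
    · exact absurd h3 (hΓ i j).ne'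
    · simpa using h3
  have hU2 : U * star U = 1 := mem_unitaryGroup_iff.1 hU
  have : (X : Matrix (Fin d) (Fin d) ℂ) = U * (star U * X * U) * star U := by
    have : U * (star U * (X : Matrix (Fin d) (Fin d) ℂ) * U) * star U =
      (U * star U) * X * (U * star U) := by simp only [mul_assoc]
    rw [this, hU2, one_mul, mul_one]
  rw [hz] at this
  ext1
  simpa using this

/-- The trace of the derivative: `Tr Df[A](X) = Tr f'(A) X`. -/
theorem tr_D1 {f : ℝ → ℝ} (hf : ContDiffOn ℝ 1 f (Ioi 0)) {A : Herm d} (hA : IsPD A)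
    (X : Herm d) : tr (D1 f A X) = hs (matFun (deriv f) A) X := by
  obtain ⟨U, hU, a, ha, hAU, h⟩ := exists_hs_D1 hf hA
  have hU1 : star U * U = 1 := mem_unitaryGroup_iff'.1 hU
  rw [← hs_one, h]
  have e1 : star U * ((1 : Herm d) : Matrix (Fin d) (Fin d) ℂ) * U = 1 := by
    rw [show ((1 : Herm d) : Matrix (Fin d) (Fin d) ℂ) = 1 from rfl, mul_one, hU1]
  have e2 : Matrix.trace (U * Matrix.diagonal (fun i => ((deriv f (a i) : ℝ) : ℂ)) * star U *
      (X : Matrix (Fin d) (Fin d) ℂ)) =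
      Matrix.trace (Matrix.diagonal (fun i => ((deriv f (a i) : ℝ) : ℂ)) *
        (star U * (X : Matrix (Fin d) (Fin d) ℂ) * U)) := by
    rw [mul_assoc, mul_assoc, Matrix.trace_mul_comm]
    simp only [mul_assoc]
  rw [e1, hs, coe_matFun, hAU, cfc_conj_diagonal hU, e2, Matrix.trace, Complex.re_sum]
  refine Finset.sum_congr rfl fun i _ => ?_
  rw [Finset.sum_eq_single i]
  · have : ∀ s : ℝ, s * a i + (1 - s) * a i = a i := fun s => by ring
    simp only [this, one_apply_eq, one_mul, intervalIntegral.integral_const, sub_zero, one_smul]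
    rw [Matrix.diag_apply, diagonal_mul, Complex.re_ofReal_mul]
  · intro j _ hj
    rw [one_apply_ne hj]
    simp
  · simp

/-- An identity for the first derivative of `φ` differentiates to one for the second derivative. -/
theorem functional_iteratedFDeriv_two {E : Type} [NormedAddCommGroup E] [NormedSpace ℝ E]
    {φ ψ : E → E} {U : Set E} (hU : IsOpen U) (hφ : ContDiffOn ℝ 2 φ U) (ℓ : E →L[ℝ] ℝ)
    (b : E →L[ℝ] E →L[ℝ] ℝ) (h : ∀ x ∈ U, ∀ v, ℓ (fderiv ℝ φ x v) = b (ψ x) v) {x : E} (hx : x ∈ U)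
    (hψ : DifferentiableAt ℝ ψ x) (u v : E) :
    ℓ (iteratedFDeriv ℝ 2 φ x ![u, v]) = b (fderiv ℝ ψ x u) v := by
  rw [iteratedFDeriv_two_apply]
  have hd : DifferentiableAt ℝ (fderiv ℝ φ) x :=
    ((hφ.fderiv_of_isOpen (m := 1) hU (by norm_num)).differentiableOn one_ne_zero).differentiableAt
      (hU.mem_nhds hx)
  have h1 : HasFDerivAt (fun y => ℓ (fderiv ℝ φ y v))
      ((ℓ.comp (ContinuousLinearMap.apply ℝ E v)).comp (fderiv ℝ (fderiv ℝ φ) x)) x :=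
    (ℓ.comp (ContinuousLinearMap.apply ℝ E v)).hasFDerivAt.comp x hd.hasFDerivAt
  have h2 : HasFDerivAt (fun y => b (ψ y) v)
      (((ContinuousLinearMap.apply ℝ ℝ v).comp b).comp (fderiv ℝ ψ x)) x :=
    ((ContinuousLinearMap.apply ℝ ℝ v).comp b).hasFDerivAt.comp x hψ.hasFDerivAt
  have h3 : (fun y => ℓ (fderiv ℝ φ y v)) =ᶠ[𝓝 x] fun y => b (ψ y) v := by
    filter_upwards [hU.mem_nhds hx] with y hy using h y hy v
  have := h1.unique (h2.congr_of_eventuallyEq h3)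
  exact congrArg (fun T => T u) this

theorem contDiffOn_deriv {k : ℕ} {f : ℝ → ℝ} (hf : ContDiffOn ℝ (k + 1 : ℕ) f (Ioi 0)) :
    ContDiffOn ℝ k (deriv f) (Ioi 0) := hf.deriv_of_isOpen isOpen_Ioi (by norm_cast)

/-- The trace of the second derivative: `Tr D²Φ[A](X, Y) = ⟨DΦ'[A](X), Y⟩`. -/
theorem tr_D2 {Φ : ℝ → ℝ} (hΦ : ContDiffOn ℝ 2 Φ (Ioi 0)) {A : Herm d} (hA : IsPD A)
    (X Y : Herm d) : tr (D2 Φ A X Y) = hs (D1 (deriv Φ) A X) Y :=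
  functional_iteratedFDeriv_two (E := Herm d) (φ := matFun Φ) (ψ := matFun (deriv Φ)) isOpen_isPD
    (contDiffOn_matFun hΦ) trCLM hsCLM
    (fun _ hx v => tr_D1 (hΦ.of_le one_le_two) hx v) hA
    (hasFDerivAt_matFun (contDiffOn_deriv hΦ) hA).differentiableAt X Y

end Trace

/-! ### Jointly convex functions built from a convex function -/

section Bregman

variable {E : Type} [NormedAddCommGroup E] [NormedSpace ℝ E]

/-- `g` is twice differentiable on the open convex set `U`, with gradient `G` and Hessian `H`. -/
structure TwiceDiff (U : Set E) (g : E → ℝ) (G : E → E →L[ℝ] ℝ) (H : E → E →L[ℝ] E →L[ℝ] ℝ) :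
    Prop where
  isOpen : IsOpen U
  convex : Convex ℝ U
  grad : ∀ x ∈ U, HasFDerivAt g (G x) x
  hess : ∀ x ∈ U, HasFDerivAt G (H x) x

/-- The Brègman divergence of `g` between `x + v` and `x`. -/
def bregman (g : E → ℝ) (G : E → E →L[ℝ] ℝ) (p : E × E) : ℝ := g (p.1 + p.2) - g p.1 - G p.1 p.2

theorem le_of_hasDerivAt_nonneg {r r' : ℝ → ℝ} {t : ℝ} (ht : 0 ≤ t)
    (h : ∀ s ∈ Icc 0 t, HasDerivAt r (r' s) s) (h0 : ∀ s ∈ Icc 0 t, 0 ≤ r' s) : r 0 ≤ r t := by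
  refine monotoneOn_of_deriv_nonneg (convex_Icc 0 t)
    (fun s hs => (h s hs).continuousAt.continuousWithinAt)
    (fun s hs => (h s (interior_subset hs)).differentiableAt.differentiableWithinAt) (fun s hs => ?_)
    (left_mem_Icc.2 ht) (right_mem_Icc.2 ht) ht
  rw [(h s (interior_subset hs)).deriv]
  exact h0 s (interior_subset hs)

theorem hasDerivAt_line (x v : E) (s : ℝ) : HasDerivAt (fun s : ℝ => x + s • v) v s := by
  simpa using ((hasDerivAt_id s).smul_const v).const_add x

namespace TwiceDiff

variable {U : Set E} {g : E → ℝ} {G : E → E →L[ℝ] ℝ} {H : E → E →L[ℝ] E →L[ℝ] ℝ}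
  (h : TwiceDiff U g G H)
include h

theorem mem_segment {x v : E} (hx : x ∈ U) (hv : x + v ∈ U) {s : ℝ} (hs : s ∈ Icc (0 : ℝ) 1) :
    x + s • v ∈ U :=
  h.convex.add_smul_mem hx hv hs

theorem hasDerivAt_fun {x v : E} {s : ℝ} (hs : x + s • v ∈ U) :
    HasDerivAt (fun s : ℝ => g (x + s • v)) (G (x + s • v) v) s :=
  (h.grad _ hs).comp_hasDerivAt s (hasDerivAt_line x v s)

theorem hasDerivAt_grad {x v w : E} {s : ℝ} (hs : x + s • v ∈ U) :
    HasDerivAt (fun s : ℝ => G (x + s • v) w) (H (x + s • v) v w) s := by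
  have := (h.hess _ hs).comp_hasDerivAt s (hasDerivAt_line x v s)
  exact ((ContinuousLinearMap.apply ℝ ℝ w).hasFDerivAt.comp_hasDerivAt s this)

theorem eventually_mem {x : E} (hx : x ∈ U) (v : E) : ∀ᶠ ε : ℝ in 𝓝[>] 0, x + ε • v ∈ U := by
  have : Tendsto (fun ε : ℝ => x + ε • v) (𝓝 0) (𝓝 x) := by
    simpa using (hasDerivAt_line x v 0).continuousAt.tendsto
  exact (this.mono_left nhdsWithin_le_nhds).eventually (h.isOpen.mem_nhds hx)

/-- The monotonicity in `s` behind both implications from the convexity of the Hessian form. -/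
theorem grad_combo_mono (hq : ConvexOn ℝ {p : E × E | p.1 ∈ U} (fun p => H p.1 p.2 p.2))
    {x v x' v' : E} (hx : x ∈ U) (hv : x + v ∈ U) (hx' : x' ∈ U) (hv' : x' + v' ∈ U)
    {a b : ℝ} (ha : 0 ≤ a) (hb : 0 ≤ b) (hab : a + b = 1) {t : ℝ} (ht : t ∈ Icc (0 : ℝ) 1) :
    G ((a • x + b • x') + t • (a • v + b • v')) (a • v + b • v') -
        G (a • x + b • x') (a • v + b • v') ≤
      a * (G (x + t • v) v - G x v) + b * (G (x' + t • v') v' - G x' v') := by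
  have hx'' : a • x + b • x' ∈ U := h.convex hx hx' ha hb hab
  have hv'' : (a • x + b • x') + (a • v + b • v') ∈ U := by
    have := h.convex hv hv' ha hb hab
    convert this using 1
    module
  have key := le_of_hasDerivAt_nonneg (t := t) (r := fun s =>
      a * G (x + s • v) v + b * G (x' + s • v') v' -
        G ((a • x + b • x') + s • (a • v + b • v')) (a • v + b • v'))
    (r' := fun s => a * H (x + s • v) v v + b * H (x' + s • v') v' v' -
        H ((a • x + b • x') + s • (a • v + b • v')) (a • v + b • v') (a • v + b • v')) ht.1 ?_ ?_
  · simp only [zero_smul, add_zero] at key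
    linarith
  · intro s hs
    have hs' : s ∈ Icc (0 : ℝ) 1 := ⟨hs.1, hs.2.trans ht.2⟩
    exact (((h.hasDerivAt_grad (h.mem_segment hx hv hs')).const_mul a).add
      ((h.hasDerivAt_grad (h.mem_segment hx' hv' hs')).const_mul b)).sub
        (h.hasDerivAt_grad (h.mem_segment hx'' hv'' hs'))
  · intro s hs
    have hs' : s ∈ Icc (0 : ℝ) 1 := ⟨hs.1, hs.2.trans ht.2⟩
    have := hq.2 (x := (x + s • v, v)) (h.mem_segment hx hv hs') (y := (x' + s • v', v'))
      (h.mem_segment hx' hv' hs') ha hb hab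
    have e : a • (x + s • v, v) + b • (x' + s • v', v') =
        ((a • x + b • x') + s • (a • v + b • v'), a • v + b • v') := by
      ext1
      · simp only [Prod.fst_add, Prod.smul_fst]; module
      · simp
    rw [e] at this
    simp only [smul_eq_mul] at this
    linarith

theorem convex_dom : Convex ℝ {p : E × E | p.1 ∈ U ∧ p.1 + p.2 ∈ U} := by
  intro p hp p' hp' a b ha hb hab
  refine ⟨h.convex hp.1 hp'.1 ha hb hab, ?_⟩
  have := h.convex hp.2 hp'.2 ha hb hab
  convert this using 1
  simp only [Prod.fst_add, Prod.snd_add, Prod.smul_fst, Prod.smul_snd]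
  module

theorem gradDiff_of_hess (hq : ConvexOn ℝ {p : E × E | p.1 ∈ U} (fun p => H p.1 p.2 p.2)) :
    ConvexOn ℝ {p : E × E | p.1 ∈ U ∧ p.1 + p.2 ∈ U}
      (fun p => G (p.1 + p.2) p.2 - G p.1 p.2) := by
  refine ⟨h.convex_dom, fun p hp p' hp' a b ha hb hab => ?_⟩
  have := h.grad_combo_mono hq hp.1 hp.2 hp'.1 hp'.2 ha hb hab (t := 1) (by simp)
  simpa using this

theorem bregman_of_hess (hq : ConvexOn ℝ {p : E × E | p.1 ∈ U} (fun p => H p.1 p.2 p.2)) :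
    ConvexOn ℝ {p : E × E | p.1 ∈ U ∧ p.1 + p.2 ∈ U} (bregman g G) := by
  refine ⟨h.convex_dom, ?_⟩
  rintro ⟨x, v⟩ ⟨hx, hv⟩ ⟨x', v'⟩ ⟨hx', hv'⟩ a b ha hb hab
  have hx'' : a • x + b • x' ∈ U := h.convex hx hx' ha hb hab
  have hv'' : (a • x + b • x') + (a • v + b • v') ∈ U :=
    (h.convex_dom (x := (x, v)) ⟨hx, hv⟩ (y := (x', v')) ⟨hx', hv'⟩ ha hb hab).2
  have key := le_of_hasDerivAt_nonneg (t := 1) (r := fun s =>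
      a * (g (x + s • v) - s * G x v) + b * (g (x' + s • v') - s * G x' v') -
        (g ((a • x + b • x') + s • (a • v + b • v')) - s * G (a • x + b • x') (a • v + b • v')))
    (r' := fun s => a * (G (x + s • v) v - G x v) + b * (G (x' + s • v') v' - G x' v') -
        (G ((a • x + b • x') + s • (a • v + b • v')) (a • v + b • v') -
          G (a • x + b • x') (a • v + b • v'))) zero_le_one ?_ ?_
  · simp only [zero_smul, add_zero, zero_mul, sub_zero, one_smul, one_mul] at key
    simp only [bregman, Prod.fst_add, Prod.snd_add, Prod.smul_fst, Prod.smul_snd, smul_eq_mul]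
    linarith
  · intro s hs
    have hlin : ∀ c : ℝ, HasDerivAt (fun s : ℝ => s * c) c s := fun c => by
      simpa using (hasDerivAt_id s).mul_const c
    exact ((((h.hasDerivAt_fun (h.mem_segment hx hv hs)).sub (hlin _)).const_mul a).add
      (((h.hasDerivAt_fun (h.mem_segment hx' hv' hs)).sub (hlin _)).const_mul b)).sub
        ((h.hasDerivAt_fun (h.mem_segment hx'' hv'' hs)).sub (hlin _))
  · intro s hs
    have := h.grad_combo_mono hq hx hv hx' hv' ha hb hab hs
    linarith

theorem tendsto_gradDiff {x : E} (hx : x ∈ U) (v : E) :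
    Tendsto (fun ε : ℝ => ε⁻¹ * (G (x + ε • v) v - G x v)) (𝓝[>] 0) (𝓝 (H x v v)) := by
  have h1 := h.hasDerivAt_grad (x := x) (v := v) (w := v) (s := 0) (by simpa using hx)
  simp only [zero_smul, add_zero] at h1
  simpa using h1.tendsto_slope_zero_right

theorem tendsto_bregman {x : E} (hx : x ∈ U) (v : E) :
    Tendsto (fun ε : ℝ => bregman g G (x, ε • v) / ε ^ 2) (𝓝[>] 0) (𝓝 (H x v v / 2)) := by
  have hm := h.eventually_mem hx v
  refine HasDerivAt.lhopital_zero_nhdsGT (f' := fun ε => G (x + ε • v) v - G x v)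
    (g' := fun ε => 2 * ε) ?_ ?_ ?_ ?_ ?_ ?_
  · filter_upwards [hm] with ε hε
    have hlin : HasDerivAt (fun s : ℝ => s * G x v) (G x v) ε := by
      simpa using (hasDerivAt_id ε).mul_const (G x v)
    have := ((h.hasDerivAt_fun hε).sub_const (g x)).sub hlin
    refine this.congr_of_eventuallyEq (Eventually.of_forall fun s => ?_)
    simp [bregman]
  · refine Eventually.of_forall fun ε => ?_
    simpa using hasDerivAt_pow 2 ε
  · filter_upwards [self_mem_nhdsWithin] with ε hε
    have : (0 : ℝ) < ε := hε
    positivity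
  · have h1 : ContinuousAt (fun ε : ℝ => g (x + ε • v) - g x - G x (ε • v)) 0 := by
      have := (h.hasDerivAt_fun (x := x) (v := v) (s := 0) (by simpa using hx)).continuousAt
      refine (this.sub continuousAt_const).sub ?_
      fun_prop
    have h2 := h1.tendsto
    simp only [zero_smul, add_zero, sub_self, map_zero] at h2
    exact h2.mono_left nhdsWithin_le_nhds
  · have : Tendsto (fun ε : ℝ => ε ^ 2) (𝓝 0) (𝓝 0) := by
      simpa using (continuous_pow 2 : Continuous fun ε : ℝ => ε ^ 2).tendsto 0
    exact this.mono_left nhdsWithin_le_nhds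
  · refine ((h.tendsto_gradDiff hx v).div_const 2).congr' ?_
    filter_upwards [self_mem_nhdsWithin] with ε hε
    have : ε ≠ 0 := ne_of_gt hε
    field_simp

/-- The second order limit of a family of functions inherits convexity. -/
theorem hess_of_limit {F : ℝ → E × E → ℝ} {c : ℝ} (hc : 0 < c)
    (hlim : ∀ x ∈ U, ∀ v, Tendsto (fun ε => F ε (x, v)) (𝓝[>] 0) (𝓝 (c * H x v v)))
    (hF : ∀ x ∈ U, ∀ v, ∀ x' ∈ U, ∀ v', ∀ a b : ℝ, 0 ≤ a → 0 ≤ b → a + b = 1 →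
      ∀ᶠ ε in 𝓝[>] 0, F ε (a • x + b • x', a • v + b • v') ≤ a * F ε (x, v) + b * F ε (x', v')) :
    ConvexOn ℝ {p : E × E | p.1 ∈ U} (fun p => H p.1 p.2 p.2) := by
  refine ⟨fun p hp p' hp' a b ha hb hab => h.convex hp hp' ha hb hab, ?_⟩
  rintro ⟨x, v⟩ hx ⟨x', v'⟩ hx' a b ha hb hab
  have h1 := hlim _ (h.convex hx hx' ha hb hab) (a • v + b • v')
  have h2 := ((hlim x hx v).const_mul a).add ((hlim x' hx' v').const_mul b)
  have := le_of_tendsto_of_tendsto h1 h2 (hF x hx v x' hx' v' a b ha hb hab)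
  simp only [Prod.fst_add, Prod.snd_add, Prod.smul_fst, Prod.smul_snd, smul_eq_mul]
  nlinarith

theorem hess_of_bregman
    (hb : ConvexOn ℝ {p : E × E | p.1 ∈ U ∧ p.1 + p.2 ∈ U} (bregman g G)) :
    ConvexOn ℝ {p : E × E | p.1 ∈ U} (fun p => H p.1 p.2 p.2) := by
  refine h.hess_of_limit (F := fun ε p => bregman g G (p.1, ε • p.2) / ε ^ 2)
    (c := 1 / 2) (by norm_num) (fun x hx v => ?_) fun x hx v x' hx' v' a b ha hb' hab => ?_
  · convert h.tendsto_bregman hx v using 2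
    ring
  · filter_upwards [h.eventually_mem hx v, h.eventually_mem hx' v', self_mem_nhdsWithin]
      with ε h1 h2 hε
    have hε' : (0 : ℝ) < ε := hε
    have := hb.2 (x := (x, ε • v)) ⟨hx, h1⟩ (y := (x', ε • v')) ⟨hx', h2⟩ ha hb' hab
    have e : a • (x, ε • v) + b • (x', ε • v') = (a • x + b • x', ε • (a • v + b • v')) := by
      ext1
      · simp
      · simp only [Prod.snd_add, Prod.smul_snd]; module
    rw [e, smul_eq_mul, smul_eq_mul] at this
    calc _ ≤ (a * bregman g G (x, ε • v) + b * bregman g G (x', ε • v')) / ε ^ 2 := by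
          gcongr
      _ = _ := by ring

theorem hess_of_gradDiff
    (hb : ConvexOn ℝ {p : E × E | p.1 ∈ U ∧ p.1 + p.2 ∈ U}
      (fun p => G (p.1 + p.2) p.2 - G p.1 p.2)) :
    ConvexOn ℝ {p : E × E | p.1 ∈ U} (fun p => H p.1 p.2 p.2) := by
  refine h.hess_of_limit (F := fun ε p => ε⁻¹ * (G (p.1 + ε • p.2) p.2 - G p.1 p.2))
    (c := 1) (by norm_num) (fun x hx v => ?_) fun x hx v x' hx' v' a b ha hb' hab => ?_
  · rw [one_mul]
    exact h.tendsto_gradDiff hx v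
  · filter_upwards [h.eventually_mem hx v, h.eventually_mem hx' v', self_mem_nhdsWithin]
      with ε h1 h2 hε
    have hε' : (0 : ℝ) < ε := hε
    have := hb.2 (x := (x, ε • v)) ⟨hx, h1⟩ (y := (x', ε • v')) ⟨hx', h2⟩ ha hb' hab
    have e : a • (x, ε • v) + b • (x', ε • v') = (a • x + b • x', ε • (a • v + b • v')) := by
      ext1
      · simp
      · simp only [Prod.snd_add, Prod.smul_snd]; module
    rw [e] at this
    simp only [(G _).map_smul ε, smul_eq_mul] at this
    have h3 : ε * (G (a • x + b • x' + ε • (a • v + b • v')) (a • v + b • v') -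
        G (a • x + b • x') (a • v + b • v')) ≤
      ε * (a * (G (x + ε • v) v - G x v) + b * (G (x' + ε • v') v' - G x' v')) := by
      linarith
    have h4 := le_of_mul_le_mul_left h3 hε'
    calc _ ≤ ε⁻¹ * (a * (G (x + ε • v) v - G x v) + b * (G (x' + ε • v') v' - G x' v')) := by
          gcongr
      _ = _ := by ring

theorem hess_of_jensen
    (hb : ConvexOn ℝ {p : E × E | p.1 ∈ U ∧ p.2 ∈ U}
      (fun p => (1 / 2) * g p.1 + (1 / 2) * g p.2 - g ((1 / 2 : ℝ) • p.1 + (1 / 2 : ℝ) • p.2))) :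
    ConvexOn ℝ {p : E × E | p.1 ∈ U} (fun p => H p.1 p.2 p.2) := by
  refine h.hess_of_limit (F := fun ε p =>
      (1 / 2) * (bregman g G (p.1, ε • p.2) / ε ^ 2) +
        (1 / 2) * (bregman g G (p.1, ε • (-p.2)) / ε ^ 2))
    (c := 1 / 2) (by norm_num) (fun x hx v => ?_) fun x hx v x' hx' v' a b ha hb' hab => ?_
  · convert ((h.tendsto_bregman hx v).const_mul (1 / 2)).add
      ((h.tendsto_bregman hx (-v)).const_mul (1 / 2)) using 2
    simp only [map_neg, _root_.neg_apply, neg_neg]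
    ring
  · filter_upwards [h.eventually_mem hx v, h.eventually_mem hx' v', h.eventually_mem hx (-v),
      h.eventually_mem hx' (-v'), self_mem_nhdsWithin] with ε h1 h2 h3 h4 hε
    have hε' : (0 : ℝ) < ε := hε
    have := hb.2 (x := (x + ε • v, x + ε • (-v))) ⟨h1, h3⟩
      (y := (x' + ε • v', x' + ε • (-v'))) ⟨h2, h4⟩ ha hb' hab
    have key : ∀ y w : E, (1 / 2) * (bregman g G (y, ε • w) / ε ^ 2) +
        (1 / 2) * (bregman g G (y, ε • (-w)) / ε ^ 2) =
        ((1 / 2) * g (y + ε • w) + (1 / 2) * g (y + ε • (-w)) -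
          g ((1 / 2 : ℝ) • (y + ε • w) + (1 / 2 : ℝ) • (y + ε • (-w)))) / ε ^ 2 := by
      intro y w
      have : (1 / 2 : ℝ) • (y + ε • w) + (1 / 2 : ℝ) • (y + ε • (-w)) = y := by module
      rw [this]
      simp only [bregman, smul_neg, map_neg]
      ring
    have e : a • (x + ε • v, x + ε • (-v)) + b • (x' + ε • v', x' + ε • (-v')) =
        ((a • x + b • x') + ε • (a • v + b • v'), (a • x + b • x') + ε • (-(a • v + b • v'))) := by
      ext1
      · simp only [Prod.fst_add, Prod.smul_fst]; module
      · simp only [Prod.snd_add, Prod.smul_snd]; module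
    rw [e] at this
    simp only [smul_eq_mul] at this
    simp only [key]
    rw [← mul_div_assoc, ← mul_div_assoc, ← add_div]
    gcongr

/-- The Jensen gap is a combination of two Brègman divergences from the mean. -/
theorem jensen_of_bregman
    (hb : ConvexOn ℝ {p : E × E | p.1 ∈ U ∧ p.1 + p.2 ∈ U} (bregman g G)) {t : ℝ} (ht0 : 0 ≤ t)
    (ht1 : t ≤ 1) :
    ConvexOn ℝ {p : E × E | p.1 ∈ U ∧ p.2 ∈ U}
      (fun p => t * g p.1 + (1 - t) * g p.2 - g (t • p.1 + (1 - t) • p.2)) := by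
  have ht1' : 0 ≤ 1 - t := sub_nonneg.2 ht1
  have key : ∀ p : E × E, t * g p.1 + (1 - t) * g p.2 - g (t • p.1 + (1 - t) • p.2) =
      t * bregman g G (t • p.1 + (1 - t) • p.2, (1 - t) • (p.1 - p.2)) +
        (1 - t) * bregman g G (t • p.1 + (1 - t) • p.2, (-t) • (p.1 - p.2)) := by
    intro p
    have e1 : t • p.1 + (1 - t) • p.2 + (1 - t) • (p.1 - p.2) = p.1 := by module
    have e2 : t • p.1 + (1 - t) • p.2 + (-t) • (p.1 - p.2) = p.2 := by module
    simp only [bregman, e1, e2, map_smul, smul_eq_mul]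
    ring
  refine ⟨fun p hp p' hp' a b ha hb' hab =>
    ⟨h.convex hp.1 hp'.1 ha hb' hab, h.convex hp.2 hp'.2 ha hb' hab⟩, ?_⟩
  intro p hp p' hp' a b ha hb' hab
  have hm1 : ∀ p : E × E, p.1 ∈ U ∧ p.2 ∈ U →
      (t • p.1 + (1 - t) • p.2) ∈ U ∧
      (t • p.1 + (1 - t) • p.2) + (1 - t) • (p.1 - p.2) ∈ U := fun p hp => by
    refine ⟨h.convex hp.1 hp.2 ht0 ht1' (by ring), ?_⟩
    have e1 : t • p.1 + (1 - t) • p.2 + (1 - t) • (p.1 - p.2) = p.1 := by module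
    rw [e1]; exact hp.1
  have hm2 : ∀ p : E × E, p.1 ∈ U ∧ p.2 ∈ U →
      (t • p.1 + (1 - t) • p.2) ∈ U ∧
      (t • p.1 + (1 - t) • p.2) + (-t) • (p.1 - p.2) ∈ U := fun p hp => by
    refine ⟨h.convex hp.1 hp.2 ht0 ht1' (by ring), ?_⟩
    have e1 : t • p.1 + (1 - t) • p.2 + (-t) • (p.1 - p.2) = p.2 := by module
    rw [e1]; exact hp.2
  have i1 := hb.2 (x := (t • p.1 + (1 - t) • p.2, (1 - t) • (p.1 - p.2))) (hm1 p hp)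
    (y := (t • p'.1 + (1 - t) • p'.2, (1 - t) • (p'.1 - p'.2))) (hm1 p' hp') ha hb' hab
  have i2 := hb.2 (x := (t • p.1 + (1 - t) • p.2, (-t) • (p.1 - p.2))) (hm2 p hp)
    (y := (t • p'.1 + (1 - t) • p'.2, (-t) • (p'.1 - p'.2))) (hm2 p' hp') ha hb' hab
  have e1 : ∀ c : ℝ, a • (t • p.1 + (1 - t) • p.2, c • (p.1 - p.2)) +
      b • (t • p'.1 + (1 - t) • p'.2, c • (p'.1 - p'.2)) =
      (t • (a • p + b • p').1 + (1 - t) • (a • p + b • p').2,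
        c • ((a • p + b • p').1 - (a • p + b • p').2)) := by
    intro c
    ext1 <;> simp only [Prod.fst_add, Prod.smul_fst, Prod.snd_add, Prod.smul_snd] <;> module
  rw [e1] at i1 i2
  simp only [key, smul_eq_mul] at i1 i2 ⊢
  nlinarith [mul_le_mul_of_nonneg_left i1 ht0, mul_le_mul_of_nonneg_left i2 ht1']

/-- The tangent inequality of the jointly convex Brègman divergence: as a function of the pair
`(M, Z)`, it lies above its linearisation at `(N, T)`. -/
theorem bregman_tangent
    (hb : ConvexOn ℝ {p : E × E | p.1 ∈ U ∧ p.1 + p.2 ∈ U} (bregman g G)) {T N Z M : E}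
    (hT : T ∈ U) (hN : N ∈ U) (hZ : Z ∈ U) (hM : M ∈ U) :
    g T - g N - G N (T - N) + (G T (Z - T) - G N (Z - T)) - H N (M - N) (T - N) ≤
      g Z - g M - G M (Z - M) := by
  set w := (Z - M) - (T - N) with hw
  have hder : HasDerivAt (fun s : ℝ => g (T + s • (Z - T)) - g (N + s • (M - N)) -
      (G (N + s • (M - N)) (T - N) + s * G (N + s • (M - N)) w))
      (G T (Z - T) - G N (M - N) - (H N (M - N) (T - N) + G N w)) 0 := by
    have hT' : T + (0 : ℝ) • (Z - T) ∈ U := by simpa using hT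
    have hN' : N + (0 : ℝ) • (M - N) ∈ U := by simpa using hN
    have h1 := h.hasDerivAt_fun hT'
    have h2 := h.hasDerivAt_fun hN'
    have h3 := h.hasDerivAt_grad (w := T - N) hN'
    have h4 := (hasDerivAt_id (0 : ℝ)).mul (h.hasDerivAt_grad (w := w) hN')
    have h5 := (h1.sub h2).sub (h3.add h4)
    refine (h5.congr_of_eventuallyEq (Eventually.of_forall fun s => rfl)).congr_deriv ?_
    simp
  have hlim := hder.tendsto_slope_zero_right
  refine sub_nonneg.1 ?_
  have hle : G T (Z - T) - G N (M - N) - (H N (M - N) (T - N) + G N w) ≤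
      bregman g G (M, Z - M) - bregman g G (N, T - N) := by
    refine le_of_tendsto hlim ?_
    have : Ioo (0 : ℝ) 1 ∈ 𝓝[>] (0 : ℝ) := Ioo_mem_nhdsGT zero_lt_one
    filter_upwards [this] with s hs
    have h1 := hb.2 (x := (N, T - N)) ⟨hN, by simpa using hT⟩ (y := (M, Z - M))
      ⟨hM, by simpa using hZ⟩ (sub_nonneg.2 hs.2.le) hs.1.le (by ring : (1 - s) + s = 1)
    have e : (1 - s) • (N, T - N) + s • (M, Z - M) = (N + s • (M - N), (T - N) + s • w) := by
      ext1
      · simp only [Prod.fst_add, Prod.smul_fst]; module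
      · simp only [Prod.snd_add, Prod.smul_snd, hw]; module
    rw [e] at h1
    have e2 : bregman g G (N + s • (M - N), (T - N) + s • w) =
        g (T + s • (Z - T)) - g (N + s • (M - N)) -
          (G (N + s • (M - N)) (T - N) + s * G (N + s • (M - N)) w) := by
      have : N + s • (M - N) + (T - N + s • w) = T + s • (Z - T) := by rw [hw]; module
      simp only [bregman, this, map_add, map_smul, smul_eq_mul]
    rw [e2] at h1
    have e3 : bregman g G (N, T - N) = g T - g N - G N (T - N) := by simp [bregman]
    simp only [zero_add, zero_smul, add_zero, zero_mul, smul_eq_mul] at h1 ⊢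
    rw [inv_mul_le_iff₀ hs.1, ← e3]
    linarith
  have e1 : bregman g G (M, Z - M) = g Z - g M - G M (Z - M) := by simp [bregman]
  have e2 : bregman g G (N, T - N) = g T - g N - G N (T - N) := by simp [bregman]
  have e3 : G N w = G N (Z - T) - G N (M - N) := by
    rw [← map_sub, hw]
    congr 1
    abel
  linarith

theorem gradient_inequality (hH : ∀ x ∈ U, ∀ v, 0 ≤ H x v v) {x y : E} (hx : x ∈ U) (hy : y ∈ U) :
    g x + G x (y - x) ≤ g y := by
  have hy' : x + (y - x) ∈ U := by simpa using hy
  have hmono : ∀ s ∈ Icc (0 : ℝ) 1, 0 ≤ G (x + s • (y - x)) (y - x) - G x (y - x) := by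
    intro s hs
    have := le_of_hasDerivAt_nonneg hs.1 (r := fun s => G (x + s • (y - x)) (y - x))
      (r' := fun s => H (x + s • (y - x)) (y - x) (y - x))
      (fun s' hs' => h.hasDerivAt_grad (h.mem_segment hx hy' ⟨hs'.1, hs'.2.trans hs.2⟩))
      (fun s' hs' => hH _ (h.mem_segment hx hy' ⟨hs'.1, hs'.2.trans hs.2⟩) _)
    simp only [zero_smul, add_zero] at this
    linarith
  have := le_of_hasDerivAt_nonneg zero_le_one
    (r := fun s : ℝ => g (x + s • (y - x)) - s * G x (y - x))
    (r' := fun s => G (x + s • (y - x)) (y - x) - G x (y - x)) (fun s hs => ?_) hmono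
  · simp only [zero_smul, add_zero, zero_mul, sub_zero, one_smul, one_mul, add_sub_cancel] at this
    linarith
  · have hlin : HasDerivAt (fun s : ℝ => s * G x (y - x)) (G x (y - x)) s := by
      simpa using (hasDerivAt_id s).mul_const (G x (y - x))
    exact (h.hasDerivAt_fun (h.mem_segment hx hy' hs)).sub hlin

theorem convexOn (hH : ∀ x ∈ U, ∀ v, 0 ≤ H x v v) : ConvexOn ℝ U g := by
  refine ⟨h.convex, fun x hx y hy a b ha hb hab => ?_⟩
  have hz := h.convex hx hy ha hb hab
  have h1 := h.gradient_inequality hH hz hx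
  have h2 := h.gradient_inequality hH hz hy
  have h3 : a * G (a • x + b • y) (x - (a • x + b • y)) +
      b * G (a • x + b • y) (y - (a • x + b • y)) = 0 := by
    rw [← smul_eq_mul, ← smul_eq_mul, ← map_smul, ← map_smul, ← map_add]
    have : a • (x - (a • x + b • y)) + b • (y - (a • x + b • y)) = 0 := by
      obtain rfl : b = 1 - a := by linarith
      module
    rw [this, map_zero]
  have h4 : g (a • x + b • y) = a * g (a • x + b • y) + b * g (a • x + b • y) := by
    rw [← add_mul, hab, one_mul]
  simp only [smul_eq_mul]
  nlinarith [mul_le_mul_of_nonneg_left h1 ha, mul_le_mul_of_nonneg_left h2 hb]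

end TwiceDiff

end Bregman

/-! ### Trace functions of a convex function -/

section TraceFunctions

variable {d : ℕ} {Φ : ℝ → ℝ}

/-- The gradient `B ↦ Tr[Φ'(A) B]` of `A ↦ Tr Φ(A)`. -/
def trGrad (Φ : ℝ → ℝ) (A : Herm d) : Herm d →L[ℝ] ℝ := hsCLM (matFun (deriv Φ) A)

/-- The Hessian `(B, C) ↦ ⟨DΦ'[A](B), C⟩` of `A ↦ Tr Φ(A)`. -/
def trHess (Φ : ℝ → ℝ) (A : Herm d) : Herm d →L[ℝ] Herm d →L[ℝ] ℝ := hsCLM.comp (D1 (deriv Φ) A)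

theorem trGrad_apply (A B : Herm d) : trGrad Φ A B = hs (matFun (deriv Φ) A) B := rfl
theorem trHess_apply (A B C : Herm d) : trHess Φ A B C = hs (D1 (deriv Φ) A B) C := rfl

theorem hasFDerivAt_clm_comp {E F G : Type} [NormedAddCommGroup E] [NormedSpace ℝ E]
    [NormedAddCommGroup F] [NormedSpace ℝ F] [NormedAddCommGroup G] [NormedSpace ℝ G]
    (L : F →L[ℝ] G) {f : E → F} {f' : E →L[ℝ] F} {x : E} (h : HasFDerivAt f f' x) :
    HasFDerivAt (fun y => L (f y)) (L.comp f') x := L.hasFDerivAt.comp x h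

theorem twiceDiff (hΦ : ContDiffOn ℝ 2 Φ (Ioi 0)) :
    TwiceDiff {A : Herm d | IsPD A} (fun A => tr (matFun Φ A)) (trGrad Φ) (trHess Φ) where
  isOpen := isOpen_isPD
  convex := convex_isPD
  grad A hA := by
    have hΦ1 : ContDiffOn ℝ 1 Φ (Ioi 0) := hΦ.of_le one_le_two
    have h1 : HasFDerivAt (fun A : Herm d => tr (matFun Φ A)) (trCLM.comp (D1 Φ A)) A :=
      (trCLM (d := d)).hasFDerivAt.comp A (hasFDerivAt_matFun hΦ1 hA)
    have h2 : trCLM.comp (D1 Φ A) = trGrad Φ A := by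
      ext B
      exact tr_D1 hΦ1 hA B
    rwa [h2] at h1
  hess A hA := hasFDerivAt_clm_comp (E := Herm d) (F := Herm d) (G := Herm d →L[ℝ] ℝ) hsCLM
    (hasFDerivAt_matFun (contDiffOn_deriv hΦ) hA)

theorem deriv_deriv_nonneg (hconv : ConvexOn ℝ (Ici 0) Φ) (hΦ : ContDiffOn ℝ 2 Φ (Ioi 0)) {t : ℝ}
    (ht : 0 < t) : 0 ≤ deriv (deriv Φ) t := by
  have h1 : MonotoneOn (deriv Φ) (Ioi 0) :=
    (hconv.subset Ioi_subset_Ici_self (convex_Ioi 0)).monotoneOn_deriv fun x hx =>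
      (hΦ.differentiableOn two_ne_zero).differentiableAt (isOpen_Ioi.mem_nhds hx)
  have := h1.derivWithin_nonneg (x := t)
  rwa [derivWithin_of_isOpen isOpen_Ioi ht] at this

theorem trHess_nonneg (hconv : ConvexOn ℝ (Ici 0) Φ) (hΦ : ContDiffOn ℝ 2 Φ (Ioi 0)) {A : Herm d}
    (hA : IsPD A) (B : Herm d) : 0 ≤ trHess Φ A B B := by
  rw [trHess_apply, hs_comm]
  exact hs_D1_self_nonneg (contDiffOn_deriv hΦ) (fun t ht => deriv_deriv_nonneg hconv hΦ ht) hA B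

/-- Convexity passes from `U` to a larger set `S` on which the function is continuous, if `U`
contains the translates of `S` in some direction. -/
theorem convexOn_of_translates {E : Type} [NormedAddCommGroup E] [NormedSpace ℝ E] {S U : Set E}
    {F : E → ℝ} (hS : Convex ℝ S) (e : E) (hUS : U ⊆ S)
    (hU : ∀ x ∈ S, ∀ ε : ℝ, 0 < ε → x + ε • e ∈ U)
    (hF : ContinuousOn F S) (hc : ConvexOn ℝ U F) : ConvexOn ℝ S F := by
  refine ⟨hS, fun x hx y hy a b ha hb hab => ?_⟩
  have hlim : ∀ z ∈ S, Tendsto (fun ε : ℝ => F (z + ε • e)) (𝓝[>] 0) (𝓝 (F z)) := by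
    intro z hz
    refine (hF z hz).tendsto.comp (tendsto_nhdsWithin_iff.2 ⟨?_, ?_⟩)
    · have : Tendsto (fun ε : ℝ => z + ε • e) (𝓝 0) (𝓝 z) := by
        simpa using (hasDerivAt_line z e 0).continuousAt.tendsto
      exact this.mono_left nhdsWithin_le_nhds
    · filter_upwards [self_mem_nhdsWithin] with ε hε using hUS (hU z hz ε hε)
  refine le_of_tendsto_of_tendsto (hlim _ (hS hx hy ha hb hab))
    (((hlim x hx).const_smul a).add ((hlim y hy).const_smul b)) ?_
  filter_upwards [self_mem_nhdsWithin] with ε hε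
  have := hc.2 (hU x hx ε hε) (hU y hy ε hε) ha hb hab
  have e1 : a • (x + ε • e) + b • (y + ε • e) = a • x + b • y + ε • e := by
    obtain rfl : b = 1 - a := by linarith
    module
  rwa [e1] at this

theorem isPD_add_smul_one {A : Herm d} (hA : IsPSD A) {ε : ℝ} (hε : 0 < ε) :
    IsPD (A + ε • (1 : Herm d)) := hA.add_isPD (isPD_smul isPD_one hε)

theorem continuousOn_Ici (hcont : ContinuousWithinAt Φ (Ici 0) 0) (hΦ : ContDiffOn ℝ 2 Φ (Ioi 0)) :
    ContinuousOn Φ (Ici 0) := by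
  intro x hx
  rcases (mem_Ici.1 hx).eq_or_lt with rfl | hx
  · exact hcont
  · exact (hΦ.continuousOn.continuousAt (isOpen_Ioi.mem_nhds hx)).continuousWithinAt

theorem continuousOn_tr_matFun (hcont : ContinuousOn Φ (Ici 0)) :
    ContinuousOn (fun A : Herm d => tr (matFun Φ A)) {A | IsPSD A} :=
  (trCLM (d := d)).continuous.comp_continuousOn (continuousOn_matFun hcont)

/-- The trace function `A ↦ Tr Φ(A)` of a convex function is convex. -/
theorem convexOn_tr_matFun (hconv : ConvexOn ℝ (Ici 0) Φ) (hcont : ContinuousOn Φ (Ici 0))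
    (hΦ : ContDiffOn ℝ 2 Φ (Ioi 0)) :
    ConvexOn ℝ {A : Herm d | IsPSD A} (fun A => tr (matFun Φ A)) :=
  convexOn_of_translates convex_isPSD (1 : Herm d) (fun _ h => IsPD.isPSD h)
    (fun _ hx _ hε => isPD_add_smul_one hx hε) (continuousOn_tr_matFun hcont)
    ((twiceDiff hΦ).convexOn fun _ hA B => trHess_nonneg hconv hΦ hA B)

/-- The Hessian form of `A ↦ Tr Φ(A)` is jointly convex, in all dimensions. -/
def HessConvex (Φ : ℝ → ℝ) : Prop :=
  ∀ d : ℕ, 1 ≤ d → ConvexOn ℝ {p : Herm d × Herm d | IsPD p.1} (fun p => trHess Φ p.1 p.2 p.2)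

theorem secondDerivConvex_iff (hΦ : ContDiffOn ℝ 2 Φ (Ioi 0)) :
    SecondDerivConvex Φ ↔ HessConvex Φ := by
  refine forall₂_congr fun d _ => ?_
  have : EqOn (fun p : Herm d × Herm d => tr (D2 Φ p.1 p.2 p.2)) (fun p => trHess Φ p.1 p.2 p.2)
      {p | IsPD p.1} := fun p hp => tr_D2 hΦ hp p.2 p.2
  exact ⟨fun h => h.congr this, fun h => h.congr this.symm⟩

theorem bregmanConvex_iff (hΦ : ContDiffOn ℝ 2 Φ (Ioi 0)) :
    BregmanConvex Φ ↔ ∀ d : ℕ, 1 ≤ d →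
      ConvexOn ℝ {p : Herm d × Herm d | p.1 ∈ {A | IsPD A} ∧ p.1 + p.2 ∈ {A | IsPD A}}
        (bregman (fun A => tr (matFun Φ A)) (trGrad Φ)) := by
  refine forall₂_congr fun d _ => ?_
  have : EqOn (fun p : Herm d × Herm d => tr (matFun Φ (p.1 + p.2) - matFun Φ p.1 - D1 Φ p.1 p.2))
      (bregman (fun A => tr (matFun Φ A)) (trGrad Φ)) {p | IsPD p.1 ∧ IsPD (p.1 + p.2)} :=
    fun p hp => by
      simp only [tr_sub, bregman, trGrad_apply, tr_D1 (hΦ.of_le one_le_two) hp.1]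
  exact ⟨fun h => h.congr this, fun h => h.congr this.symm⟩

theorem derivDiffConvex_iff (hΦ : ContDiffOn ℝ 2 Φ (Ioi 0)) :
    DerivDiffConvex Φ ↔ ∀ d : ℕ, 1 ≤ d →
      ConvexOn ℝ {p : Herm d × Herm d | p.1 ∈ {A | IsPD A} ∧ p.1 + p.2 ∈ {A | IsPD A}}
        (fun p => trGrad Φ (p.1 + p.2) p.2 - trGrad Φ p.1 p.2) := by
  refine forall₂_congr fun d _ => ?_
  have : EqOn (fun p : Herm d × Herm d => tr (D1 Φ (p.1 + p.2) p.2 - D1 Φ p.1 p.2))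
      (fun p => trGrad Φ (p.1 + p.2) p.2 - trGrad Φ p.1 p.2) {p | IsPD p.1 ∧ IsPD (p.1 + p.2)} :=
    fun p hp => by
      simp only [tr_sub, trGrad_apply, tr_D1 (hΦ.of_le one_le_two) hp.1,
        tr_D1 (hΦ.of_le one_le_two) hp.2]
  exact ⟨fun h => h.congr this, fun h => h.congr this.symm⟩

theorem bregmanConvex_iff_hessConvex (hΦ : ContDiffOn ℝ 2 Φ (Ioi 0)) :
    BregmanConvex Φ ↔ HessConvex Φ := by
  rw [bregmanConvex_iff hΦ]
  exact forall₂_congr fun d _ =>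
    ⟨fun h => (twiceDiff hΦ).hess_of_bregman h, fun h => (twiceDiff hΦ).bregman_of_hess h⟩

theorem derivDiffConvex_iff_hessConvex (hΦ : ContDiffOn ℝ 2 Φ (Ioi 0)) :
    DerivDiffConvex Φ ↔ HessConvex Φ := by
  rw [derivDiffConvex_iff hΦ]
  exact forall₂_congr fun d _ =>
    ⟨fun h => (twiceDiff hΦ).hess_of_gradDiff h, fun h => (twiceDiff hΦ).gradDiff_of_hess h⟩

theorem tr_jensen (t : ℝ) (A B C : Herm d) :
    tr (t • A + (1 - t) • B - C) = t * tr A + (1 - t) * tr B - tr C := by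
  rw [tr_sub, tr_add, tr_smul, tr_smul]

theorem jensenGapConvex_iff_hessConvex (hcont : ContinuousOn Φ (Ici 0))
    (hΦ : ContDiffOn ℝ 2 Φ (Ioi 0)) : JensenGapConvex Φ ↔ HessConvex Φ := by
  constructor
  · intro h d hd
    refine (twiceDiff hΦ).hess_of_jensen ?_
    have h1 := h (1 / 2) (by norm_num) (by norm_num) d hd
    simp only [tr_jensen] at h1
    norm_num only at h1
    refine (h1.subset (fun p hp => ⟨IsPD.isPSD hp.1, IsPD.isPSD hp.2⟩) ?_)
    exact (convex_isPD (d := d)).prod (convex_isPD (d := d))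
  · intro h t ht0 ht1 d hd
    simp only [tr_jensen]
    have ht1' : 0 ≤ 1 - t := sub_nonneg.2 ht1
    have hj := (twiceDiff hΦ).jensen_of_bregman
      ((bregmanConvex_iff hΦ).1 ((bregmanConvex_iff_hessConvex hΦ).2 h) d hd) ht0 ht1
    have hcv : Convex ℝ {p : Herm d × Herm d | IsPSD p.1 ∧ IsPSD p.2} :=
      (convex_isPSD (d := d)).prod (convex_isPSD (d := d))
    refine convexOn_of_translates hcv
      (U := {p : Herm d × Herm d | IsPD p.1 ∧ IsPD p.2}) (1, 1)
      (fun p hp => ⟨IsPD.isPSD hp.1, IsPD.isPSD hp.2⟩)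
      (fun p hp ε hε => ⟨isPD_add_smul_one hp.1 hε, isPD_add_smul_one hp.2 hε⟩) ?_ hj
    have hg := continuousOn_tr_matFun (d := d) hcont
    refine ContinuousOn.sub (ContinuousOn.add ?_ ?_) ?_
    · exact continuousOn_const.mul (hg.comp continuousOn_fst fun p hp => hp.1)
    · exact continuousOn_const.mul (hg.comp continuousOn_snd fun p hp => hp.2)
    · refine hg.comp (f := fun p : Herm d × Herm d => t • p.1 + (1 - t) • p.2) (by fun_prop)
        fun p hp => convex_isPSD hp.1 hp.2 ht0 ht1' (by ring)

end TraceFunctions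

/-! ### Affine functions and functions of positive second derivative -/

section ClassC2

variable {d : ℕ} {Φ : ℝ → ℝ}

theorem matFun_smul_one (f : ℝ → ℝ) (t : ℝ) : matFun f (t • (1 : Herm d)) = f t • 1 := by
  have h1 : (t • (1 : Herm d)) = matFun (fun _ => t) (1 : Herm d) := (matFun_const t 1).symm
  rw [h1, matFun_comp, matFun_const]

theorem D1_smul_one {f : ℝ → ℝ} (hf : ContDiffOn ℝ 1 f (Ioi 0)) {t : ℝ} (ht : 0 < t) :
    D1 f (t • (1 : Herm d)) 1 = deriv f t • 1 := by
  have h1 : HasDerivAt (fun s : ℝ => matFun f (s • (1 : Herm d))) (D1 f (t • (1 : Herm d)) 1) t := by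
    have h2 : HasDerivAt (fun s : ℝ => s • (1 : Herm d)) 1 t := by
      simpa using (hasDerivAt_id t).smul_const (1 : Herm d)
    exact (hasFDerivAt_matFun hf (isPD_smul isPD_one ht)).comp_hasDerivAt t h2
  have h3 : HasDerivAt (fun s : ℝ => matFun f (s • (1 : Herm d))) (deriv f t • 1) t := by
    simp only [matFun_smul_one]
    exact (((hf.differentiableOn one_ne_zero).differentiableAt
      (isOpen_Ioi.mem_nhds ht)).hasDerivAt).smul_const (1 : Herm d)
  exact h1.unique h3

theorem tr_one : tr (1 : Herm d) = d := by simp [tr]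

theorem trHess_smul_one (hΦ : ContDiffOn ℝ 2 Φ (Ioi 0)) {t : ℝ} (ht : 0 < t) (c : ℝ) :
    trHess Φ (t • (1 : Herm d)) (c • 1) (c • 1) = c ^ 2 * (deriv (deriv Φ) t * d) := by
  rw [trHess_apply, map_smul, D1_smul_one (contDiffOn_deriv hΦ) ht, hs_smul_left, hs_smul_left,
    hs_smul_right, hs_one, tr_one]
  ring

theorem isAffine_of_deriv_deriv_eq_zero (hcont : ContinuousOn Φ (Ici 0))
    (hΦ : ContDiffOn ℝ 2 Φ (Ioi 0)) (h : ∀ t, 0 < t → deriv (deriv Φ) t = 0) : IsAffine Φ := by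
  have hd : DifferentiableOn ℝ (deriv Φ) (Ioi 0) :=
    (contDiffOn_deriv (k := 1) hΦ).differentiableOn one_ne_zero
  have h1 : ∀ t, 0 < t → deriv Φ t = deriv Φ 1 := fun t ht =>
    isOpen_Ioi.is_const_of_deriv_eq_zero isPreconnected_Ioi hd (fun x hx => h x hx) ht
      (mem_Ioi.2 one_pos)
  have hd2 : DifferentiableOn ℝ (fun t => Φ t - deriv Φ 1 * t) (Ioi 0) :=
    (hΦ.differentiableOn two_ne_zero).sub (by fun_prop)
  have h2 : ∀ t, 0 < t → Φ t - deriv Φ 1 * t = Φ 1 - deriv Φ 1 * 1 := fun t ht =>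
    isOpen_Ioi.is_const_of_deriv_eq_zero isPreconnected_Ioi hd2 (fun x hx => by
      have hx' := ((hΦ.differentiableOn two_ne_zero).differentiableAt
        (isOpen_Ioi.mem_nhds hx)).hasDerivAt
      have hlin : HasDerivAt (fun t : ℝ => deriv Φ 1 * t) (deriv Φ 1) x := by
        simpa using (hasDerivAt_id x).const_mul (deriv Φ 1)
      have := (hx'.sub hlin).deriv
      rw [h1 x hx, sub_self] at this
      exact this) ht (mem_Ioi.2 one_pos)
  refine ⟨deriv Φ 1, Φ 1 - deriv Φ 1, fun t ht => ?_⟩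
  have hEq : EqOn Φ (fun t => deriv Φ 1 * t + (Φ 1 - deriv Φ 1)) (closure (Ioi 0) ∩ Ici 0) := by
    refine EqOn.of_subset_closure (s := Ioi 0) (fun x hx => ?_)
      (hcont.mono inter_subset_right) (by fun_prop) ?_ inter_subset_left
    · have := h2 x hx
      linarith
    · exact fun x hx => ⟨subset_closure hx, Ioi_subset_Ici_self hx⟩
  exact hEq ⟨by rw [closure_Ioi]; exact ht, ht⟩

/-- If `Φ''` has a zero, then joint convexity of the Hessian form forces it to vanish: in dimension
one, `(a, b) ↦ Φ''(a) b²` is jointly convex, and any `x > 0` is a mean of the zero `t₀` and another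
point, where `b` may be taken to be `0`. -/
theorem isAffine_or_pos (hconv : ConvexOn ℝ (Ici 0) Φ) (hcont : ContinuousOn Φ (Ici 0))
    (hΦ : ContDiffOn ℝ 2 Φ (Ioi 0)) (h : HessConvex Φ) :
    IsAffine Φ ∨ ∀ t, 0 < t → 0 < deriv (deriv Φ) t := by
  by_contra! hcon
  obtain ⟨hna, t₀, ht₀, hz⟩ := hcon
  refine hna (isAffine_of_deriv_deriv_eq_zero hcont hΦ fun x hx => ?_)
  have hz0 : deriv (deriv Φ) t₀ = 0 := le_antisymm hz (deriv_deriv_nonneg hconv hΦ ht₀)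
  refine le_antisymm ?_ (deriv_deriv_nonneg hconv hΦ hx)
  -- `x` is the mean of `t₀`, with weight `a = x / (x + t₀)`, and `x² / t₀`, with weight `1 - a`.
  set a := x / (x + t₀) with ha
  have hxt : 0 < x + t₀ := by linarith
  have ha0 : 0 < a := div_pos hx hxt
  have hb : 1 - a = t₀ / (x + t₀) := by rw [ha]; field_simp; ring
  have hb0 : 0 ≤ 1 - a := by rw [hb]; positivity
  have ht1 : 0 < x ^ 2 / t₀ := by positivity
  have := (h 1 le_rfl).2 (x := (t₀ • 1, a⁻¹ • 1)) (isPD_smul isPD_one ht₀)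
    (y := ((x ^ 2 / t₀) • 1, (0 : ℝ) • 1)) (isPD_smul isPD_one ht1) ha0.le hb0 (by ring)
  have e : a • (t₀ • (1 : Herm 1), a⁻¹ • (1 : Herm 1)) +
      (1 - a) • ((x ^ 2 / t₀) • (1 : Herm 1), (0 : ℝ) • (1 : Herm 1)) =
        (x • 1, (1 : ℝ) • 1) := by
    ext1
    · simp only [Prod.fst_add, Prod.smul_fst]
      rw [smul_smul, smul_smul, ← add_smul, hb, ha]
      congr 1
      field_simp
      ring
    · simp only [Prod.snd_add, Prod.smul_snd]
      rw [smul_smul, mul_inv_cancel₀ ha0.ne', zero_smul, smul_zero, add_zero]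
  rw [e] at this
  simp only [trHess_smul_one hΦ hx, trHess_smul_one hΦ ht₀, trHess_smul_one hΦ ht1, hz0] at this
  simpa using this

theorem hessConvex_of_isAffine (h : IsAffine Φ) : HessConvex Φ := by
  obtain ⟨a, b, hab⟩ := h
  intro d _
  have hder : ∀ t, 0 < t → deriv Φ t = a := by
    intro t ht
    have : Φ =ᶠ[𝓝 t] fun t => a * t + b := by
      filter_upwards [isOpen_Ioi.mem_nhds (mem_Ioi.2 ht)] with s hs using hab s (le_of_lt hs)
    rw [this.deriv_eq]
    simp
  have hD : ∀ A : Herm d, IsPD A → D1 (deriv Φ) A = 0 := by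
    intro A hA
    have : (matFun (deriv Φ) : Herm d → Herm d) =ᶠ[𝓝 A] fun _ => a • 1 := by
      filter_upwards [isOpen_isPD.mem_nhds hA] with B hB
      rw [matFun_congr_pd hB (g := fun _ => a) (fun t ht => hder t ht), matFun_const]
    rw [D1, this.fderiv_eq]
    exact fderiv_const_apply _
  have hcv : Convex ℝ {p : Herm d × Herm d | IsPD p.1} := fun p hp q hq a b ha hb hab =>
    convex_isPD hp hq ha hb hab
  refine (convexOn_const (0 : ℝ) hcv).congr fun p hp => ?_
  rw [trHess_apply, hD p.1 hp]
  simp [hs]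

end ClassC2

/-! ### Concavity of inverses of positive operators -/

section Inverse

variable {E : Type} [NormedAddCommGroup E] [NormedSpace ℝ E]

theorem isInvertible_of_injective [FiniteDimensional ℝ E] {T : E →L[ℝ] E}
    (hT : ∀ x, T x = 0 → x = 0) : T.IsInvertible := by
  have hinj : Function.Injective (T : E →ₗ[ℝ] E) := (injective_iff_map_eq_zero _).2 hT
  refine ⟨(LinearEquiv.ofInjectiveEndo (T : E →ₗ[ℝ] E) hinj).toContinuousLinearEquiv, ?_⟩
  ext x
  rfl

theorem isInvertible_apply_inverse {T : E →L[ℝ] E} (hT : T.IsInvertible) (x : E) :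
    T (T.inverse x) = x := by
  have := congrArg (fun S : E →L[ℝ] E => S x) hT.self_comp_inverse
  simpa using this

/-- `⟨h, T⁻¹ h⟩` is the supremum of `2⟨h, x⟩ - ⟨T x, x⟩`. -/
theorem two_mul_sub_le_inverse {b : E →L[ℝ] E →L[ℝ] ℝ} {T : E →L[ℝ] E}
    (hT : T.IsInvertible) (hs : ∀ x y, b (T x) y = b (T y) x)
    (hp : ∀ x, 0 ≤ b (T x) x) (h x : E) : 2 * b h x - b (T x) x ≤ b h (T.inverse h) := by
  have h1 := hp (x - T.inverse h)
  have h2 := isInvertible_apply_inverse hT h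
  have h3 : b (T x) (T.inverse h) = b h x := by rw [hs, h2]
  simp only [map_sub, _root_.sub_apply, h2, h3] at h1
  linarith

/-- Both directions use that `⟨h, T⁻¹ h⟩` is the supremum of `2⟨h, x⟩ - ⟨T x, x⟩`, attained at
`x = T⁻¹ h`. -/
theorem concaveOn_inverse_iff {b : E →L[ℝ] E →L[ℝ] ℝ} {U : Set E} (hU : Convex ℝ U)
    {T : E → E →L[ℝ] E} (hT : ∀ x ∈ U, (T x).IsInvertible)
    (hs : ∀ x ∈ U, ∀ v w, b (T x v) w = b (T x w) v) (hp : ∀ x ∈ U, ∀ v, 0 ≤ b (T x v) v) :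
    (∀ h, ConcaveOn ℝ U fun x => b h ((T x).inverse h)) ↔
      ConvexOn ℝ {p : E × E | p.1 ∈ U} fun p => b (T p.1 p.2) p.2 := by
  constructor
  · intro hc
    refine ⟨fun p hp q hq a c ha hc hac => hU hp hq ha hc hac, ?_⟩
    rintro ⟨x, v⟩ hx ⟨y, w⟩ hy a c ha hc' hac
    have hz := hU hx hy ha hc' hac
    simp only [Prod.fst_add, Prod.snd_add, Prod.smul_fst, Prod.smul_snd, smul_eq_mul]
    set z := a • x + c • y
    set u := a • v + c • w with hu
    have h1 := (hc (T z u)).2 hx hy ha hc' hac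
    simp only [smul_eq_mul] at h1
    rw [show T (a • x + c • y) = T z from rfl, (hT z hz).inverse_apply_self] at h1
    have h2 := two_mul_sub_le_inverse (hT x hx) (hs x hx) (hp x hx) (T z u) v
    have h3 := two_mul_sub_le_inverse (hT y hy) (hs y hy) (hp y hy) (T z u) w
    have h4 : b (T z u) u = a * b (T z u) v + c * b (T z u) w := by
      conv_lhs => rw [hu, map_add, map_smul, map_smul, smul_eq_mul, smul_eq_mul]
    have h5 := mul_le_mul_of_nonneg_left h2 ha
    have h6 := mul_le_mul_of_nonneg_left h3 hc'
    linarith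
  · intro hc h
    refine ⟨hU, fun x hx y hy a c ha hc' hac => ?_⟩
    have hz := hU hx hy ha hc' hac
    have h1 := hc.2 (x := (x, (T x).inverse h)) hx (y := (y, (T y).inverse h)) hy ha hc' hac
    simp only [Prod.fst_add, Prod.snd_add, Prod.smul_fst, Prod.smul_snd, smul_eq_mul,
      isInvertible_apply_inverse (hT x hx), isInvertible_apply_inverse (hT y hy)] at h1 ⊢
    have h2 := two_mul_sub_le_inverse (hT _ hz) (hs _ hz) (hp _ hz) h
      (a • (T x).inverse h + c • (T y).inverse h)
    have h4 : b h (a • (T x).inverse h + c • (T y).inverse h) =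
        a * b h ((T x).inverse h) + c * b h ((T y).inverse h) := by
      rw [map_add, map_smul, map_smul, smul_eq_mul, smul_eq_mul]
    linarith

theorem hasDerivAt_inverse [CompleteSpace E] {T : ℝ → E →L[ℝ] E} {T' : E →L[ℝ] E} {s : ℝ}
    (h : HasDerivAt T T' s) (hi : (T s).IsInvertible) :
    HasDerivAt (fun s => (T s).inverse) (-((T s).inverse * T' * (T s).inverse)) s := by
  obtain ⟨e, he⟩ := hi
  have h1 := hasFDerivAt_ringInverse (𝕜 := ℝ) (ContinuousLinearEquiv.unitsEquiv ℝ E |>.symm e)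
  have hcoe : ((ContinuousLinearEquiv.unitsEquiv ℝ E |>.symm e : (E →L[ℝ] E)ˣ) :
      E →L[ℝ] E) = T s := he
  rw [hcoe] at h1
  have h2 := h1.comp_hasDerivAt s h
  rw [ContinuousLinearMap.ringInverse_eq_inverse] at h2
  refine h2.congr_deriv ?_
  have h3 : (((ContinuousLinearEquiv.unitsEquiv ℝ E |>.symm e)⁻¹ : (E →L[ℝ] E)ˣ) : E →L[ℝ] E) =
      (T s).inverse := by
    rw [← he, ContinuousLinearMap.inverse_equiv]
    rfl
  rw [h3]
  simp

theorem hasDerivAt_comp_line {F : Type} [NormedAddCommGroup F] [NormedSpace ℝ F] {f : E → F}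
    {f' : E →L[ℝ] F} {x k : E} {s : ℝ} (h : HasFDerivAt f f' (x + s • k)) :
    HasDerivAt (fun s : ℝ => f (x + s • k)) (f' k) s :=
  h.comp_hasDerivAt s (hasDerivAt_line x k s)

theorem hasDerivAt_apply_const {F G : Type} [NormedAddCommGroup F] [NormedSpace ℝ F]
    [NormedAddCommGroup G] [NormedSpace ℝ G] {f : ℝ → F →L[ℝ] G} {f' : F →L[ℝ] G} {s : ℝ}
    (h : HasDerivAt f f' s) (k : F) : HasDerivAt (fun s => f s k) (f' k) s :=
  (ContinuousLinearMap.apply ℝ G k).hasFDerivAt.comp_hasDerivAt s h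

/-- Concavity of `x ↦ ⟨h, T(x)⁻¹ h⟩` expressed by the second derivative of `T⁻¹`. -/
theorem concaveOn_inverse_iff_second_deriv [CompleteSpace E] (b : E →L[ℝ] E →L[ℝ] ℝ)
    {U : Set E} (hUo : IsOpen U) (hU : Convex ℝ U) {T : E → E →L[ℝ] E}
    {T' : E → E →L[ℝ] E →L[ℝ] E} {T'' : E → E →L[ℝ] E →L[ℝ] E →L[ℝ] E}
    (hT : ∀ x ∈ U, (T x).IsInvertible) (hT' : ∀ x ∈ U, HasFDerivAt T (T' x) x)
    (hT'' : ∀ x ∈ U, HasFDerivAt T' (T'' x) x) (h : E) :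
    (ConcaveOn ℝ U fun x => b h ((T x).inverse h)) ↔
      ∀ x ∈ U, ∀ k, b h ((T x).inverse (T'' x k k ((T x).inverse h))) ≥
        2 * b h ((T x).inverse (T' x k ((T x).inverse (T' x k ((T x).inverse h))))) := by
  have d1 : ∀ x k : E, ∀ s : ℝ, x + s • k ∈ U →
      HasDerivAt (fun s : ℝ => T (x + s • k)) (T' (x + s • k) k) s := fun x k s hs =>
    (hT' _ hs).comp_hasDerivAt s (hasDerivAt_line x k s)
  have d2 : ∀ x k : E, ∀ s : ℝ, x + s • k ∈ U →
      HasDerivAt (fun s : ℝ => T' (x + s • k) k) (T'' (x + s • k) k k) s := fun x k s hs => by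
    have h1 : HasDerivAt (fun s : ℝ => T' (x + s • k)) (T'' (x + s • k) k) s :=
      hasDerivAt_comp_line (F := E →L[ℝ] E →L[ℝ] E) (hT'' _ hs)
    exact hasDerivAt_apply_const (F := E) (G := E →L[ℝ] E) h1 k
  have d3 := fun (x k : E) (s : ℝ) (hs : x + s • k ∈ U) =>
    hasDerivAt_inverse (d1 x k s hs) (hT _ hs)
  have d4 := fun (x k : E) (s : ℝ) (hs : x + s • k ∈ U) =>
    (((d3 x k s hs).mul (d2 x k s hs)).mul (d3 x k s hs)).neg
  set ev : (E →L[ℝ] E) →L[ℝ] ℝ := (b h).comp (ContinuousLinearMap.apply ℝ E h) with hev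
  have e1 : ∀ x k : E, ∀ s : ℝ, x + s • k ∈ U →
      HasDerivAt (fun s : ℝ => ev (T (x + s • k)).inverse) (ev (-((T (x + s • k)).inverse *
        T' (x + s • k) k * (T (x + s • k)).inverse))) s := fun x k s hs =>
    ev.hasFDerivAt.comp_hasDerivAt s (d3 x k s hs)
  have e2 : ∀ x k : E, ∀ s : ℝ, x + s • k ∈ U →
      HasDerivAt (fun s : ℝ => ev (-((T (x + s • k)).inverse *
        T' (x + s • k) k * (T (x + s • k)).inverse)))
        (2 * b h ((T (x + s • k)).inverse (T' (x + s • k) k ((T (x + s • k)).inverse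
            (T' (x + s • k) k ((T (x + s • k)).inverse h))))) -
          b h ((T (x + s • k)).inverse (T'' (x + s • k) k k ((T (x + s • k)).inverse h)))) s := by
    intro x k s hs
    refine (ev.hasFDerivAt.comp_hasDerivAt s (d4 x k s hs)).congr_deriv ?_
    simp only [hev, Pi.mul_apply, ContinuousLinearMap.comp_apply, ContinuousLinearMap.apply_apply,
      _root_.neg_apply, _root_.add_apply, mul_apply_eq_comp, map_neg, map_add]
    ring
  have hopen : ∀ x k : E, IsOpen {s : ℝ | x + s • k ∈ U} := fun x k =>
    hUo.preimage (by fun_prop)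
  constructor
  · intro hc x hx k
    set S := {s : ℝ | x + s • k ∈ U} with hS
    have h0 : (0 : ℝ) ∈ S := by simpa [hS] using hx
    have hcS : ConcaveOn ℝ S (fun s : ℝ => ev (T (x + s • k)).inverse) := by
      have hl : ∀ s : ℝ, AffineMap.lineMap x (x + k) s = x + s • k := fun s => by
        rw [AffineMap.lineMap_apply]; simp [add_comm]
      have := hc.comp_affineMap (AffineMap.lineMap x (x + k))
      have hpre : (AffineMap.lineMap x (x + k)) ⁻¹' U = S := by
        ext s
        rw [mem_preimage, hl]
        rfl
      rw [hpre] at this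
      refine this.congr fun s _ => ?_
      rw [Function.comp_apply, hl]
      rfl
    have ha := hcS.antitoneOn_deriv (fun s hs => (e1 x k s hs).differentiableAt)
    have hn := ha.derivWithin_nonpos (x := 0)
    rw [derivWithin_of_isOpen (hopen x k) h0] at hn
    have hee : deriv (fun s : ℝ => ev (T (x + s • k)).inverse) =ᶠ[𝓝 0] fun s =>
        ev (-((T (x + s • k)).inverse * T' (x + s • k) k * (T (x + s • k)).inverse)) := by
      filter_upwards [(hopen x k).mem_nhds h0] with s hs using (e1 x k s hs).deriv
    rw [hee.deriv_eq, (e2 x k 0 h0).deriv] at hn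
    simp only [zero_smul, add_zero] at hn
    linarith
  · intro hineq
    refine ⟨hU, fun x hx y hy a c ha hc hac => ?_⟩
    have hm : ∀ s ∈ Icc (0 : ℝ) 1, x + s • (y - x) ∈ U := fun s hs =>
      hU.add_smul_mem hx (by simpa using hy) hs
    have hcS : ConcaveOn ℝ (Icc (0 : ℝ) 1) (fun s : ℝ => ev (T (x + s • (y - x))).inverse) := by
      refine concaveOn_of_hasDerivWithinAt2_nonpos (convex_Icc 0 1)
        (fun s hs => (e1 x (y - x) s (hm s hs)).continuousAt.continuousWithinAt)
        (fun s hs => (e1 x (y - x) s (hm s (interior_subset hs))).hasDerivWithinAt)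
        (fun s hs => (e2 x (y - x) s (hm s (interior_subset hs))).hasDerivWithinAt) ?_
      intro s hs
      have := hineq _ (hm s (interior_subset hs)) (y - x)
      linarith
    have := hcS.2 (left_mem_Icc.2 zero_le_one) (right_mem_Icc.2 zero_le_one) ha hc hac
    have e : x + c • (y - x) = a • x + c • y := by
      obtain rfl : a = 1 - c := by linarith
      module
    simpa [hev, e] using this

end Inverse

/-! ### The class of entropy functions -/

section ClassC2

variable {d : ℕ} {Φ : ℝ → ℝ}

theorem concave_D1inv_iff (hconv : ConvexOn ℝ (Ici 0) Φ) (hΦ : ContDiffOn ℝ 2 Φ (Ioi 0))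
    (hinv : ∀ A : Herm d, IsPD A → (D1 (deriv Φ) A).IsInvertible) :
    (∀ h : Herm d, ConcaveOn ℝ {A : Herm d | IsPD A} fun A => hs h (D1inv (deriv Φ) A h)) ↔
      ConvexOn ℝ {p : Herm d × Herm d | IsPD p.1} fun p => trHess Φ p.1 p.2 p.2 :=
  concaveOn_inverse_iff (E := Herm d) (b := hsCLM) convex_isPD (T := D1 (deriv Φ)) hinv
    (fun A hA v w => by
      simp only [hsCLM_apply]
      rw [hs_comm, hs_D1_comm (contDiffOn_deriv hΦ) hA, hs_comm])
    (fun A hA v => trHess_nonneg hconv hΦ hA v)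

theorem isInvertible_D1 (hΦ : ContDiffOn ℝ 2 Φ (Ioi 0))
    (hpos : ∀ t, 0 < t → 0 < deriv (deriv Φ) t) {A : Herm d} (hA : IsPD A) :
    (D1 (deriv Φ) A).IsInvertible :=
  isInvertible_of_injective (E := Herm d) fun X hX =>
    eq_zero_of_hs_D1_self (contDiffOn_deriv hΦ) hpos hA (by rw [hX]; simp [hs])

theorem classC2_iff_hessConvex (hconv : ConvexOn ℝ (Ici 0) Φ)
    (hcont : ContinuousWithinAt Φ (Ici 0) 0) (hΦ : ContDiffOn ℝ 2 Φ (Ioi 0)) :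
    ClassC2 Φ ↔ HessConvex Φ := by
  constructor
  · intro h d hd
    rcases h d hd with h | ⟨-, -, -, hinv, hcc⟩
    · exact hessConvex_of_isAffine h d hd
    · exact (concave_D1inv_iff hconv hΦ hinv).1 hcc
  · intro h d hd
    rcases isAffine_or_pos hconv (continuousOn_Ici hcont hΦ) hΦ h with ha | hpos
    · exact Or.inl ha
    · have hinv : ∀ A : Herm d, IsPD A → (D1 (deriv Φ) A).IsInvertible :=
        fun A hA => isInvertible_D1 hΦ hpos hA
      exact Or.inr ⟨hconv, hcont, hΦ, hinv, (concave_D1inv_iff hconv hΦ hinv).2 (h d hd)⟩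

theorem iteratedFDeriv_three_apply {E : Type} [NormedAddCommGroup E] [NormedSpace ℝ E] (φ : E → E)
    (x u v w : E) :
    iteratedFDeriv ℝ 3 φ x ![u, v, w] = fderiv ℝ (fderiv ℝ (fderiv ℝ φ)) x u v w := by
  rw [iteratedFDeriv_succ_apply_right, iteratedFDeriv_two_apply]
  rfl

theorem concaveOn_inverse_iff_iteratedFDeriv {E : Type} [NormedAddCommGroup E] [NormedSpace ℝ E]
    [CompleteSpace E] (b : E →L[ℝ] E →L[ℝ] ℝ) {U : Set E} (hUo : IsOpen U) (hU : Convex ℝ U)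
    {φ : E → E} (hφ : ContDiffOn ℝ 3 φ U) (hT : ∀ x ∈ U, (fderiv ℝ φ x).IsInvertible) (h : E) :
    (ConcaveOn ℝ U fun x => b h ((fderiv ℝ φ x).inverse h)) ↔
      ∀ x ∈ U, ∀ k, b h ((fderiv ℝ φ x).inverse
          (iteratedFDeriv ℝ 3 φ x ![k, k, (fderiv ℝ φ x).inverse h])) ≥
        2 * b h ((fderiv ℝ φ x).inverse (iteratedFDeriv ℝ 2 φ x ![k,
          (fderiv ℝ φ x).inverse (iteratedFDeriv ℝ 2 φ x ![k, (fderiv ℝ φ x).inverse h])])) := by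
  have h2 : ContDiffOn ℝ 2 (fderiv ℝ φ) U := hφ.fderiv_of_isOpen hUo (by norm_num)
  have h1 : ContDiffOn ℝ 1 (fderiv ℝ (fderiv ℝ φ)) U := h2.fderiv_of_isOpen hUo (by norm_num)
  simp only [iteratedFDeriv_three_apply, iteratedFDeriv_two_apply]
  exact concaveOn_inverse_iff_second_deriv b hUo hU hT
    (fun x hx => ((h2.differentiableOn two_ne_zero).differentiableAt
      (hUo.mem_nhds hx)).hasFDerivAt)
    (fun x hx => ((h1.differentiableOn one_ne_zero).differentiableAt
      (hUo.mem_nhds hx)).hasFDerivAt) h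

theorem concave_D1inv_iff_thirdDeriv (hΦ : ContDiffOn ℝ 4 Φ (Ioi 0))
    (hinv : ∀ A : Herm d, IsPD A → (D1 (deriv Φ) A).IsInvertible) (h : Herm d) :
    (ConcaveOn ℝ {A : Herm d | IsPD A} fun A => hs h (D1inv (deriv Φ) A h)) ↔
      ∀ A ∈ {A : Herm d | IsPD A}, ∀ k : Herm d,
        hs h (D1inv (deriv Φ) A (D3 (deriv Φ) A k k (D1inv (deriv Φ) A h))) ≥
          2 * hs h (D1inv (deriv Φ) A (D2 (deriv Φ) A k
            (D1inv (deriv Φ) A (D2 (deriv Φ) A k (D1inv (deriv Φ) A h))))) :=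
  concaveOn_inverse_iff_iteratedFDeriv (E := Herm d) hsCLM isOpen_isPD convex_isPD
    (contDiffOn_matFun (k := 3) (contDiffOn_deriv hΦ)) hinv h

/-- In dimension one, `DΦ'[t]` is multiplication by `Φ''(t)`. -/
theorem pos_of_isInvertible (hconv : ConvexOn ℝ (Ici 0) Φ) (hΦ : ContDiffOn ℝ 2 Φ (Ioi 0))
    (hinv : ∀ A : Herm 1, IsPD A → (D1 (deriv Φ) A).IsInvertible) {t : ℝ} (ht : 0 < t) :
    0 < deriv (deriv Φ) t := by
  refine lt_of_le_of_ne (deriv_deriv_nonneg hconv hΦ ht) fun h0 => ?_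
  have h1 := D1_smul_one (d := 1) (contDiffOn_deriv hΦ) ht
  rw [← h0, zero_smul] at h1
  have h2 := (hinv _ (isPD_smul isPD_one ht)).inverse_apply_self 1
  rw [h1, map_zero] at h2
  have h3 : tr (0 : Herm 1) = tr (1 : Herm 1) := by rw [h2]
  rw [tr_one] at h3
  simp [tr] at h3

theorem classC2_iff_thirdDerivIneq (hconv : ConvexOn ℝ (Ici 0) Φ)
    (hcont : ContinuousWithinAt Φ (Ici 0) 0) (hΦ : ContDiffOn ℝ 4 Φ (Ioi 0)) :
    ClassC2 Φ ↔ ThirdDerivIneq Φ := by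
  have hΦ2 : ContDiffOn ℝ 2 Φ (Ioi 0) := hΦ.of_le (by norm_num)
  constructor
  · intro h
    by_cases ha : IsAffine Φ
    · exact Or.inl ha
    · have hr := fun d hd => (h d hd).resolve_left ha
      refine Or.inr ⟨fun t ht => pos_of_isInvertible hconv hΦ2 (hr 1 le_rfl).2.2.2.1 ht, ?_⟩
      intro d hd A h k hA
      exact (concave_D1inv_iff_thirdDeriv hΦ (hr d hd).2.2.2.1 h).1 ((hr d hd).2.2.2.2 h) A hA k
  · rintro (ha | ⟨hpos, hineq⟩) d hd
    · exact Or.inl ha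
    · have hinv : ∀ A : Herm d, IsPD A → (D1 (deriv Φ) A).IsInvertible :=
        fun A hA => isInvertible_D1 hΦ2 hpos hA
      exact Or.inr ⟨hconv, hcont, hΦ2, hinv, fun h =>
        (concave_D1inv_iff_thirdDeriv hΦ hinv h).2 fun A hA k => hineq d hd A h k hA⟩

end ClassC2

/-! ### Random matrices -/

section Abstract

variable {Ω : Type u} [MeasurableSpace Ω] {P : Measure Ω}
variable {E : Type} [NormedAddCommGroup E] [NormedSpace ℝ E]

theorem integral_clm [FiniteDimensional ℝ E] (L : E →L[ℝ] ℝ) {Z : Ω → E} (hZ : Integrable Z P) :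
    ∫ ω, L (Z ω) ∂P = L (∫ ω, Z ω ∂P) :=
  have := FiniteDimensional.complete ℝ E
  L.integral_comp_comm hZ

theorem integrable_clm (L : E →L[ℝ] ℝ) {Z : Ω → E} (hZ : Integrable Z P) :
    Integrable (fun ω => L (Z ω)) P := L.integrable_comp hZ

theorem integral_clm_sub_mean [FiniteDimensional ℝ E] [IsProbabilityMeasure P]
    (L : E →L[ℝ] ℝ) {Z : Ω → E} (hZ : Integrable Z P) :
    ∫ ω, L (Z ω - ∫ ω', Z ω' ∂P) ∂P = 0 := by
  have := FiniteDimensional.complete ℝ E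
  refine (integral_clm L (hZ.sub (integrable_const _))).trans ?_
  rw [integral_sub' hZ (integrable_const _)]
  simp

theorem integrable_clm_sub_const [IsFiniteMeasure P] (L : E →L[ℝ] ℝ) {Z : Ω → E}
    (hZ : Integrable Z P) (c : E) : Integrable (fun ω => L (Z ω - c)) P :=
  integrable_clm L (hZ.sub (integrable_const _))

/-- A bounded random functional of an integrable random vector is integrable. -/
theorem integrable_clm₂ {F : Type} [NormedAddCommGroup F] [NormedSpace ℝ F]
    (B : F →L[ℝ] E →L[ℝ] ℝ) {S : Ω → F} {Z : Ω → E} (hS : AEStronglyMeasurable S P) {C : ℝ}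
    (hC : ∀ ω, ‖S ω‖ ≤ C) (hZ : Integrable Z P) : Integrable (fun ω => B (S ω) (Z ω)) P := by
  refine Integrable.mono' (hZ.norm.const_mul (‖B‖ * C)) ?_ (ae_of_all _ fun ω => ?_)
  · exact B.aestronglyMeasurable_comp₂ hS hZ.aestronglyMeasurable
  · exact (B.le_opNorm₂ _ _).trans (by gcongr; exact hC ω)

end Abstract

section Herm

variable {d : ℕ} {Ω : Type u} [MeasurableSpace Ω] {P : Measure Ω} {f g Φ : ℝ → ℝ}

theorem integrable_tr {Z : Ω → Herm d} (hZ : Integrable Z P) : Integrable (fun ω => tr (Z ω)) P :=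
  integrable_clm (E := Herm d) trCLM hZ

theorem integral_tr {Z : Ω → Herm d} (hZ : Integrable Z P) :
    ∫ ω, tr (Z ω) ∂P = tr (∫ ω, Z ω ∂P) :=
  integral_clm (E := Herm d) trCLM hZ

theorem isPSD_integral {Z : Ω → Herm d} (hZ : ∀ ω, IsPSD (Z ω)) : IsPSD (∫ ω, Z ω ∂P) := by
  by_cases hi : Integrable Z P
  · refine isPSD_iff.2 fun v => ?_
    rw [← integral_clm (E := Herm d) (quadForm v) hi]
    exact integral_nonneg fun ω => isPSD_iff.1 (hZ ω) v
  · rw [integral_undef hi]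
    exact isPSD_zero

theorem isPD_integral [IsProbabilityMeasure P] {Z : Ω → Herm d} (hZ : ∀ ω, IsPD (Z ω))
    (hi : Integrable Z P) : IsPD (∫ ω, Z ω ∂P) := by
  refine isPD_iff.2 fun v hv => ?_
  have hpos : ∀ ω, 0 < quadForm v (Z ω) := fun ω => isPD_iff.1 (hZ ω) v hv
  rw [← integral_clm (E := Herm d) (quadForm v) hi,
    integral_pos_iff_support_of_nonneg (fun ω => (hpos ω).le)
      (integrable_clm (E := Herm d) (quadForm v) hi)]
  have : Function.support (fun ω => quadForm v (Z ω)) = univ := by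
    ext ω; simpa using (hpos ω).ne'
  rw [this]
  simp

/-- The trace of `f(A)` is the sum of the values of `f` at the eigenvalues of `A`. -/
theorem exists_tr_matFun_eq_sum (A : Herm d) :
    ∃ a : Fin d → ℝ, (∀ i, a i ∈ spectrum ℝ (A : Matrix (Fin d) (Fin d) ℂ)) ∧
      ∀ f : ℝ → ℝ, tr (matFun f A) = ∑ i, f (a i) := by
  obtain ⟨U, hU, a, hA, ha⟩ := exists_diagonalization A
  refine ⟨a, ha, fun f => ?_⟩
  rw [tr, coe_matFun, hA, cfc_conj_diagonal hU, Matrix.trace_mul_comm, ← Matrix.mul_assoc,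
    (Matrix.mem_unitaryGroup_iff').1 hU, Matrix.one_mul, Matrix.trace_diagonal, Complex.re_sum]
  simp

theorem tr_matFun_mono {A : Herm d} (hA : IsPSD A) (h : ∀ x, 0 ≤ x → f x ≤ g x) :
    tr (matFun f A) ≤ tr (matFun g A) := by
  obtain ⟨a, ha, hs⟩ := exists_tr_matFun_eq_sum A
  rw [hs, hs]
  exact Finset.sum_le_sum fun i _ => h _ (isPSD_iff_spectrum.1 hA (ha i))

theorem tendsto_tr_matFun {A : Herm d} (hA : IsPSD A) {F : ℕ → ℝ → ℝ}
    (h : ∀ x, 0 ≤ x → Tendsto (fun n => F n x) atTop (𝓝 (f x))) :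
    Tendsto (fun n => tr (matFun (F n) A)) atTop (𝓝 (tr (matFun f A))) := by
  obtain ⟨a, ha, hs⟩ := exists_tr_matFun_eq_sum A
  simp only [hs]
  exact tendsto_finsetSum _ fun i _ => h _ (isPSD_iff_spectrum.1 hA (ha i))

theorem tr_matFun_affine (a b : ℝ) (A : Herm d) :
    tr (matFun (fun x => a * x + b) A) = a * tr A + b * d := by
  have : matFun (fun x => a * x + b) A = a • A + b • 1 := by
    rw [← matFun_const b A]
    conv_rhs => rw [← matFun_id A, ← matFun_smul]
    rw [matFun_id, ← matFun_add]
    rfl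
  rw [this, tr_add, tr_smul, tr_smul, tr_one]

theorem matFun_sub_affine (a b : ℝ) (A : Herm d) :
    matFun (fun x => f x - (a * x + b)) A = matFun f A - (a • A + b • 1) := by
  have h1 : (fun x => f x - (a * x + b)) = f + ((-a) • (fun x : ℝ => x) + fun _ => -b) := by
    ext x; simp; ring
  rw [h1, matFun_add, matFun_add, matFun_smul, matFun_id, matFun_const]
  module

theorem aestronglyMeasurable_matFun (hf : ContinuousOn f (Ici 0)) {Z : Ω → Herm d}
    (hZ : ∀ ω, IsPSD (Z ω)) (hm : AEStronglyMeasurable Z P) :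
    AEStronglyMeasurable (fun ω => matFun f (Z ω)) P := by
  have h : Continuous fun x => f (max x 0) :=
    hf.comp_continuous (continuous_id.max continuous_const) fun x => mem_Ici.2 (le_max_right _ _)
  refine ((continuous_matFun h).comp_aestronglyMeasurable hm).congr (ae_of_all _ fun ω => ?_)
  exact matFun_congr_psd (hZ ω) fun x hx => by simp [max_eq_left (mem_Ici.1 hx)]

/-- A convex function on `[0, ∞)` lies above its tangents. -/
theorem tangent_le (hconv : ConvexOn ℝ (Ici 0) Φ) (hΦ : ContDiffOn ℝ 2 Φ (Ioi 0)) {x y : ℝ}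
    (hx : 0 ≤ x) (hy : 0 < y) : Φ y + deriv Φ y * (x - y) ≤ Φ x := by
  have hd : HasDerivAt Φ (deriv Φ y) y :=
    ((hΦ.differentiableOn two_ne_zero).differentiableAt (isOpen_Ioi.mem_nhds hy)).hasDerivAt
  rcases lt_trichotomy x y with h | rfl | h
  · have := hconv.slope_le_of_hasDerivAt (mem_Ici.2 hx) (mem_Ici.2 hy.le) h hd
    rw [slope_def_field, div_le_iff₀ (by linarith)] at this
    linarith
  · simp
  · have := hconv.le_slope_of_hasDerivAt (mem_Ici.2 hy.le) (mem_Ici.2 hx) h hd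
    rw [slope_def_field, le_div_iff₀ (by linarith)] at this
    linarith

/-- `Φ(Z)` is integrable as soon as `Tr Φ(Z)` is bounded above by an integrable function. -/
theorem integrable_matFun_of_tr_le [IsFiniteMeasure P] (hconv : ConvexOn ℝ (Ici 0) Φ)
    (hc : ContinuousOn Φ (Ici 0)) (hΦ : ContDiffOn ℝ 2 Φ (Ioi 0)) {Z : Ω → Herm d}
    (hZ : ∀ ω, IsPSD (Z ω)) (hi : Integrable Z P) {G : Ω → ℝ} (hG : Integrable G P)
    (hle : ∀ᵐ ω ∂P, tr (matFun Φ (Z ω)) ≤ G ω) : Integrable (fun ω => matFun Φ (Z ω)) P := by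
  -- Subtract the tangent at `1`; the difference is positive, so its trace controls its norm.
  set a := deriv Φ 1
  set b := Φ 1 - deriv Φ 1
  have hlin : Integrable (fun ω => a • Z ω + b • (1 : Herm d)) P :=
    (hi.smul a).add (integrable_const _)
  have h1 : Integrable (fun ω => matFun Φ (Z ω) - (a • Z ω + b • (1 : Herm d))) P := by
    refine Integrable.mono' (hG.sub (integrable_tr hlin))
      ((aestronglyMeasurable_matFun hc hZ hi.aestronglyMeasurable).sub hlin.aestronglyMeasurable) ?_
    filter_upwards [hle] with ω hω
    rw [← matFun_sub_affine]
    refine (norm_le_tr (isPSD_matFun fun x hx => ?_)).trans ?_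
    · have := tangent_le hconv hΦ (isPSD_iff_spectrum.1 (hZ ω) hx) one_pos
      simp only [a, b]; linarith
    · rw [matFun_sub_affine, tr_sub]
      exact sub_le_sub_right hω _
  exact (h1.add hlin).congr (ae_of_all _ fun ω => sub_add_cancel _ _)

theorem tr_matFun_integral_le [IsProbabilityMeasure P] (hconv : ConvexOn ℝ (Ici 0) Φ)
    (hc : ContinuousOn Φ (Ici 0)) (hΦ : ContDiffOn ℝ 2 Φ (Ioi 0)) {Z : Ω → Herm d}
    (hZ : EntropyDomain Φ P Z) : tr (matFun Φ (∫ ω, Z ω ∂P)) ≤ ∫ ω, tr (matFun Φ (Z ω)) ∂P := by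
  have : CompleteSpace (Herm d) := FiniteDimensional.complete ℝ (Herm d)
  exact (convexOn_tr_matFun hconv hc hΦ).map_integral_le (continuousOn_tr_matFun hc)
    isClosed_isPSD (ae_of_all _ hZ.1) hZ.2.1 (integrable_tr hZ.2.2)

/-- The gradient inequality for `A ↦ Tr Φ(A)`, up to the boundary of the positive cone. -/
theorem tr_gradient_inequality (hconv : ConvexOn ℝ (Ici 0) Φ)
    (hc : ContinuousOn Φ (Ici 0)) (hΦ : ContDiffOn ℝ 2 Φ (Ioi 0)) {N M : Herm d} (hN : IsPD N)
    (hM : IsPSD M) :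
    tr (matFun Φ N) + hs (matFun (deriv Φ) N) (M - N) ≤ tr (matFun Φ M) := by
  have hl : Tendsto (fun ε : ℝ => M + ε • (1 : Herm d)) (𝓝[>] 0) (𝓝 M) := by
    have : Tendsto (fun ε : ℝ => M + ε • (1 : Herm d)) (𝓝 0) (𝓝 M) := by
      simpa using (hasDerivAt_line M (1 : Herm d) 0).continuousAt.tendsto
    exact this.mono_left nhdsWithin_le_nhds
  have hl2 : Tendsto (fun ε : ℝ => tr (matFun Φ (M + ε • (1 : Herm d)))) (𝓝[>] 0)
      (𝓝 (tr (matFun Φ M))) := by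
    refine (continuousOn_tr_matFun hc M hM).tendsto.comp (tendsto_nhdsWithin_iff.2 ⟨hl, ?_⟩)
    filter_upwards [self_mem_nhdsWithin] with ε hε using (isPD_add_smul_one hM hε).isPSD
  have hl3 : Tendsto (fun ε : ℝ => tr (matFun Φ N) +
      hs (matFun (deriv Φ) N) (M + ε • (1 : Herm d) - N)) (𝓝[>] 0)
      (𝓝 (tr (matFun Φ N) + hs (matFun (deriv Φ) N) (M - N))) :=
    (((trGrad Φ N).continuous.tendsto _).comp (hl.sub_const N)).const_add _
  refine le_of_tendsto_of_tendsto hl3 hl2 ?_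
  filter_upwards [self_mem_nhdsWithin] with ε hε
  exact (twiceDiff hΦ).gradient_inequality (fun A hA B => trHess_nonneg hconv hΦ hA B) hN
    (isPD_add_smul_one hM hε)

/-- The entropy without its normalising factor, `E Tr Φ(Z) - Tr Φ(E Z)`. -/
def gap (Φ : ℝ → ℝ) (P : Measure Ω) (Z : Ω → Herm d) : ℝ :=
  ∫ ω, tr (matFun Φ (Z ω)) ∂P - tr (matFun Φ (∫ ω, Z ω ∂P))

/-- The functional of `Z` in the dual representation of the entropy that belongs to `T`, without
its normalising factor: `E ⟨Φ'(T) - Φ'(E T), Z - T⟩ + E Tr Φ(T) - Tr Φ(E T)`. -/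
def dual (Φ : ℝ → ℝ) (P : Measure Ω) (T Z : Ω → Herm d) : ℝ :=
  ∫ ω, hs (matFun (deriv Φ) (T ω) - matFun (deriv Φ) (∫ ω', T ω' ∂P)) (Z ω - T ω) ∂P + gap Φ P T

theorem entropy_eq_gap {Z : Ω → Herm d} (hZ : EntropyDomain Φ P Z) :
    entropy Φ P Z = (d : ℝ)⁻¹ * gap Φ P Z := by
  rw [entropy, gap, tr_sub, integral_tr hZ.2.2]

/-- The tangent functionals lie below the entropy: the tangent inequality for the jointly convex
Brègman divergence, at the point `(E T, T)`, integrates to `dual T Z ≤ gap Z`, since the terms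
that are linear in `T - E T` or in `Z - E Z` have mean zero. -/
theorem dual_le_gap [IsProbabilityMeasure P] (hd : 1 ≤ d) (hconv : ConvexOn ℝ (Ici 0) Φ)
    (hc : ContinuousOn Φ (Ici 0)) (hΦ : ContDiffOn ℝ 2 Φ (Ioi 0)) (hH : HessConvex Φ)
    {T Z : Ω → Herm d} (hT : ∀ ω, IsPD (T ω)) (hTi : Integrable T P)
    (hTΦ : Integrable (fun ω => matFun Φ (T ω)) P)
    (hp : Integrable (fun ω => hs (matFun (deriv Φ) (T ω) - matFun (deriv Φ) (∫ ω', T ω' ∂P))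
      (Z ω - T ω)) P) (hZ : EntropyDomain Φ P Z) : dual Φ P T Z ≤ gap Φ P Z := by
  obtain ⟨hZp, hZi, hZΦ⟩ := hZ
  set N := ∫ ω, T ω ∂P with hN_def
  set M := ∫ ω, Z ω ∂P with hM_def
  have hN : IsPD N := isPD_integral hT hTi
  have hM : IsPSD M := isPSD_integral hZp
  have hb := (twiceDiff hΦ).bregman_of_hess (hH d hd)
  have hgT := integrable_tr hTΦ
  have hgZ := integrable_tr hZΦ
  -- The inequality for `(1 - ε) Z + ε T`, which is positive definite.
  have key : ∀ ε : ℝ, 0 < ε → ε ≤ 1 →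
      (∫ ω, tr (matFun Φ (T ω)) ∂P) - tr (matFun Φ N) + (1 - ε) * ∫ ω, hs (matFun (deriv Φ) (T ω) -
        matFun (deriv Φ) N) (Z ω - T ω) ∂P ≤
      (1 - ε) * (∫ ω, tr (matFun Φ (Z ω)) ∂P) + ε * (∫ ω, tr (matFun Φ (T ω)) ∂P) -
        tr (matFun Φ (ε • N + (1 - ε) • M)) := by
    intro ε hε hε1
    have hε1' : 0 ≤ 1 - ε := sub_nonneg.2 hε1
    set Y : Ω → Herm d := fun ω => ε • T ω + (1 - ε) • Z ω with hY
    have hYi : Integrable Y P := (hTi.smul ε).add (hZi.smul (1 - ε))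
    have hMY : ∫ ω, Y ω ∂P = ε • N + (1 - ε) • M := by
      refine (integral_add (hTi.smul ε) (hZi.smul (1 - ε))).trans ?_
      simp only [Pi.smul_apply, integral_smul]
      rfl
    set K := ε • N + (1 - ε) • M with hK
    have hpt : ∀ ω, tr (matFun Φ (T ω)) - tr (matFun Φ N) - trGrad Φ N (T ω - N) +
        (1 - ε) * hs (matFun (deriv Φ) (T ω) - matFun (deriv Φ) N) (Z ω - T ω) -
          trHess Φ N (K - N) (T ω - N) ≤
        (1 - ε) * tr (matFun Φ (Z ω)) + ε * tr (matFun Φ (T ω)) - tr (matFun Φ K) -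
          trGrad Φ K (Y ω - K) := by
      intro ω
      have h1 := (twiceDiff hΦ).bregman_tangent hb (hT ω) hN (isPD_combo (hT ω) (hZp ω) hε hε1')
        (isPD_combo hN hM hε hε1')
      have h2 := (convexOn_tr_matFun hconv hc hΦ).2 (hT ω).isPSD (hZp ω) hε.le hε1' (by ring)
      have h3 : Y ω - T ω = (1 - ε) • (Z ω - T ω) := by simp only [hY]; module
      have h4 : trGrad Φ (T ω) (Y ω - T ω) - trGrad Φ N (Y ω - T ω) =
          (1 - ε) * hs (matFun (deriv Φ) (T ω) - matFun (deriv Φ) N) (Z ω - T ω) := by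
        rw [trGrad_apply, trGrad_apply, ← hs_sub_left, h3, hs_smul_right]
      simp only [smul_eq_mul] at h2
      change _ - _ - _ + (trGrad Φ (T ω) (Y ω - T ω) - trGrad Φ N (Y ω - T ω)) - _ ≤
        tr (matFun Φ (Y ω)) - _ - trGrad Φ K (Y ω - K) at h1
      change tr (matFun Φ (Y ω)) ≤ _ at h2
      rw [h4] at h1
      linarith
    have hI1 := integrable_clm_sub_const (E := Herm d) (trGrad Φ N) hTi N
    have hI2 := integrable_clm_sub_const (E := Herm d) (trHess Φ N (K - N)) hTi N
    have hI3 := integrable_clm_sub_const (E := Herm d) (trGrad Φ K) hYi K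
    have e1 := integral_clm_sub_mean (E := Herm d) (trGrad Φ N) hTi
    have e2 := integral_clm_sub_mean (E := Herm d) (trHess Φ N (K - N)) hTi
    have e3 := integral_clm_sub_mean (E := Herm d) (trGrad Φ K) hYi
    rw [hMY] at e3
    have hA1 := hgT.sub (integrable_const (tr (matFun Φ N)))
    have hA2 := hA1.sub hI1
    have hA3 := hA2.add (hp.const_mul (1 - ε))
    have hB0 := (hgZ.const_mul (1 - ε)).add (hgT.const_mul ε)
    have hB1 := hB0.sub (integrable_const (tr (matFun Φ K)))
    have h5 := integral_mono (hA3.sub hI2) (hB1.sub hI3) hpt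
    rw [integral_sub' hA3 hI2, integral_add' hA2 (hp.const_mul (1 - ε)), integral_sub' hA1 hI1,
      integral_sub' hgT (integrable_const _), integral_sub' hB1 hI3,
      integral_sub' hB0 (integrable_const _),
      integral_add' (hgZ.const_mul (1 - ε)) (hgT.const_mul ε), integral_const_mul,
      integral_const_mul, integral_const_mul, e1, e2, e3] at h5
    simpa using h5
  have hl : Tendsto (fun ε : ℝ => ε • N + (1 - ε) • M) (𝓝[>] 0) (𝓝 M) := by
    have : Tendsto (fun ε : ℝ => ε • N + (1 - ε) • M) (𝓝 0)
        (𝓝 ((0 : ℝ) • N + (1 - (0 : ℝ)) • M)) :=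
      (Continuous.tendsto (by fun_prop) _)
    simp only [zero_smul, sub_zero, one_smul, zero_add] at this
    exact this.mono_left nhdsWithin_le_nhds
  have hmem : ∀ᶠ ε : ℝ in 𝓝[>] 0, 0 < ε ∧ ε ≤ 1 := by
    filter_upwards [Ioc_mem_nhdsGT (zero_lt_one (α := ℝ))] with ε hε using hε
  have hl2 : Tendsto (fun ε : ℝ => tr (matFun Φ (ε • N + (1 - ε) • M))) (𝓝[>] 0)
      (𝓝 (tr (matFun Φ M))) := by
    refine (continuousOn_tr_matFun hc M hM).tendsto.comp (tendsto_nhdsWithin_iff.2 ⟨hl, ?_⟩)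
    filter_upwards [hmem] with ε hε using
      (isPD_combo hN hM hε.1 (sub_nonneg.2 hε.2)).isPSD
  have hid : Tendsto (fun ε : ℝ => ε) (𝓝[>] 0) (𝓝 0) := nhdsWithin_le_nhds
  have hid' : Tendsto (fun ε : ℝ => 1 - ε) (𝓝[>] 0) (𝓝 1) := by simpa using hid.const_sub 1
  have := le_of_tendsto_of_tendsto ((hid'.mul_const _).const_add _)
    (((hid'.mul_const _).add (hid.mul_const _)).sub hl2)
    (by filter_upwards [hmem] with ε hε using key ε hε.1 hε.2)
  simp only [dual, gap]
  linarith

end Herm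

/-! ### The dual representation of the entropy -/

/-- Truncation of a real number to the interval `[1 / (n + 1), n + 1]`. -/
def trunc (n : ℕ) (x : ℝ) : ℝ := max (1 / (n + 1 : ℝ)) (min x (n + 1))

theorem continuous_trunc (n : ℕ) : Continuous (trunc n) :=
  continuous_const.max (continuous_id.min continuous_const)

theorem trunc_mem (n : ℕ) (x : ℝ) : trunc n x ∈ Icc (1 / (n + 1 : ℝ)) (n + 1) := by
  have h1 : (1 : ℝ) ≤ n + 1 := by simp
  have h2 : 1 / (n + 1 : ℝ) ≤ 1 := by rw [div_le_one (by positivity)]; exact h1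
  exact ⟨le_max_left _ _, max_le (h2.trans h1) (min_le_right _ _)⟩

theorem trunc_pos (n : ℕ) (x : ℝ) : 0 < trunc n x :=
  lt_of_lt_of_le (by positivity) (trunc_mem n x).1

/-- Truncation moves a number towards `1` or fixes it. -/
theorem trunc_cases (n : ℕ) (x : ℝ) :
    (x ≤ trunc n x ∧ trunc n x ≤ 1) ∨ (1 ≤ trunc n x ∧ trunc n x ≤ x) ∨ trunc n x = x := by
  have h1 : (1 : ℝ) ≤ n + 1 := by simp
  have h2 : 1 / (n + 1 : ℝ) ≤ 1 := by rw [div_le_one (by positivity)]; exact h1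
  simp only [trunc]
  rcases le_total x (n + 1) with h | h
  · rw [min_eq_left h]
    rcases le_total (1 / (n + 1 : ℝ)) x with h' | h'
    · exact Or.inr (Or.inr (max_eq_right h'))
    · rw [max_eq_left h']; exact Or.inl ⟨h', h2⟩
  · rw [min_eq_right h, max_eq_right (h2.trans h1)]
    exact Or.inr (Or.inl ⟨h1, h⟩)

theorem eventually_trunc_eq {x : ℝ} (hx : 0 < x) : ∀ᶠ n : ℕ in atTop, trunc n x = x := by
  have h1 := tendsto_one_div_add_atTop_nhds_zero_nat (𝕜 := ℝ)
  filter_upwards [h1.eventually_le_const hx, eventually_ge_atTop ⌈x⌉₊] with n hn hn2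
  have : x ≤ n + 1 := (Nat.le_ceil x).trans (by exact_mod_cast Nat.le_succ_of_le hn2)
  rw [trunc, min_eq_left this, max_eq_right hn]

theorem tendsto_trunc {x : ℝ} (hx : 0 ≤ x) : Tendsto (fun n => trunc n x) atTop (𝓝 x) := by
  rcases hx.eq_or_lt with rfl | hx
  · have : ∀ n, trunc n 0 = 1 / (n + 1 : ℝ) := fun n => by
      rw [trunc, min_eq_left (by positivity), max_eq_left (by positivity)]
    simpa only [this] using tendsto_one_div_add_atTop_nhds_zero_nat (𝕜 := ℝ)
  · exact tendsto_const_nhds.congr' ((eventually_trunc_eq hx).mono fun n hn => hn.symm)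

section Herm

variable {d : ℕ} {Ω : Type u} [MeasurableSpace Ω] {P : Measure Ω} {f Φ : ℝ → ℝ}

theorem isPD_matFun_trunc (n : ℕ) (A : Herm d) : IsPD (matFun (trunc n) A) :=
  isPD_matFun fun _ _ => trunc_pos _ _

theorem continuous_matFun_trunc (hf : ContinuousOn f (Ioi 0)) (n : ℕ) :
    Continuous (fun A : Herm d => matFun f (matFun (trunc n) A)) := by
  simp only [matFun_comp]
  exact continuous_matFun (hf.comp_continuous (continuous_trunc n) (trunc_pos n))

theorem exists_norm_matFun_trunc_le (hf : ContinuousOn f (Ioi 0)) (n : ℕ) :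
    ∃ C, ∀ A : Herm d, ‖matFun f (matFun (trunc n) A)‖ ≤ C := by
  have hpos : (0 : ℝ) < 1 / (n + 1 : ℝ) := by positivity
  obtain ⟨C, hC⟩ := isCompact_Icc.exists_bound_of_continuousOn
    (hf.mono fun x (hx : x ∈ Icc (1 / (n + 1 : ℝ)) (n + 1)) => lt_of_lt_of_le hpos hx.1)
  refine ⟨max C 0, fun A => ?_⟩
  rw [matFun_comp]
  exact norm_matFun_le (le_max_right _ _) fun x _ => (hC _ (trunc_mem n x)).trans (le_max_left _ _)

theorem aestronglyMeasurable_matFun_trunc (hf : ContinuousOn f (Ioi 0)) (n : ℕ) {Z : Ω → Herm d}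
    (hZ : AEStronglyMeasurable Z P) :
    AEStronglyMeasurable (fun ω => matFun f (matFun (trunc n) (Z ω))) P :=
  (continuous_matFun_trunc hf n).comp_aestronglyMeasurable hZ

theorem integrable_matFun_trunc [IsFiniteMeasure P] (hf : ContinuousOn f (Ioi 0)) (n : ℕ)
    {Z : Ω → Herm d} (hZ : AEStronglyMeasurable Z P) :
    Integrable (fun ω => matFun f (matFun (trunc n) (Z ω))) P := by
  obtain ⟨C, hC⟩ := exists_norm_matFun_trunc_le (d := d) hf n
  exact (integrable_const C).mono' (aestronglyMeasurable_matFun_trunc hf n hZ)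
    (ae_of_all _ fun ω => hC _)

theorem integrable_trunc [IsFiniteMeasure P] (n : ℕ) {Z : Ω → Herm d}
    (hZ : AEStronglyMeasurable Z P) : Integrable (fun ω => matFun (trunc n) (Z ω)) P := by
  simpa only [matFun_id] using integrable_matFun_trunc (f := fun x => x) continuousOn_id n hZ

theorem integrable_hs_trunc [IsFiniteMeasure P] (hf : ContinuousOn f (Ioi 0)) (n : ℕ)
    {Y : Ω → Herm d} (hY : AEStronglyMeasurable Y P) {Z : Ω → Herm d} (hZ : Integrable Z P)
    (N : Herm d) :
    Integrable (fun ω => hs (matFun f (matFun (trunc n) (Y ω)) - N) (Z ω)) P := by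
  obtain ⟨C, hC⟩ := exists_norm_matFun_trunc_le (d := d) hf n
  exact integrable_clm₂ (E := Herm d) (F := Herm d) hsCLM
    (S := fun ω => matFun f (matFun (trunc n) (Y ω)) - N)
    ((aestronglyMeasurable_matFun_trunc hf n hY).sub aestronglyMeasurable_const) (C := C + ‖N‖)
    (fun ω => (norm_sub_le _ _).trans (by gcongr; exact hC _)) hZ

theorem continuousOn_deriv_Ioi (hΦ : ContDiffOn ℝ 2 Φ (Ioi 0)) : ContinuousOn (deriv Φ) (Ioi 0) :=
  (contDiffOn_deriv (k := 1) hΦ).continuousOn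

/-- The functional that belongs to a truncation of `Y` is defined on all integrable `Z`. -/
theorem integrable_dual_trunc [IsFiniteMeasure P] (hΦ : ContDiffOn ℝ 2 Φ (Ioi 0)) (n : ℕ)
    {Y : Ω → Herm d} (hY : AEStronglyMeasurable Y P) {Z : Ω → Herm d} (hZ : Integrable Z P) :
    Integrable (fun ω => hs (matFun (deriv Φ) (matFun (trunc n) (Y ω)) -
      matFun (deriv Φ) (∫ ω', matFun (trunc n) (Y ω') ∂P)) (Z ω - matFun (trunc n) (Y ω))) P :=
  integrable_hs_trunc (continuousOn_deriv_Ioi hΦ) n hY (hZ.sub (integrable_trunc n hY)) _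

theorem dual_trunc_le_gap [IsProbabilityMeasure P] (hd : 1 ≤ d) (hconv : ConvexOn ℝ (Ici 0) Φ)
    (hc : ContinuousOn Φ (Ici 0)) (hΦ : ContDiffOn ℝ 2 Φ (Ioi 0)) (hH : HessConvex Φ) (n : ℕ)
    {Y : Ω → Herm d} (hY : AEStronglyMeasurable Y P) {Z : Ω → Herm d} (hZ : EntropyDomain Φ P Z) :
    dual Φ P (fun ω => matFun (trunc n) (Y ω)) Z ≤ gap Φ P Z :=
  dual_le_gap hd hconv hc hΦ hH (fun _ => isPD_matFun_trunc _ _) (integrable_trunc n hY)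
    (integrable_matFun_trunc hΦ.continuousOn n hY) (integrable_dual_trunc hΦ n hY hZ.2.1) hZ

/-- The difference of `Φ` and a linear function, chosen so that it is minimal at `1`. -/
def centred (Φ : ℝ → ℝ) (x : ℝ) : ℝ := Φ x - deriv Φ 1 * x

theorem tr_matFun_centred (A : Herm d) :
    tr (matFun (centred Φ) A) = tr (matFun Φ A) - deriv Φ 1 * tr A := by
  have h := matFun_sub_affine (f := Φ) (deriv Φ 1) 0 A
  simp only [add_zero, zero_smul] at h
  change tr (matFun (fun x => Φ x - deriv Φ 1 * x) A) = _
  rw [h, tr_sub, tr_smul]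

theorem deriv_sub_mul_nonneg (hconv : ConvexOn ℝ (Ici 0) Φ) (hΦ : ContDiffOn ℝ 2 Φ (Ioi 0))
    {x y : ℝ} (hx : 0 < x) (hy : 0 < y) : 0 ≤ (deriv Φ y - deriv Φ x) * (y - x) := by
  have h1 := tangent_le hconv hΦ hx.le hy
  have h2 := tangent_le hconv hΦ hy.le hx
  linarith

/-- Truncation moves a number towards `1`, where the increasing function `Φ' - Φ'(1)` changes
sign. -/
theorem deriv_trunc_sub_mul_nonneg (hconv : ConvexOn ℝ (Ici 0) Φ)
    (hΦ : ContDiffOn ℝ 2 Φ (Ioi 0)) (n : ℕ) (x : ℝ) :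
    0 ≤ (deriv Φ (trunc n x) - deriv Φ 1) * (x - trunc n x) := by
  have h := deriv_sub_mul_nonneg hconv hΦ one_pos (trunc_pos n x)
  rcases trunc_cases n x with ⟨h1, h2⟩ | ⟨h1, h2⟩ | h1
  · rcases h2.eq_or_lt with h3 | h3
    · simp [h3]
    · exact mul_nonneg_of_nonpos_of_nonpos
        (nonpos_of_mul_nonneg_left h (sub_neg.2 h3)) (sub_nonpos.2 h1)
  · rcases h1.eq_or_lt with h3 | h3
    · simp [← h3]
    · exact mul_nonneg (nonneg_of_mul_nonneg_left h (sub_pos.2 h3)) (sub_nonneg.2 h2)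
  · simp [h1]

theorem centred_trunc_mem (hconv : ConvexOn ℝ (Ici 0) Φ) (hΦ : ContDiffOn ℝ 2 Φ (Ioi 0)) (n : ℕ)
    {x : ℝ} (hx : 0 ≤ x) : centred Φ (trunc n x) ∈ Icc (centred Φ 1) (centred Φ x) := by
  have h1 := tangent_le hconv hΦ (trunc_pos n x).le one_pos
  have h2 := tangent_le hconv hΦ hx (trunc_pos n x)
  have h3 := deriv_trunc_sub_mul_nonneg hconv hΦ n x
  constructor <;> simp only [centred] <;> linarith

/-- The lower bound for the functional of the truncation `T` of `Z`, evaluated at `Z`. Here `Φ'(T)`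
is replaced by `Φ'(1)`, as `Φ'(T) - Φ'(1)` and `Z - T` are functions of `Z` of equal sign, and
`⟨Φ'(E T), E Z - E T⟩` is bounded by the gradient inequality. -/
theorem le_dual_trunc [IsProbabilityMeasure P] (hconv : ConvexOn ℝ (Ici 0) Φ)
    (hc : ContinuousOn Φ (Ici 0)) (hΦ : ContDiffOn ℝ 2 Φ (Ioi 0)) (n : ℕ)
    {Z : Ω → Herm d} (hZp : ∀ ω, IsPSD (Z ω)) (hZi : Integrable Z P) :
    (∫ ω, tr (matFun (fun x => centred Φ (trunc n x)) (Z ω)) ∂P) -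
      tr (matFun (centred Φ) (∫ ω, Z ω ∂P)) ≤ dual Φ P (fun ω => matFun (trunc n) (Z ω)) Z := by
  have hZm := hZi.aestronglyMeasurable
  have hTi := integrable_trunc n hZm
  have hTΦ := integrable_matFun_trunc hΦ.continuousOn n hZm
  have hi1 := integrable_dual_trunc hΦ n hZm hZi
  have hTp : ∀ ω, IsPD (matFun (trunc n) (Z ω)) := fun _ => isPD_matFun_trunc _ _
  have hgr := tr_gradient_inequality hconv hc hΦ (isPD_integral hTp hTi)
    (isPSD_integral (P := P) hZp)
  have e1 : ∀ ω, tr (matFun (fun x => centred Φ (trunc n x)) (Z ω)) =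
      tr (matFun Φ (matFun (trunc n) (Z ω))) - deriv Φ 1 * tr (matFun (trunc n) (Z ω)) := fun ω => by
    rw [← matFun_comp, tr_matFun_centred]
  simp only [dual, gap, e1, tr_matFun_centred]
  set N := ∫ ω', matFun (trunc n) (Z ω') ∂P with hN
  set M := ∫ ω, Z ω ∂P with hM
  have hpt : ∀ ω, deriv Φ 1 * tr (Z ω - matFun (trunc n) (Z ω)) -
      hs (matFun (deriv Φ) N) (Z ω - matFun (trunc n) (Z ω)) ≤
      hs (matFun (deriv Φ) (matFun (trunc n) (Z ω)) - matFun (deriv Φ) N)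
        (Z ω - matFun (trunc n) (Z ω)) := by
    intro ω
    rw [hs_sub_left]
    refine sub_le_sub_right ?_ _
    have h1 : Z ω - matFun (trunc n) (Z ω) = matFun (fun x => x - trunc n x) (Z ω) := by
      have : (fun x => x - trunc n x) = (fun x : ℝ => x) + (-1 : ℝ) • trunc n := by
        ext x; simp; ring
      rw [this, matFun_add, matFun_smul, matFun_id]
      module
    have h2 : deriv Φ 1 * tr (matFun (fun x => x - trunc n x) (Z ω)) =
        tr (matFun (fun x => deriv Φ 1 * (x - trunc n x)) (Z ω)) := by
      rw [← tr_smul, ← matFun_smul]; rfl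
    rw [h1, matFun_comp, hs_matFun_matFun, h2]
    refine tr_matFun_mono (hZp ω) fun x hx => ?_
    have := deriv_trunc_sub_mul_nonneg hconv hΦ n x
    linarith
  have hD := hZi.sub hTi
  have hA1 := (integrable_tr hD).const_mul (deriv Φ 1)
  have hA2 := integrable_clm (E := Herm d) (trGrad Φ N) hD
  have h3 := integral_mono (hA1.sub hA2) hi1 hpt
  rw [integral_sub' hA1 hA2, integral_const_mul, integral_tr hD,
    integral_clm (E := Herm d) (trGrad Φ N) hD, integral_sub' hZi hTi, tr_sub, trGrad_apply,
    ← hN, ← hM] at h3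
  have h4 := integral_sub (integrable_tr hTΦ) ((integrable_tr hTi).const_mul (deriv Φ 1))
  rw [integral_const_mul, integral_tr hTi, ← hN] at h4
  rw [h4]
  linarith

/-- Dominated convergence applies, since `Φ(x) - Φ'(1) x` composed with a truncation lies between
its minimum, attained at `1`, and `Φ(x) - Φ'(1) x`. -/
theorem tendsto_lower_bound [IsProbabilityMeasure P] (hconv : ConvexOn ℝ (Ici 0) Φ)
    (hc : ContinuousOn Φ (Ici 0)) (hΦ : ContDiffOn ℝ 2 Φ (Ioi 0))
    {Z : Ω → Herm d} (hZ : EntropyDomain Φ P Z) :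
    Tendsto (fun n => (∫ ω, tr (matFun (fun x => centred Φ (trunc n x)) (Z ω)) ∂P) -
      tr (matFun (centred Φ) (∫ ω, Z ω ∂P))) atTop (𝓝 (gap Φ P Z)) := by
  obtain ⟨hZp, hZi, hZΦ⟩ := hZ
  have hi : Integrable (fun ω => tr (matFun (centred Φ) (Z ω))) P := by
    simp only [tr_matFun_centred]
    exact (integrable_tr hZΦ).sub ((integrable_tr hZi).const_mul _)
  have hcen : ContinuousOn (centred Φ) (Ici 0) := hc.sub (by fun_prop)
  have e : gap Φ P Z = (∫ ω, tr (matFun (centred Φ) (Z ω)) ∂P) -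
      tr (matFun (centred Φ) (∫ ω, Z ω ∂P)) := by
    simp only [gap, tr_matFun_centred]
    rw [integral_sub (integrable_tr hZΦ) ((integrable_tr hZi).const_mul _), integral_const_mul,
      integral_tr hZi]
    ring
  rw [e]
  refine Tendsto.sub_const ?_ _
  refine tendsto_integral_of_dominated_convergence
    (fun ω => |centred Φ 1 * d| + |tr (matFun (centred Φ) (Z ω))|) (fun n => ?_)
    ((integrable_const _).add hi.abs) (fun n => ae_of_all _ fun ω => ?_) (ae_of_all _ fun ω => ?_)
  · have hcont : Continuous fun x => centred Φ (trunc n x) :=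
      hcen.comp_continuous (continuous_trunc n) fun x => (trunc_pos n x).le
    exact ((trCLM (d := d)).continuous.comp (continuous_matFun hcont)).comp_aestronglyMeasurable
      hZi.aestronglyMeasurable
  · have h1 : centred Φ 1 * d ≤ tr (matFun (fun x => centred Φ (trunc n x)) (Z ω)) := by
      have := tr_matFun_affine 0 (centred Φ 1) (Z ω)
      rw [zero_mul, zero_add] at this
      rw [← this]
      exact tr_matFun_mono (hZp ω) fun x hx => by
        simpa using (centred_trunc_mem hconv hΦ n hx).1
    have h2 : tr (matFun (fun x => centred Φ (trunc n x)) (Z ω)) ≤ tr (matFun (centred Φ) (Z ω)) :=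
      tr_matFun_mono (hZp ω) fun x hx => (centred_trunc_mem hconv hΦ n hx).2
    rw [Real.norm_eq_abs, abs_le]
    constructor
    · linarith [neg_abs_le (centred Φ 1 * d), abs_nonneg (tr (matFun (centred Φ) (Z ω)))]
    · linarith [le_abs_self (tr (matFun (centred Φ) (Z ω))), abs_nonneg (centred Φ 1 * d)]
  · refine tendsto_tr_matFun (hZp ω) fun x hx => ?_
    exact (hcen x hx).tendsto.comp (tendsto_nhdsWithin_iff.2
      ⟨tendsto_trunc hx, Eventually.of_forall fun n => (trunc_pos n x).le⟩)

/-- An upper bound for the functionals of the truncations of `Z`, evaluated at `Z`, is an upper bound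
for the entropy of `Z`. -/
theorem gap_le_of_dual_trunc_le [IsProbabilityMeasure P] (hconv : ConvexOn ℝ (Ici 0) Φ)
    (hc : ContinuousOn Φ (Ici 0)) (hΦ : ContDiffOn ℝ 2 Φ (Ioi 0))
    {Z : Ω → Herm d} (hZ : EntropyDomain Φ P Z) {c : ℝ}
    (h : ∀ n, dual Φ P (fun ω => matFun (trunc n) (Z ω)) Z ≤ c) : gap Φ P Z ≤ c :=
  le_of_tendsto' (tendsto_lower_bound hconv hc hΦ hZ) fun n =>
    (le_dual_trunc hconv hc hΦ n hZ.1 hZ.2.1).trans (h n)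

theorem convex_entropyDomain [IsFiniteMeasure P] (hconv : ConvexOn ℝ (Ici 0) Φ)
    (hc : ContinuousOn Φ (Ici 0)) (hΦ : ContDiffOn ℝ 2 Φ (Ioi 0)) :
    Convex ℝ {Z : Ω → Herm d | EntropyDomain Φ P Z} := by
  intro Z hZ W hW a b ha hb hab
  have hp : ∀ ω, IsPSD ((a • Z + b • W) ω) := fun ω => convex_isPSD (hZ.1 ω) (hW.1 ω) ha hb hab
  have hi : Integrable (a • Z + b • W) P := (hZ.2.1.smul a).add (hW.2.1.smul b)
  exact ⟨hp, hi, integrable_matFun_of_tr_le hconv hc hΦ hp hi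
    (((integrable_tr hZ.2.2).const_mul a).add ((integrable_tr hW.2.2).const_mul b))
    (ae_of_all _ fun ω => (convexOn_tr_matFun hconv hc hΦ).2 (hZ.1 ω) (hW.1 ω) ha hb hab)⟩

/-- For fixed `T` the functional is affine. -/
theorem dual_combo {T Z W : Ω → Herm d} {a b : ℝ} (hab : a + b = 1)
    (hZ : Integrable (fun ω => hs (matFun (deriv Φ) (T ω) - matFun (deriv Φ) (∫ ω', T ω' ∂P))
      (Z ω - T ω)) P)
    (hW : Integrable (fun ω => hs (matFun (deriv Φ) (T ω) - matFun (deriv Φ) (∫ ω', T ω' ∂P))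
      (W ω - T ω)) P) :
    dual Φ P T (a • Z + b • W) = a * dual Φ P T Z + b * dual Φ P T W := by
  obtain rfl : b = 1 - a := by linarith
  simp only [dual]
  rw [mul_add, mul_add, ← integral_const_mul, ← integral_const_mul, add_add_add_comm,
    ← integral_add (hZ.const_mul a) (hW.const_mul (1 - a)), ← add_mul, hab, one_mul]
  congr 2
  ext ω
  rw [← hs_smul_right, ← hs_smul_right, ← hs_add_right]
  congr 1
  simp only [Pi.add_apply, Pi.smul_apply]
  module

theorem convexOn_gap [IsProbabilityMeasure P] (hd : 1 ≤ d) (hconv : ConvexOn ℝ (Ici 0) Φ)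
    (hc : ContinuousOn Φ (Ici 0)) (hΦ : ContDiffOn ℝ 2 Φ (Ioi 0)) (hH : HessConvex Φ) :
    ConvexOn ℝ {Z : Ω → Herm d | EntropyDomain Φ P Z} (gap Φ P) := by
  refine ⟨convex_entropyDomain hconv hc hΦ, fun Z hZ W hW a b ha hb hab => ?_⟩
  have hV := convex_entropyDomain hconv hc hΦ hZ hW ha hb hab
  refine gap_le_of_dual_trunc_le hconv hc hΦ hV fun n => ?_
  have hVm := hV.2.1.aestronglyMeasurable
  have hZ1 := dual_trunc_le_gap hd hconv hc hΦ hH n hVm hZ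
  have hW1 := dual_trunc_le_gap hd hconv hc hΦ hH n hVm hW
  have iZ := integrable_dual_trunc hΦ n hVm hZ.2.1
  have iW := integrable_dual_trunc hΦ n hVm hW.2.1
  rw [dual_combo hab iZ iW]
  simp only [smul_eq_mul]
  gcongr

theorem entropyConvex_of_hessConvex (hconv : ConvexOn ℝ (Ici 0) Φ)
    (hc : ContinuousOn Φ (Ici 0)) (hΦ : ContDiffOn ℝ 2 Φ (Ioi 0)) (hH : HessConvex Φ) :
    EntropyConvex.{u} Φ := by
  intro d hd Ω _ P _
  refine ((convexOn_gap hd hconv hc hΦ hH).smul (inv_nonneg.2 (Nat.cast_nonneg d))).congr ?_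
  exact fun Z hZ => (entropy_eq_gap hZ).symm

/-- The trace of a matrix, as a real functional. -/
def reTrace (d : ℕ) : Matrix (Fin d) (Fin d) ℂ →L[ℝ] ℝ :=
  have : FiniteDimensional ℝ (Matrix (Fin d) (Fin d) ℂ) := FiniteDimensional.trans ℝ ℂ _
  LinearMap.toContinuousLinearMap
    { toFun := fun A => (Matrix.trace A).re
      map_add' := fun A B => by simp
      map_smul' := fun c A => by simp }

/-- The expression in the supremum representation is the normalised functional that belongs to
`T`. -/
theorem sup_value_eq {Z T : Ω → Herm d} (hT : SupRange Φ P Z T) :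
    (d : ℝ)⁻¹ * (Matrix.trace (∫ ω,
      ((matFun (deriv Φ) (T ω) - matFun (deriv Φ) (∫ ω', T ω' ∂P) : Herm d) :
        Matrix (Fin d) (Fin d) ℂ) *
      ((Z ω - T ω : Herm d) : Matrix (Fin d) (Fin d) ℂ) ∂P)).re + entropy Φ P T =
    (d : ℝ)⁻¹ * dual Φ P T Z := by
  have := FiniteDimensional.trans ℝ ℂ (Matrix (Fin d) (Fin d) ℂ)
  rw [entropy_eq_gap ⟨fun ω => (hT.1 ω).isPSD, hT.2.1, hT.2.2.1⟩, dual, mul_add]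
  congr 2
  exact (integral_clm (E := Matrix (Fin d) (Fin d) ℂ) (reTrace d) hT.2.2.2).symm

theorem SupRange.integrable_hs {Z T : Ω → Herm d} (hT : SupRange Φ P Z T) :
    Integrable (fun ω => hs (matFun (deriv Φ) (T ω) - matFun (deriv Φ) (∫ ω', T ω' ∂P))
      (Z ω - T ω)) P :=
  integrable_clm (E := Matrix (Fin d) (Fin d) ℂ) (reTrace d) hT.2.2.2

theorem supRange_trunc [IsProbabilityMeasure P] (hΦ : ContDiffOn ℝ 2 Φ (Ioi 0)) (n : ℕ)
    {Z : Ω → Herm d} (hZi : Integrable Z P) :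
    SupRange Φ P Z (fun ω => matFun (trunc n) (Z ω)) := by
  have hZm := hZi.aestronglyMeasurable
  refine ⟨fun _ => isPD_matFun_trunc _ _, integrable_trunc n hZm,
    integrable_matFun_trunc hΦ.continuousOn n hZm, ?_⟩
  obtain ⟨C, hC⟩ := exists_norm_matFun_trunc_le (d := d) (continuousOn_deriv_Ioi hΦ) n
  set N := matFun (deriv Φ) (∫ ω', matFun (trunc n) (Z ω') ∂P)
  have hD := hZi.sub (integrable_trunc n hZm)
  have hm := ((aestronglyMeasurable_matFun_trunc (continuousOn_deriv_Ioi hΦ) n hZm).sub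
    (aestronglyMeasurable_const (b := N)))
  refine Integrable.mono' (hD.norm.const_mul (C + ‖N‖)) ?_ (ae_of_all _ fun ω => ?_)
  · exact (continuous_subtype_val.comp_aestronglyMeasurable hm).mul
      (continuous_subtype_val.comp_aestronglyMeasurable hD.aestronglyMeasurable)
  · refine (norm_mul_le _ _).trans ?_
    refine mul_le_mul_of_nonneg_right ?_ (norm_nonneg _)
    exact (norm_sub_le (matFun (deriv Φ) (matFun (trunc n) (Z ω))) N).trans (by gcongr; exact hC _)

theorem supRepresentation_of_hessConvex (hconv : ConvexOn ℝ (Ici 0) Φ)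
    (hc : ContinuousOn Φ (Ici 0)) (hΦ : ContDiffOn ℝ 2 Φ (Ioi 0)) (hH : HessConvex Φ) :
    SupRepresentation.{u} Φ := by
  intro d hd Ω _ P _ Z hZ
  have hd' : (0 : ℝ) < (d : ℝ)⁻¹ := inv_pos.2 (Nat.cast_pos.2 hd)
  rw [entropy_eq_gap hZ]
  constructor
  · rintro r ⟨T, hT, rfl⟩
    rw [sup_value_eq hT]
    gcongr
    exact dual_le_gap hd hconv hc hΦ hH hT.1 hT.2.1 hT.2.2.1 hT.integrable_hs hZ
  · intro c hcub
    rw [inv_mul_le_iff₀ (Nat.cast_pos.2 hd)]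
    refine gap_le_of_dual_trunc_le hconv hc hΦ hZ fun n => ?_
    rw [← inv_mul_le_iff₀ (Nat.cast_pos.2 hd)]
    have hT := supRange_trunc hΦ n hZ.2.1
    exact hcub ⟨_, hT, (sup_value_eq hT).symm⟩

end Herm

/-! ### Product spaces: conditional Jensen inequality and subadditivity -/

section Product

variable {d : ℕ} {Ω₁ Ω₂ : Type u} [MeasurableSpace Ω₁] [MeasurableSpace Ω₂] {P₁ : Measure Ω₁}
  {P₂ : Measure Ω₂} {Φ : ℝ → ℝ}

theorem EntropyDomain.comp_equiv {Z : Ω₁ → Herm d} (hZ : EntropyDomain Φ P₁ Z) (e : Ω₁ ≃ᵐ Ω₂)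
    (he : MeasurePreserving e P₁ P₂) : EntropyDomain Φ P₂ (fun x => Z (e.symm x)) :=
  ⟨fun _ => hZ.1 _, (he.symm e).integrable_comp_of_integrable hZ.2.1,
    (he.symm e).integrable_comp_of_integrable hZ.2.2⟩

theorem gap_comp_equiv (Z : Ω₁ → Herm d) (e : Ω₁ ≃ᵐ Ω₂) (he : MeasurePreserving e P₁ P₂) :
    gap Φ P₂ (fun x => Z (e.symm x)) = gap Φ P₁ Z := by
  rw [gap, gap, (he.symm e).integral_comp' Z,
    (he.symm e).integral_comp' fun x => tr (matFun Φ (Z x))]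

variable [IsProbabilityMeasure P₁] [IsProbabilityMeasure P₂] {Z : Ω₁ × Ω₂ → Herm d}

theorem EntropyDomain.swap (hZ : EntropyDomain Φ (P₁.prod P₂) Z) :
    EntropyDomain Φ (P₂.prod P₁) (fun x => Z x.swap) :=
  ⟨fun _ => hZ.1 _, hZ.2.1.swap, hZ.2.2.swap⟩

theorem EntropyDomain.ae_slice (hZ : EntropyDomain Φ (P₁.prod P₂) Z) :
    ∀ᵐ x₁ ∂P₁, EntropyDomain Φ P₂ (fun x₂ => Z (x₁, x₂)) := by
  filter_upwards [hZ.2.1.prod_right_ae, hZ.2.2.prod_right_ae] with x₁ h1 h2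
  exact ⟨fun _ => hZ.1 _, h1, h2⟩

/-- Partial expectations of an admissible random matrix are admissible. -/
theorem EntropyDomain.integral_right (hconv : ConvexOn ℝ (Ici 0) Φ)
    (hc : ContinuousOn Φ (Ici 0)) (hΦ : ContDiffOn ℝ 2 Φ (Ioi 0))
    (hZ : EntropyDomain Φ (P₁.prod P₂) Z) :
    EntropyDomain Φ P₁ (fun x₁ => ∫ x₂, Z (x₁, x₂) ∂P₂) := by
  have hp : ∀ x₁, IsPSD (∫ x₂, Z (x₁, x₂) ∂P₂) := fun x₁ => isPSD_integral fun x₂ => hZ.1 _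
  have hi : Integrable (fun x₁ => ∫ x₂, Z (x₁, x₂) ∂P₂) P₁ := hZ.2.1.integral_prod_left
  refine ⟨hp, hi, integrable_matFun_of_tr_le hconv hc hΦ hp hi
    (integrable_tr hZ.2.2).integral_prod_left ?_⟩
  filter_upwards [hZ.ae_slice] with x₁ h using tr_matFun_integral_le hconv hc hΦ h

theorem integrable_gap_slice (hconv : ConvexOn ℝ (Ici 0) Φ)
    (hc : ContinuousOn Φ (Ici 0)) (hΦ : ContDiffOn ℝ 2 Φ (Ioi 0))
    (hZ : EntropyDomain Φ (P₁.prod P₂) Z) :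
    Integrable (fun x₁ => gap Φ P₂ (fun x₂ => Z (x₁, x₂))) P₁ :=
  (integrable_tr hZ.2.2).integral_prod_left.sub
    (integrable_tr (hZ.integral_right hconv hc hΦ).2.2)

/-- The chain rule for the entropy of a function of two independent variables. -/
theorem gap_prod (hconv : ConvexOn ℝ (Ici 0) Φ)
    (hc : ContinuousOn Φ (Ici 0)) (hΦ : ContDiffOn ℝ 2 Φ (Ioi 0))
    (hZ : EntropyDomain Φ (P₁.prod P₂) Z) :
    gap Φ (P₁.prod P₂) Z = ∫ x₁, gap Φ P₂ (fun x₂ => Z (x₁, x₂)) ∂P₁ +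
      gap Φ P₁ (fun x₁ => ∫ x₂, Z (x₁, x₂) ∂P₂) := by
  have h := integral_sub (integrable_tr hZ.2.2).integral_prod_left
    (integrable_tr (hZ.integral_right hconv hc hΦ).2.2)
  simp only [gap]
  rw [h, integral_prod _ (integrable_tr hZ.2.2), integral_prod _ hZ.2.1]
  ring

theorem integral_entropy_slice (hZ : EntropyDomain Φ (P₁.prod P₂) Z) :
    ∫ x₁, entropy Φ P₂ (fun x₂ => Z (x₁, x₂)) ∂P₁ =
      (d : ℝ)⁻¹ * ∫ x₁, gap Φ P₂ (fun x₂ => Z (x₁, x₂)) ∂P₁ := by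
  rw [← integral_const_mul]
  exact integral_congr_ae (hZ.ae_slice.mono fun x₁ h => entropy_eq_gap h)

/-- The conditional Jensen inequality: the functional that belongs to a truncation of `E₁ Z` is
affine, so it commutes with `E₁`, and on the slices of `Z` it lies below the entropy. -/
theorem gap_integral_le (hd : 1 ≤ d) (hconv : ConvexOn ℝ (Ici 0) Φ)
    (hc : ContinuousOn Φ (Ici 0)) (hΦ : ContDiffOn ℝ 2 Φ (Ioi 0)) (hH : HessConvex Φ)
    (hZ : EntropyDomain Φ (P₁.prod P₂) Z) :
    gap Φ P₂ (fun x₂ => ∫ x₁, Z (x₁, x₂) ∂P₁) ≤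
      ∫ x₁, gap Φ P₂ (fun x₂ => Z (x₁, x₂)) ∂P₁ := by
  have hY : EntropyDomain Φ P₂ (fun x₂ => ∫ x₁, Z (x₁, x₂) ∂P₁) :=
    hZ.swap.integral_right hconv hc hΦ
  refine gap_le_of_dual_trunc_le hconv hc hΦ hY fun n => ?_
  have hYm := hY.2.1.aestronglyMeasurable
  set Y : Ω₂ → Herm d := fun x₂ => ∫ x₁, Z (x₁, x₂) ∂P₁ with hY_def
  set T : Ω₂ → Herm d := fun x₂ => matFun (trunc n) (Y x₂) with hT
  set N := matFun (deriv Φ) (∫ x₂, T x₂ ∂P₂) with hN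
  have hF : Integrable (fun p : Ω₁ × Ω₂ => hs (matFun (deriv Φ) (T p.2) - N) (Z p - T p.2))
      (P₁.prod P₂) :=
    integrable_hs_trunc (continuousOn_deriv_Ioi hΦ) n (Y := fun p : Ω₁ × Ω₂ => Y p.2)
      hYm.comp_snd (hZ.2.1.sub ((integrable_trunc n hYm).comp_snd P₁)) N
  have h1 : dual Φ P₂ T Y = ∫ x₁, dual Φ P₂ T (fun x₂ => Z (x₁, x₂)) ∂P₁ := by
    simp only [dual]
    rw [integral_add hF.integral_prod_left (integrable_const _), integral_integral_swap hF]
    congr 1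
    · refine integral_congr_ae ?_
      filter_upwards [hZ.2.1.prod_left_ae] with x₂ hx₂
      refine Eq.trans ?_ (integral_clm (E := Herm d) (hsCLM (matFun (deriv Φ) (T x₂) - N))
        (hx₂.sub (integrable_const (T x₂)))).symm
      rw [integral_sub' hx₂ (integrable_const _)]
      simp [hY_def, hN, hs_sub_left]
    · simp
  rw [h1]
  refine integral_mono_ae (hF.integral_prod_left.add (integrable_const _))
    (integrable_gap_slice hconv hc hΦ hZ) ?_
  filter_upwards [hZ.ae_slice] with x₁ hx₁
  exact dual_trunc_le_gap hd hconv hc hΦ hH n hYm hx₁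

end Product

theorem conditionalJensen_of_hessConvex {Φ : ℝ → ℝ} (hconv : ConvexOn ℝ (Ici 0) Φ)
    (hc : ContinuousOn Φ (Ici 0)) (hΦ : ContDiffOn ℝ 2 Φ (Ioi 0)) (hH : HessConvex Φ) :
    ConditionalJensen.{u} Φ := by
  intro d hd Ω₁ Ω₂ _ _ P₁ P₂ _ _ Z hZ
  have hY : EntropyDomain Φ P₂ (fun x₂ => ∫ x₁, Z (x₁, x₂) ∂P₁) :=
    hZ.swap.integral_right hconv hc hΦ
  rw [ge_iff_le, integral_entropy_slice hZ, entropy_eq_gap hY]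
  gcongr
  exact gap_integral_le hd hconv hc hΦ hH hZ

section Pi

variable {d : ℕ} {Φ : ℝ → ℝ}

theorem update_eq_piFinSuccAbove_symm {n : ℕ} {Ω : Fin (n + 1) → Type u}
    [∀ i, MeasurableSpace (Ω i)] (i : Fin (n + 1)) (ω : ∀ i, Ω i) (x : Ω i) :
    Function.update ω i x = (MeasurableEquiv.piFinSuccAbove Ω i).symm
      (x, (MeasurableEquiv.piFinSuccAbove Ω i ω).2) :=
  (Fin.insertNth_removeNth i x ω).symm

section

variable {n : ℕ} {Ω : Fin (n + 1) → Type u} [∀ i, MeasurableSpace (Ω i)] {P : ∀ i, Measure (Ω i)}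
  [∀ i, IsProbabilityMeasure (P i)] {Z : (∀ i, Ω i) → Herm d}

theorem ae_update_of_ae_slice (i : Fin (n + 1)) {p : (∀ j, Ω (i.succAbove j)) → Prop}
    (h : ∀ᵐ y ∂(Measure.pi fun j => P (i.succAbove j)), p y) :
    ∀ᵐ ω ∂(Measure.pi P), p (MeasurableEquiv.piFinSuccAbove Ω i ω).2 :=
  (measurePreserving_piFinSuccAbove P i).quasiMeasurePreserving.ae
    (Measure.quasiMeasurePreserving_snd.ae h)

theorem EntropyDomain.ae_update (hZ : EntropyDomain Φ (Measure.pi P) Z) (i : Fin (n + 1)) :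
    ∀ᵐ ω ∂(Measure.pi P), EntropyDomain Φ (P i) (fun x => Z (Function.update ω i x)) := by
  simp only [update_eq_piFinSuccAbove_symm]
  exact ae_update_of_ae_slice i
    (hZ.comp_equiv _ (measurePreserving_piFinSuccAbove P i)).swap.ae_slice

theorem integrable_gap_update (hconv : ConvexOn ℝ (Ici 0) Φ)
    (hc : ContinuousOn Φ (Ici 0)) (hΦ : ContDiffOn ℝ 2 Φ (Ioi 0))
    (hZ : EntropyDomain Φ (Measure.pi P) Z) (i : Fin (n + 1)) :
    Integrable (fun ω => gap Φ (P i) (fun x => Z (Function.update ω i x))) (Measure.pi P) := by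
  simp only [update_eq_piFinSuccAbove_symm]
  have h := integrable_gap_slice hconv hc hΦ
    (hZ.comp_equiv _ (measurePreserving_piFinSuccAbove P i)).swap
  exact (measurePreserving_piFinSuccAbove P i).integrable_comp_of_integrable (h.comp_snd (P i))

theorem integral_gap_update (i : Fin (n + 1)) :
    ∫ ω, gap Φ (P i) (fun x => Z (Function.update ω i x)) ∂(Measure.pi P) =
      ∫ y, gap Φ (P i) (fun x => Z ((MeasurableEquiv.piFinSuccAbove Ω i).symm (x, y)))
        ∂(Measure.pi fun j => P (i.succAbove j)) := by
  simp only [update_eq_piFinSuccAbove_symm]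
  rw [(measurePreserving_piFinSuccAbove P i).integral_comp' fun p => gap Φ (P i) (fun x =>
    Z ((MeasurableEquiv.piFinSuccAbove Ω i).symm (x, p.2)))]
  exact (integral_fun_snd fun y => gap Φ (P i) (fun x =>
    Z ((MeasurableEquiv.piFinSuccAbove Ω i).symm (x, y)))).trans (by simp)

end

/-- Subadditivity of the entropy, by induction on the number of variables. The chain rule splits off
the first variable; the entropy of the expectation over the others is bounded by the conditional
Jensen inequality, and the entropies of the slices by induction. -/
theorem gap_pi_le (hd : 1 ≤ d) (hconv : ConvexOn ℝ (Ici 0) Φ)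
    (hc : ContinuousOn Φ (Ici 0)) (hΦ : ContDiffOn ℝ 2 Φ (Ioi 0)) (hH : HessConvex Φ) (n : ℕ) :
    ∀ (Ω : Fin n → Type u) [∀ i, MeasurableSpace (Ω i)]
    (P : ∀ i, Measure (Ω i)) [∀ i, IsProbabilityMeasure (P i)]
    (Z : (∀ i, Ω i) → Herm d), EntropyDomain Φ (Measure.pi P) Z →
      gap Φ (Measure.pi P) Z ≤
        ∑ i, ∫ ω, gap Φ (P i) (fun x => Z (Function.update ω i x)) ∂(Measure.pi P) := by
  induction n with
  | zero =>
    intro Ω _ P _ Z hZ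
    have hconst : Z = fun _ => Z (fun i => i.elim0) := by
      ext1 ω; exact congrArg Z (Subsingleton.elim _ _)
    rw [hconst]
    simp [gap]
  | succ n ih =>
    intro Ω _ P _ Z hZ
    have he := measurePreserving_piFinSuccAbove P 0
    set e := MeasurableEquiv.piFinSuccAbove Ω 0 with he_def
    have hZ' := hZ.comp_equiv e he
    -- The entropies in the remaining coordinates, as functions on the product of two spaces.
    have hslice : ∀ j, Integrable (fun p : Ω 0 × (∀ j, Ω ((0 : Fin (n + 1)).succAbove j)) =>
        gap Φ (P ((0 : Fin (n + 1)).succAbove j))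
          (fun x => Z (e.symm (p.1, Function.update p.2 j x))))
        ((P 0).prod (Measure.pi fun j => P ((0 : Fin (n + 1)).succAbove j))) := by
      intro j
      have h1 := (he.symm e).integrable_comp_of_integrable
        (integrable_gap_update hconv hc hΦ hZ ((0 : Fin (n + 1)).succAbove j))
      refine h1.congr (ae_of_all _ fun p => ?_)
      have : ∀ x, e.symm (p.1, Function.update p.2 j x) =
          Function.update (e.symm p) ((0 : Fin (n + 1)).succAbove j) x := fun x =>
        Fin.insertNth_update 0 p.1 j x p.2
      simp only [Function.comp_apply, this]
    have hint : ∀ j, ∫ ω, gap Φ (P ((0 : Fin (n + 1)).succAbove j))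
          (fun x => Z (Function.update ω ((0 : Fin (n + 1)).succAbove j) x)) ∂(Measure.pi P) =
        ∫ x₀, ∫ y, gap Φ (P ((0 : Fin (n + 1)).succAbove j))
          (fun x => Z (e.symm (x₀, Function.update y j x)))
            ∂(Measure.pi fun j => P ((0 : Fin (n + 1)).succAbove j)) ∂(P 0) := by
      intro j
      rw [← integral_prod _ (hslice j), ← he.integral_comp' (f := e)]
      refine integral_congr_ae (ae_of_all _ fun ω => ?_)
      have : ∀ x, e.symm ((e ω).1, Function.update (e ω).2 j x) =
          Function.update ω ((0 : Fin (n + 1)).succAbove j) x := fun x => by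
        have h2 := Fin.insertNth_update 0 (e ω).1 j x (e ω).2
        have h3 : (0 : Fin (n + 1)).insertNth (e ω).1 (e ω).2 = ω := e.symm_apply_apply ω
        rw [h3] at h2
        exact h2
      simp only [this]
    have h0 := gap_integral_le hd hconv hc hΦ hH hZ'.swap
    rw [← gap_comp_equiv Z e he, gap_prod hconv hc hΦ hZ', Fin.sum_univ_succAbove _ 0,
      integral_gap_update 0, add_comm]
    refine add_le_add h0 ?_
    simp only [hint]
    have hA := integrable_gap_slice hconv hc hΦ hZ'
    have hB := fun j => (hslice j).integral_prod_left
    have hB' := integrable_finsetSum Finset.univ fun j _ => hB j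
    rw [← integral_finsetSum _ fun j _ => hB j]
    have hle := hZ'.ae_slice.mono fun x₀ hx₀ => ih _ _ (fun y => Z (e.symm (x₀, y))) hx₀
    exact integral_mono_ae hA hB' hle

theorem entropySubadditive_of_hessConvex (hconv : ConvexOn ℝ (Ici 0) Φ)
    (hc : ContinuousOn Φ (Ici 0)) (hΦ : ContDiffOn ℝ 2 Φ (Ioi 0)) (hH : HessConvex Φ) :
    EntropySubadditive.{u} Φ := by
  intro d hd n Ω _ P _ Z hZ
  have h : ∀ i, ∫ ω, entropy Φ (P i) (fun x => Z (Function.update ω i x)) ∂(Measure.pi P) =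
      (d : ℝ)⁻¹ * ∫ ω, gap Φ (P i) (fun x => Z (Function.update ω i x)) ∂(Measure.pi P) := by
    intro i
    rw [← integral_const_mul]
    cases n with
    | zero => exact i.elim0
    | succ n => exact integral_congr_ae ((hZ.ae_update i).mono fun ω h => entropy_eq_gap h)
  simp only [h]
  rw [entropy_eq_gap hZ, ← Finset.mul_sum]
  gcongr
  exact gap_pi_le hd hconv hc hΦ hH n Ω P Z hZ

end Pi

/-! ### Two-point probability spaces -/

/-- The probability measure on two points with weights `t` and `1 - t`. -/
def twoPoint (t : ℝ) : Measure (ULift.{u} Bool) :=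
  ENNReal.ofReal t • Measure.dirac ⟨true⟩ + ENNReal.ofReal (1 - t) • Measure.dirac ⟨false⟩

/-- The function on two points with values `A` and `B`. -/
def twoValued {E : Type*} (A B : E) (x : ULift.{u} Bool) : E := if x.down then A else B

instance : MeasurableSingletonClass (ULift.{u} Bool) :=
  ⟨fun _ => trivial⟩

theorem isProbabilityMeasure_twoPoint {t : ℝ} (h0 : 0 ≤ t) (h1 : t ≤ 1) :
    IsProbabilityMeasure (twoPoint.{u} t) := by
  constructor
  simp only [twoPoint, Measure.coe_add, Measure.coe_smul, Pi.add_apply, Pi.smul_apply, smul_eq_mul,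
    measure_univ, mul_one]
  rw [← ENNReal.ofReal_add h0 (sub_nonneg.2 h1)]
  simp

theorem integral_twoPoint {E : Type} [NormedAddCommGroup E] [NormedSpace ℝ E] [CompleteSpace E]
    {t : ℝ} (h0 : 0 ≤ t) (h1 : t ≤ 1) (F : ULift.{u} Bool → E) :
    ∫ x, F x ∂(twoPoint t) = t • F ⟨true⟩ + (1 - t) • F ⟨false⟩ := by
  have hi : ∀ x : ULift.{u} Bool, Integrable F (Measure.dirac x) := fun x => .of_finite
  rw [twoPoint, integral_add_measure ((hi _).smul_measure ENNReal.ofReal_ne_top)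
    ((hi _).smul_measure ENNReal.ofReal_ne_top), integral_smul_measure, integral_smul_measure,
    integral_dirac, integral_dirac, ENNReal.toReal_ofReal h0,
    ENNReal.toReal_ofReal (sub_nonneg.2 h1)]

section

variable {d : ℕ} {Φ : ℝ → ℝ} {t : ℝ}

theorem gap_twoValued (h0 : 0 ≤ t) (h1 : t ≤ 1) (A B : Herm d) :
    gap Φ (twoPoint.{u} t) (twoValued A B) =
      tr (t • matFun Φ A + (1 - t) • matFun Φ B - matFun Φ (t • A + (1 - t) • B)) := by
  have : CompleteSpace (Herm d) := FiniteDimensional.complete ℝ (Herm d)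
  rw [gap, integral_twoPoint h0 h1, integral_twoPoint (E := Herm d) h0 h1, tr_jensen]
  rfl

theorem entropyDomain_twoValued [IsProbabilityMeasure (twoPoint.{u} t)] {A B : Herm d}
    (hA : IsPSD A) (hB : IsPSD B) : EntropyDomain Φ (twoPoint.{u} t) (twoValued A B) := by
  refine ⟨fun x => ?_, .of_finite, .of_finite⟩
  unfold twoValued
  split_ifs <;> assumption

theorem twoValued_combo (a b : ℝ) (p q : Herm d × Herm d) :
    (twoValued (a • p + b • q).1 (a • p + b • q).2 : ULift.{u} Bool → Herm d) =
      a • twoValued p.1 p.2 + b • twoValued q.1 q.2 := by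
  ext1 x
  simp only [twoValued, Pi.add_apply, Pi.smul_apply]
  split_ifs <;> rfl

theorem convex_isPSD_prod : Convex ℝ {p : Herm d × Herm d | IsPSD p.1 ∧ IsPSD p.2} :=
  (convex_isPSD (d := d)).prod (convex_isPSD (d := d))

/-- Convexity of the entropy on two-point spaces is joint convexity of the Jensen gap. -/
theorem jensenGapConvex_of_twoPoint
    (h : ∀ t : ℝ, 0 ≤ t → t ≤ 1 → ∀ d : ℕ, 1 ≤ d → ∀ p q : Herm d × Herm d, IsPSD p.1 → IsPSD p.2 →
      IsPSD q.1 → IsPSD q.2 → ∀ a b : ℝ, 0 ≤ a → 0 ≤ b → a + b = 1 →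
      gap Φ (twoPoint.{u} t) (a • twoValued p.1 p.2 + b • twoValued q.1 q.2) ≤
        a * gap Φ (twoPoint.{u} t) (twoValued p.1 p.2) +
        b * gap Φ (twoPoint.{u} t) (twoValued q.1 q.2)) : JensenGapConvex Φ := by
  intro t h0 h1 d hd
  refine ⟨convex_isPSD_prod, fun p hp q hq a b ha hb hab => ?_⟩
  have := h t h0 h1 d hd p q hp.1 hp.2 hq.1 hq.2 a b ha hb hab
  rwa [← twoValued_combo, gap_twoValued h0 h1, gap_twoValued h0 h1, gap_twoValued h0 h1] at this

theorem jensenGapConvex_of_entropyConvex (h : EntropyConvex.{u} Φ) : JensenGapConvex Φ := by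
  refine jensenGapConvex_of_twoPoint.{u} fun t h0 h1 d hd p q hp1 hp2 hq1 hq2 a b ha hb hab => ?_
  have := isProbabilityMeasure_twoPoint.{u} h0 h1
  have hd' : (0 : ℝ) < (d : ℝ)⁻¹ := inv_pos.2 (Nat.cast_pos.2 hd)
  have hp := entropyDomain_twoValued (t := t) (Φ := Φ) hp1 hp2
  have hq := entropyDomain_twoValued (t := t) (Φ := Φ) hq1 hq2
  have h2 := (h d hd _ (twoPoint t)).2 hp hq ha hb hab
  beta_reduce at h2
  rw [entropy_eq_gap hp, entropy_eq_gap hq,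
    entropy_eq_gap ((h d hd _ (twoPoint t)).1 hp hq ha hb hab), smul_eq_mul, smul_eq_mul] at h2
  rw [← mul_le_mul_iff_right₀ hd']
  linarith

/-- On a finite space the range of `T` does not depend on `Z`, so the entropy is a supremum of affine
functions. -/
theorem jensenGapConvex_of_supRepresentation (h : SupRepresentation.{u} Φ) :
    JensenGapConvex Φ := by
  refine jensenGapConvex_of_twoPoint.{u} fun t h0 h1 d hd p q hp1 hp2 hq1 hq2 a b ha hb hab => ?_
  have := isProbabilityMeasure_twoPoint.{u} h0 h1
  have hd' : (0 : ℝ) < (d : ℝ)⁻¹ := inv_pos.2 (Nat.cast_pos.2 hd)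
  have hp := entropyDomain_twoValued (t := t) (Φ := Φ) hp1 hp2
  have hq := entropyDomain_twoValued (t := t) (Φ := Φ) hq1 hq2
  have hr : EntropyDomain Φ (twoPoint.{u} t) (a • twoValued p.1 p.2 + b • twoValued q.1 q.2) := by
    rw [← twoValued_combo]
    have := convex_isPSD_prod ⟨hp1, hp2⟩ ⟨hq1, hq2⟩ ha hb hab
    exact entropyDomain_twoValued this.1 this.2
  have hlub := h d hd _ (twoPoint t) _ hr
  rw [entropy_eq_gap hr] at hlub
  rw [← mul_le_mul_iff_right₀ hd']
  refine hlub.2 ?_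
  rintro r ⟨T, hT, rfl⟩
  rw [sup_value_eq hT, dual_combo hab .of_finite .of_finite]
  have key : ∀ {W : ULift.{u} Bool → Herm d}, EntropyDomain Φ (twoPoint t) W →
      dual Φ (twoPoint t) T W ≤ gap Φ (twoPoint t) W := by
    intro W hW
    have hTW : SupRange Φ (twoPoint t) W T := ⟨hT.1, hT.2.1, hT.2.2.1, .of_finite⟩
    have := (h d hd _ (twoPoint t) _ hW).1 ⟨T, hTW, rfl⟩
    rw [sup_value_eq hTW, entropy_eq_gap hW] at this
    exact le_of_mul_le_mul_left this hd'
  have hp' := key hp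
  have hq' := key hq
  gcongr

/-- The conditional Jensen inequality on a product of two-point spaces is convexity of the entropy
on two-point spaces. -/
theorem jensenGapConvex_of_gap_integral_le
    (h : ∀ d : ℕ, 1 ≤ d → ∀ (P₁ P₂ : Measure (ULift.{u} Bool)) [IsProbabilityMeasure P₁]
      [IsProbabilityMeasure P₂] (Z : ULift.{u} Bool × ULift.{u} Bool → Herm d), (∀ x, IsPSD (Z x)) →
      gap Φ P₂ (fun x₂ => ∫ x₁, Z (x₁, x₂) ∂P₁) ≤ ∫ x₁, gap Φ P₂ (fun x₂ => Z (x₁, x₂)) ∂P₁) :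
    JensenGapConvex Φ := by
  refine jensenGapConvex_of_twoPoint.{u} fun t h0 h1 d hd p q hp1 hp2 hq1 hq2 a b ha hb hab => ?_
  have : CompleteSpace (Herm d) := FiniteDimensional.complete ℝ (Herm d)
  obtain rfl : b = 1 - a := by linarith
  have ha1 : a ≤ 1 := sub_nonneg.1 hb
  have := isProbabilityMeasure_twoPoint.{u} h0 h1
  have := isProbabilityMeasure_twoPoint.{u} ha ha1
  have h2 := h d hd (twoPoint a) (twoPoint t)
    (fun x => twoValued (twoValued p.1 p.2) (twoValued q.1 q.2) x.1 x.2) (fun x => by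
      obtain ⟨⟨_ | _⟩, ⟨_ | _⟩⟩ := x <;> simpa [twoValued])
  simp only [integral_twoPoint ha ha1] at h2
  exact h2

theorem jensenGapConvex_of_conditionalJensen (h : ConditionalJensen.{u} Φ) :
    JensenGapConvex Φ := by
  refine jensenGapConvex_of_gap_integral_le.{u} fun d hd P₁ P₂ _ _ Z hZ => ?_
  have hd' : (0 : ℝ) < (d : ℝ)⁻¹ := inv_pos.2 (Nat.cast_pos.2 hd)
  have hD : EntropyDomain Φ (P₁.prod P₂) Z := ⟨hZ, .of_finite, .of_finite⟩
  have h2 := h d hd _ _ P₁ P₂ Z hD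
  rw [ge_iff_le, integral_entropy_slice hD, entropy_eq_gap (P := P₂)
    ⟨fun x₂ => isPSD_integral fun x₁ => hZ _, .of_finite, .of_finite⟩] at h2
  exact le_of_mul_le_mul_left h2 hd'

/-- For two variables, subadditivity and the chain rule yield the conditional Jensen inequality. -/
theorem jensenGapConvex_of_entropySubadditive (hconv : ConvexOn ℝ (Ici 0) Φ)
    (hc : ContinuousOn Φ (Ici 0)) (hΦ : ContDiffOn ℝ 2 Φ (Ioi 0))
    (h : EntropySubadditive.{u} Φ) : JensenGapConvex Φ := by
  refine jensenGapConvex_of_gap_integral_le.{u} fun d hd P₁ P₂ _ _ Z hZ => ?_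
  have hd' : (0 : ℝ) < (d : ℝ)⁻¹ := inv_pos.2 (Nat.cast_pos.2 hd)
  let P : Fin 2 → Measure (ULift.{u} Bool) := ![P₂, P₁]
  have hP : ∀ i, IsProbabilityMeasure (P i) := Fin.forall_fin_two.2 ⟨‹_›, ‹_›⟩
  let e := (MeasurableEquiv.piFinTwo fun _ : Fin 2 => ULift.{u} Bool)
  have he : MeasurePreserving e (Measure.pi P) (P₂.prod P₁) := measurePreserving_piFinTwo P
  let W : (Fin 2 → ULift.{u} Bool) → Herm d := fun ω => Z (ω 1, ω 0)
  have hW : EntropyDomain Φ (Measure.pi P) W := ⟨fun _ => hZ _, .of_finite, .of_finite⟩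
  have hZs : EntropyDomain Φ (P₂.prod P₁) (fun x => Z x.swap) :=
    ⟨fun _ => hZ _, .of_finite, .of_finite⟩
  have hgap : gap Φ (P₂.prod P₁) (fun x => Z x.swap) = gap Φ (Measure.pi P) W :=
    gap_comp_equiv W e he
  have hev : ∀ (i : Fin 2) (F : ULift.{u} Bool → ℝ),
      ∫ ω, F (ω i) ∂(Measure.pi P) = ∫ x, F x ∂(P i) := fun i F => by
    have hi : Integrable F (P i) := .of_finite
    have hm := measurePreserving_eval P i
    have := integral_map (μ := Measure.pi P) hm.measurable.aemeasurable
      (by rw [hm.map_eq]; exact hi.aestronglyMeasurable : AEStronglyMeasurable F _)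
    rw [hm.map_eq] at this
    exact this.symm
  have h2 := h d hd 2 _ P W hW
  have e0 : ∀ ω x, W (Function.update ω 0 x) = Z (ω 1, x) := fun ω x => by simp [W]
  have e1 : ∀ ω x, W (Function.update ω 1 x) = Z (x, ω 0) := fun ω x => by simp [W]
  have hs1 : ∀ x₁, entropy Φ P₂ (fun x₂ => Z (x₁, x₂)) =
      (d : ℝ)⁻¹ * gap Φ P₂ (fun x₂ => Z (x₁, x₂)) := fun x₁ =>
    entropy_eq_gap ⟨fun _ => hZ _, .of_finite, .of_finite⟩
  have hs2 : ∀ x₂, entropy Φ P₁ (fun x₁ => Z (x₁, x₂)) =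
      (d : ℝ)⁻¹ * gap Φ P₁ (fun x₁ => Z (x₁, x₂)) := fun x₂ =>
    entropy_eq_gap ⟨fun _ => hZ _, .of_finite, .of_finite⟩
  simp only [Fin.sum_univ_two, e0, e1] at h2
  rw [hev 1 fun x => entropy Φ (P 0) (fun x₂ => Z (x, x₂)),
    hev 0 fun x => entropy Φ (P 1) (fun x₁ => Z (x₁, x))] at h2
  change _ ≤ ∫ x, entropy Φ P₂ (fun x₂ => Z (x, x₂)) ∂P₁ +
    ∫ x, entropy Φ P₁ (fun x₁ => Z (x₁, x)) ∂P₂ at h2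
  simp only [hs1, hs2] at h2
  rw [entropy_eq_gap hW, ← hgap, integral_const_mul, integral_const_mul, ← mul_add,
    gap_prod hconv hc hΦ hZs] at h2
  have h3 := le_of_mul_le_mul_left h2 hd'
  simp only [Prod.swap_prod_mk] at h3
  linarith

end

/-! ### Convexity of the class of entropies -/

section

variable {Φ Φ₁ Φ₂ : ℝ → ℝ} {d : ℕ}

theorem ClassC2.convexOn (h : ClassC2 Φ) : ConvexOn ℝ (Ici 0) Φ := by
  rcases h 1 le_rfl with ⟨a, b, hab⟩ | h
  · refine ⟨convex_Ici 0, fun x hx y hy s t hs ht hst => ?_⟩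
    rw [hab _ hx, hab _ hy, hab _ (convex_Ici 0 hx hy hs ht hst)]
    obtain rfl : t = 1 - s := by linarith
    simp only [smul_eq_mul]
    linarith
  · exact h.1

theorem ClassC2.continuousWithinAt (h : ClassC2 Φ) : ContinuousWithinAt Φ (Ici 0) 0 := by
  rcases h 1 le_rfl with ⟨a, b, hab⟩ | h
  · have : ContinuousOn Φ (Ici 0) :=
      ContinuousOn.congr (f := fun t => a * t + b) (by fun_prop) fun t ht => hab t ht
    exact this 0 (mem_Ici.2 le_rfl)
  · exact h.2.1

theorem ClassC2.contDiffOn (h : ClassC2 Φ) : ContDiffOn ℝ 2 Φ (Ioi 0) := by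
  rcases h 1 le_rfl with ⟨a, b, hab⟩ | h
  · exact ContDiffOn.congr (f := fun t => a * t + b) (by fun_prop) fun t ht => hab t ht.le
  · exact h.2.2.1

theorem classC2_iff_jensenGapConvex (hconv : ConvexOn ℝ (Ici 0) Φ)
    (hcont : ContinuousWithinAt Φ (Ici 0) 0) (hΦ : ContDiffOn ℝ 2 Φ (Ioi 0)) :
    ClassC2 Φ ↔ JensenGapConvex Φ :=
  (classC2_iff_hessConvex hconv hcont hΦ).trans
    (jensenGapConvex_iff_hessConvex (continuousOn_Ici hcont hΦ) hΦ).symm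

theorem matFun_combo (a b : ℝ) (A : Herm d) :
    matFun (a • Φ₁ + b • Φ₂) A = a • matFun Φ₁ A + b • matFun Φ₂ A := by
  rw [matFun_add, matFun_smul, matFun_smul]

theorem JensenGapConvex.combo (h1 : JensenGapConvex Φ₁) (h2 : JensenGapConvex Φ₂) {a b : ℝ}
    (ha : 0 ≤ a) (hb : 0 ≤ b) : JensenGapConvex (a • Φ₁ + b • Φ₂) := by
  intro t h0 ht d hd
  refine (((h1 t h0 ht d hd).smul ha).add ((h2 t h0 ht d hd).smul hb)).congr fun p _ => ?_
  simp only [Pi.add_apply, smul_eq_mul, tr_jensen, matFun_combo, tr_add, tr_smul]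
  ring

theorem convex_classC2 : Convex ℝ {Φ : ℝ → ℝ | ClassC2 Φ} := by
  intro Φ₁ (h1 : ClassC2 Φ₁) Φ₂ (h2 : ClassC2 Φ₂) a b ha hb _
  have j1 := (classC2_iff_jensenGapConvex h1.convexOn h1.continuousWithinAt h1.contDiffOn).1 h1
  have j2 := (classC2_iff_jensenGapConvex h2.convexOn h2.continuousWithinAt h2.contDiffOn).1 h2
  refine (classC2_iff_jensenGapConvex ((h1.convexOn.smul ha).add (h2.convexOn.smul hb))
    ((h1.continuousWithinAt.const_smul a).add (h2.continuousWithinAt.const_smul b))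
    ((h1.contDiffOn.const_smul a).add (h2.contDiffOn.const_smul b))).2 (j1.combo j2 ha hb)

theorem entropy_combo {Ω : Type u} [MeasurableSpace Ω] {P : Measure Ω} {Z : Ω → Herm d}
    (h1 : EntropyDomain Φ₁ P Z) (h2 : EntropyDomain Φ₂ P Z) (a b : ℝ) :
    EntropyDomain (a • Φ₁ + b • Φ₂) P Z ∧
      entropy (a • Φ₁ + b • Φ₂) P Z = a * entropy Φ₁ P Z + b * entropy Φ₂ P Z := by
  have hD : EntropyDomain (a • Φ₁ + b • Φ₂) P Z := by
    refine ⟨h1.1, h1.2.1, ?_⟩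
    simp only [matFun_combo]
    exact (h1.2.2.smul a).add (h2.2.2.smul b)
  refine ⟨hD, ?_⟩
  rw [entropy_eq_gap hD, entropy_eq_gap h1, entropy_eq_gap h2]
  simp only [gap, matFun_combo, tr_add, tr_smul]
  rw [integral_add ((integrable_tr h1.2.2).const_mul a) ((integrable_tr h2.2.2).const_mul b),
    integral_const_mul, integral_const_mul]
  ring

theorem entropiesConvexSet : EntropiesConvexSet.{u} :=
  ⟨convex_classC2, fun _ _ _ _ θ _ _ _ _ _ _ _ _ _ h1 h2 => entropy_combo h1 h2 θ (1 - θ)⟩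

end

end

end MatrixPhiEntropy

open MatrixPhiEntropy
theorem theorem3p3 (Φ : ℝ → ℝ) (hconv : ConvexOn ℝ (Set.Ici 0) Φ)
    (hcont : ContinuousWithinAt Φ (Set.Ici 0) 0) (hdiff : ContDiffOn ℝ 2 Φ (Set.Ioi 0)) :
    List.TFAE
      [ ClassC2 Φ,
        BregmanConvex Φ,
        DerivDiffConvex Φ,
        SecondDerivConvex Φ,
        JensenGapConvex Φ,
        ConditionalJensen.{u} Φ,
        EntropyConvex.{u} Φ,
        SupRepresentation.{u} Φ,
        EntropySubadditive.{u} Φ ] ∧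
    (ContDiffOn ℝ 4 Φ (Set.Ioi 0) → (ClassC2 Φ ↔ ThirdDerivIneq Φ)) ∧
    EntropiesConvexSet.{u} := by
  have hc := continuousOn_Ici hcont hdiff
  have hJ := jensenGapConvex_iff_hessConvex hc hdiff
  refine ⟨?_, fun h4 => classC2_iff_thirdDerivIneq hconv hcont h4, entropiesConvexSet⟩
  tfae_have 1 ↔ 5 := classC2_iff_jensenGapConvex hconv hcont hdiff
  tfae_have 2 ↔ 5 := (bregmanConvex_iff_hessConvex hdiff).trans hJ.symm
  tfae_have 3 ↔ 5 := (derivDiffConvex_iff_hessConvex hdiff).trans hJ.symm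
  tfae_have 4 ↔ 5 := (secondDerivConvex_iff hdiff).trans hJ.symm
  tfae_have 5 → 6 := fun h => conditionalJensen_of_hessConvex hconv hc hdiff (hJ.1 h)
  tfae_have 5 → 7 := fun h => entropyConvex_of_hessConvex hconv hc hdiff (hJ.1 h)
  tfae_have 5 → 8 := fun h => supRepresentation_of_hessConvex hconv hc hdiff (hJ.1 h)
  tfae_have 5 → 9 := fun h => entropySubadditive_of_hessConvex hconv hc hdiff (hJ.1 h)
  tfae_have 6 → 5 := jensenGapConvex_of_conditionalJensen
  tfae_have 7 → 5 := jensenGapConvex_of_entropyConvex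
  tfae_have 8 → 5 := jensenGapConvex_of_supRepresentation
  tfae_have 9 → 5 := jensenGapConvex_of_entropySubadditive hconv hc hdiff
  tfae_finish
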